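/- **Theorem (a real-RAM analogue of the Cook–Levin theorem).** For every discrete decision problem $Q$: there is a real verification algorithm for $Q$ if and only if $Q\in\exists\mathbb{R}$. This holds both for the real RAM with and for the real RAM without the square root instruction. The notions are as follows. *Real RAM.* For a word size $w$, a word is an integer in $\{0,\dots,2^w-1\}$. Memory consists of word registers $W[0],\dots,W[2^w-1]$, which hold words, and real registers $R[0],\dots,R[2^w-1]$, which hold exact real numbers. A program is a finite sequence of instructions that does not depend on $w$ or on the input. The instructions, with constant words $i,j,k$ and an instruction index $\ell$, are: $W[i]\gets j$, $W[i]\gets W[j]$, $W[W[i]]\gets W[j]$, $W[i]\gets W[W[j]]$; $W[i]\gets W[j]\boxplus W[k]$, where $\boxplus$ is one of addition, subtraction, lower multiplication (all mod $2^w$), upper multiplication $\lfloor yz/2^w\rfloor$, $\lfloor y/z\rfloor$ and $y \bmod z$ (both for $z\neq0$ only), bitwise nand; $R[i]\gets 0$, $R[i]\gets 1$, $R[i]\gets R[j]$, $R[W[i]]\gets R[j]$, $R[i]\gets R[W[j]]$, $R[i]\gets j$, $R[i]\gets W[j]$; $R[i]\gets R[j]\oplus R[k]$ with $\oplus\in\{+,-,\cdot,/\}$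 (division by nonzero numbers only); optionally $R[i]\gets\sqrt{R[j]}$ (for $R[j]\ge0$ only); "if $W[i]=W[j]$ goto $\ell$", "if $W[i]<W[j]$ goto $\ell$", "if $R[i]=0$ goto $\ell$", "if $R[i]>0$ goto $\ell$", "goto $\ell$", "halt", "accept", "reject". Each instruction takes one time step; the machine gets stuck, without halting, on an undefined operation, on a constant that is not a word, or if the program counter leaves the program. On input $(x,b)$, where $x$ is a real vector and $b$ a vector of words, initially $R[i]=x_i$ and $W[i]=b_i$, and all other registers are $0$. The *word RAM* is the same machine without the instructions that involve real registers. *Instances.* A discrete decision problem is a function $Q$ from integer vectors (of arbitrary length and with arbitrary entries) to $\{\text{True},\text{False}\}$. An instance $I$ is presented to a machine as a sequence of words from $\{0,1\}$, again denoted by $I$: each entry is written as its sign bit followed by the binary digits of its absolute value, least significant first, each bit $\beta$ being written as the two words $1\,\beta$, and is terminated by $0\,1$; the vector is terminated by $0\,0$. The size $n$ of $I$ is the number of these words (so $n\ge2$). *Real verification algorithm.* A real verification algorithm for $Q$ is a real RAM program $A$ such that, for some integer constant $c\ge1$: (1) given any input $(x,b)$ of total length $N=|x|+|b|\ge2$ whose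 words are words of size $w=\lceil c\log_2N\rceil$, $A$ run with this word size halts (by halt, accept or reject) after at most $N^c$ time steps; (2) for every yes-instance $I$ of size $n$ there are a real vector $x$ and a vector $z$ of words, each of length at most $n^c$, such that $A$ accepts the input $(x,I\circ z)$; (3) for every no-instance $I$, every real vector $x$ and every vector $z$ of words, $A$ rejects the input $(x,I\circ z)$. Here $\circ$ is concatenation, and in (2) and (3) too the word size is $\lceil c\log_2N\rceil$, where $N$ is the total length of the input, and the entries of $z$ are words of that size. *The class $\exists\mathbb{R}$.* An ETR formula is $\exists x_0,x_1,\ldots\;\Phi$, where $\Phi$ is quantifier-free and built from the symbols $0,1,+,\cdot,=,\le,<,\land,\lor,\lnot$ and variables; it is true if some real values of its variables satisfy $\Phi$. It is represented by the string of symbols of $\Phi$ in prefix notation, one word per symbol ($0,1,+,\cdot,=,\le,<,\land,\lor,\lnot$ are numbered $0,\dots,9$, and $x_i$ has number $10+i$). $Q\in\exists\mathbb{R}$ means that there are a word RAM program $P$ and an integer constant $c\ge1$ such that for every instance $I$, of size $n$, the program $P$ on input $I$ with word size $\lceil c\log_2n\rceil$ executes "halt" after at most $n^c$ time steps, and then the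 word memory starts with the representation of an ETR formula (which fits into the $2^w$ registers) that is true if and only if $I$ is a yes-instance of $Q$. -/

import Mathlib

namespace RealRAM

/-! ## The real RAM -/

/-- Binary word operations. -/
inductive WordOp where
  | add | sub | mulLow | mulHigh | div | mod | nand

/-- Result of a word operation at word size `w`; a word is a natural number below `2 ^ w`.
`none` means that the operation is undefined (division by zero). -/
def WordOp.eval (w : ℕ) : WordOp → ℕ → ℕ → Option ℕ
  | .add, y, z => some ((y + z) % 2 ^ w)
  | .sub, y, z => some ((y + 2 ^ w - z) % 2 ^ w)
  | .mulLow, y, z => some (y * z % 2 ^ w)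
  | .mulHigh, y, z => some (y * z / 2 ^ w)
  | .div, y, z => if z = 0 then none else some (y / z)
  | .mod, y, z => if z = 0 then none else some (y % z)
  | .nand, y, z => some (2 ^ w - ((y &&& z) + 1))

/-- Bitwise nand does what its name says on each of the `w` bits of a word. -/
theorem WordOp.nand_testBit (w y z : ℕ) (hy : y < 2 ^ w) (b : ℕ) :
    (2 ^ w - ((y &&& z) + 1)).testBit b = (decide (b < w) && !(y.testBit b && z.testBit b)) := by
  rw [Nat.testBit_two_pow_sub_succ (lt_of_le_of_lt Nat.and_le_left hy), Nat.testBit_and]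

/-- Binary exact real operations. -/
inductive RealOp where
  | add | sub | mul | div

/-- Result of a real operation; `none` means that it is undefined (division by zero). -/
noncomputable def RealOp.eval : RealOp → ℝ → ℝ → Option ℝ
  | .add, y, z => some (y + z)
  | .sub, y, z => some (y - z)
  | .mul, y, z => some (y * z)
  | .div, y, z => if z = 0 then none else some (y / z)

/-- The instructions. `i j k` are constant words, `l` is an instruction index. -/
inductive Instr where
  /-- `W[i] ← j` -/
  | wConst (i j : ℕ)
  /-- `W[i] ← W[j]` -/
  | wCopy (i j : ℕ)
  /-- `W[W[i]] ← W[j]` -/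
  | wStore (i j : ℕ)
  /-- `W[i] ← W[W[j]]` -/
  | wLoad (i j : ℕ)
  /-- `W[i] ← W[j] op W[k]` -/
  | wArith (op : WordOp) (i j k : ℕ)
  /-- `if W[i] = W[j] goto l` -/
  | wIfEq (i j l : ℕ)
  /-- `if W[i] < W[j] goto l` -/
  | wIfLt (i j l : ℕ)
  /-- `R[i] ← 0` -/
  | rZero (i : ℕ)
  /-- `R[i] ← 1` -/
  | rOne (i : ℕ)
  /-- `R[i] ← R[j]` -/
  | rCopy (i j : ℕ)
  /-- `R[W[i]] ← R[j]` -/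
  | rStore (i j : ℕ)
  /-- `R[i] ← R[W[j]]` -/
  | rLoad (i j : ℕ)
  /-- `R[i] ← j` -/
  | rCastConst (i j : ℕ)
  /-- `R[i] ← W[j]` -/
  | rCastWord (i j : ℕ)
  /-- `R[i] ← R[j] op R[k]` -/
  | rArith (op : RealOp) (i j k : ℕ)
  /-- `R[i] ← √R[j]` -/
  | rSqrt (i j : ℕ)
  /-- `if R[i] = 0 goto l` -/
  | rIfZero (i l : ℕ)
  /-- `if R[i] > 0 goto l` -/
  | rIfPos (i l : ℕ)
  | goto (l : ℕ)
  | halt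
  | accept
  | reject

/-- The constant words that occur in an instruction. -/
def Instr.words : Instr → List ℕ
  | .wConst i j | .wCopy i j | .wStore i j | .wLoad i j => [i, j]
  | .wArith _ i j k => [i, j, k]
  | .wIfEq i j _ | .wIfLt i j _ => [i, j]
  | .rZero i | .rOne i => [i]
  | .rCopy i j | .rStore i j | .rLoad i j | .rCastConst i j | .rCastWord i j => [i, j]
  | .rArith _ i j k => [i, j, k]
  | .rSqrt i j => [i, j]
  | .rIfZero i _ | .rIfPos i _ => [i]
  | .goto _ | .halt | .accept | .reject => []

/-- The instructions of the word RAM: those that do not touch a real register. -/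
def Instr.IsWord : Instr → Prop
  | .wConst _ _ | .wCopy _ _ | .wStore _ _ | .wLoad _ _ | .wArith _ _ _ _
  | .wIfEq _ _ _ | .wIfLt _ _ _ | .goto _ | .halt | .accept | .reject => True
  | _ => False

/-- The (optional) square root instruction. -/
def Instr.IsSqrt : Instr → Prop
  | .rSqrt _ _ => True
  | _ => False

/-- A program is a finite sequence of instructions, indexed from `0`. -/
abbrev Program := List Instr

/-- Program counter and contents of the two register arrays. At word size `w` only the addresses
below `2 ^ w` are ever accessed. -/
structure Config where
  pc : ℕ
  W : ℕ → ℕ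
  R : ℕ → ℝ

/-- Write `v` into `W[i]` and go to the next instruction. -/
def Config.setW (s : Config) (i v : ℕ) : Config :=
  { pc := s.pc + 1, W := Function.update s.W i v, R := s.R }

/-- Write `v` into `R[i]` and go to the next instruction. -/
noncomputable def Config.setR (s : Config) (i : ℕ) (v : ℝ) : Config :=
  { pc := s.pc + 1, W := s.W, R := Function.update s.R i v }

/-- Go to instruction `l`. -/
def Config.jump (s : Config) (l : ℕ) : Config :=
  { pc := l, W := s.W, R := s.R }

/-- Go to instruction `l` if `p` holds and to the next instruction otherwise. -/
noncomputable def Config.jumpIf (s : Config) (p : Prop) [Decidable p] (l : ℕ) : Config :=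
  if p then s.jump l else s.jump (s.pc + 1)

/-- Effect of one instruction at word size `w`; `none` if the machine stops, either because the
instruction is `halt`, `accept` or `reject`, or because the operation is undefined. -/
noncomputable def Instr.exec (w : ℕ) (s : Config) : Instr → Option Config
  | .wConst i j => some (s.setW i j)
  | .wCopy i j => some (s.setW i (s.W j))
  | .wStore i j => some (s.setW (s.W i) (s.W j))
  | .wLoad i j => some (s.setW i (s.W (s.W j)))
  | .wArith op i j k => (op.eval w (s.W j) (s.W k)).map (s.setW i)
  | .wIfEq i j l => some (s.jumpIf (s.W i = s.W j) l)
  | .wIfLt i j l => some (s.jumpIf (s.W i < s.W j) l)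
  | .rZero i => some (s.setR i 0)
  | .rOne i => some (s.setR i 1)
  | .rCopy i j => some (s.setR i (s.R j))
  | .rStore i j => some (s.setR (s.W i) (s.R j))
  | .rLoad i j => some (s.setR i (s.R (s.W j)))
  | .rCastConst i j => some (s.setR i (j : ℝ))
  | .rCastWord i j => some (s.setR i (s.W j : ℝ))
  | .rArith op i j k => (op.eval (s.R j) (s.R k)).map (s.setR i)
  | .rSqrt i j => if 0 ≤ s.R j then some (s.setR i (Real.sqrt (s.R j))) else none
  | .rIfZero i l => some (s.jumpIf (s.R i = 0) l)
  | .rIfPos i l => some (s.jumpIf (0 < s.R i) l)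
  | .goto l => some (s.jump l)
  | .halt => none
  | .accept => none
  | .reject => none

/-- One time step at word size `w`. An instruction can be executed only if its constants are
`w`-bit words. -/
noncomputable def step (P : Program) (w : ℕ) (s : Config) : Option Config :=
  match P[s.pc]? with
  | none => none
  | some ins => if ∀ a ∈ ins.words, a < 2 ^ w then ins.exec w s else none

/-- The configuration after exactly `t` time steps, if the machine gets that far. -/
noncomputable def run (P : Program) (w : ℕ) : ℕ → Config → Option Config
  | 0, s => some s
  | t + 1, s => (step P w s).bind (run P w t)

/-- The initial configuration on input `(x, b)`: `R[i] = x_i` and `W[i] = b_i`, all other registers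
are zero. -/
noncomputable def init (x : List ℝ) (b : List ℕ) : Config :=
  { pc := 0, W := fun i => b.getD i 0, R := fun i => x.getD i 0 }

/-- On input `(x, b)` at word size `w`, the program executes `t` instructions, reaches the
configuration `s`, and there meets the stopping instruction `ins`. -/
def StopsAt (P : Program) (w : ℕ) (x : List ℝ) (b : List ℕ) (t : ℕ) (s : Config)
    (ins : Instr) : Prop :=
  run P w t (init x b) = some s ∧ P[s.pc]? = some ins

/-- The program halts within `T` time steps. -/
def HaltsWithin (P : Program) (w : ℕ) (x : List ℝ) (b : List ℕ) (T : ℕ) : Prop :=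
  ∃ t ≤ T, ∃ s, StopsAt P w x b t s .halt ∨ StopsAt P w x b t s .accept ∨
    StopsAt P w x b t s .reject

/-- The program accepts the input. -/
def Accepts (P : Program) (w : ℕ) (x : List ℝ) (b : List ℕ) : Prop :=
  ∃ t s, StopsAt P w x b t s .accept

/-- The program rejects the input. -/
def Rejects (P : Program) (w : ℕ) (x : List ℝ) (b : List ℕ) : Prop :=
  ∃ t s, StopsAt P w x b t s .reject

/-- The word size `⌈c log₂ N⌉`, as the least `k` with `N ^ c ≤ 2 ^ k`. -/
def wordSize (c N : ℕ) : ℕ := Nat.clog 2 (N ^ c)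

theorem wordSize_eq_ceil (c N : ℕ) : wordSize c N = ⌈(c : ℝ) * Real.logb 2 N⌉₊ := by
  have h := Real.natCeil_logb_natCast 2 (N ^ c)
  rw [wordSize, ← h]
  simp [Real.logb_pow]

/-! ## Discrete decision problems -/

/-- A discrete decision problem: a function from integer vectors to the booleans. -/
abbrev DecisionProblem := List ℤ → Bool

/-- An integer as a sequence of words: its sign bit, then the binary digits of its absolute value
(least significant first, none for `0`), each bit `β` written as the two words `1 β`; then `0 1`. -/
def encodeInt (z : ℤ) : List ℕ :=
  (decide (z < 0) :: z.natAbs.bits).flatMap (fun β => [1, β.toNat]) ++ [0, 1]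

/-- The sequence of words that represents an integer vector in memory: the codes of its entries, and
`0 0` to mark the end of the vector. All these words are `0` or `1`, and no code is a proper prefix
of another one. -/
def encode (I : List ℤ) : List ℕ := I.flatMap encodeInt ++ [0, 0]

/-- `P` is a real verification algorithm for `Q` with constant `c`. The size of an instance `I` is
the number of words of its code; certificates are a real vector `x` and a vector `z` of words. -/
structure IsRealVerifier (Q : DecisionProblem) (P : Program) (c : ℕ) : Prop where
  halts : ∀ (x : List ℝ) (b : List ℕ), 2 ≤ x.length + b.length →
    (∀ v ∈ b, v < 2 ^ wordSize c (x.length + b.length)) →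
    HaltsWithin P (wordSize c (x.length + b.length)) x b ((x.length + b.length) ^ c)
  complete : ∀ I : List ℤ, Q I = true → ∃ (x : List ℝ) (z : List ℕ),
    x.length ≤ (encode I).length ^ c ∧ z.length ≤ (encode I).length ^ c ∧
    (∀ v ∈ z, v < 2 ^ wordSize c (x.length + (encode I ++ z).length)) ∧
    Accepts P (wordSize c (x.length + (encode I ++ z).length)) x (encode I ++ z)
  sound : ∀ I : List ℤ, Q I = false → ∀ (x : List ℝ) (z : List ℕ),
    (∀ v ∈ z, v < 2 ^ wordSize c (x.length + (encode I ++ z).length)) →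
    Rejects P (wordSize c (x.length + (encode I ++ z).length)) x (encode I ++ z)

/-- `Q` has a real verification algorithm; square roots are available iff `allowSqrt`. -/
def HasRealVerifier (allowSqrt : Bool) (Q : DecisionProblem) : Prop :=
  ∃ (P : Program) (c : ℕ), 1 ≤ c ∧ (allowSqrt = false → ∀ ins ∈ P, ¬ ins.IsSqrt) ∧
    IsRealVerifier Q P c

/-! ## The existential theory of the reals -/

/-- Terms over `0, 1, +, ·` and the variables `x₀, x₁, …`. -/
inductive Term where
  | zero
  | one
  | var (i : ℕ)
  | add (s t : Term)
  | mul (s t : Term)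

/-- Value of a term in `ℝ`. -/
noncomputable def Term.eval (v : ℕ → ℝ) : Term → ℝ
  | .zero => 0
  | .one => 1
  | .var i => v i
  | .add s t => s.eval v + t.eval v
  | .mul s t => s.eval v * t.eval v

/-- Quantifier-free formulas over the reals. -/
inductive Formula where
  | eq (s t : Term)
  | le (s t : Term)
  | lt (s t : Term)
  | and (φ ψ : Formula)
  | or (φ ψ : Formula)
  | not (φ : Formula)

/-- Truth of a quantifier-free formula at a point. -/
def Formula.Holds (v : ℕ → ℝ) : Formula → Prop
  | .eq s t => s.eval v = t.eval v
  | .le s t => s.eval v ≤ t.eval v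
  | .lt s t => s.eval v < t.eval v
  | .and φ ψ => φ.Holds v ∧ ψ.Holds v
  | .or φ ψ => φ.Holds v ∨ ψ.Holds v
  | .not φ => ¬ φ.Holds v

/-- Truth of the sentence `∃ x₀ x₁ …, φ`. -/
def Formula.ETRTrue (φ : Formula) : Prop := ∃ v : ℕ → ℝ, φ.Holds v

/-- A term as a string over `0, 1, +, ·, =, ≤, <, ∧, ∨, ¬, x₀, x₁, …` in prefix (bracket-free)
notation, with these symbols numbered `0, 1, 2, …` in this order. -/
def Term.code : Term → List ℕ
  | .zero => [0]
  | .one => [1]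
  | .var i => [10 + i]
  | .add s t => 2 :: (s.code ++ t.code)
  | .mul s t => 3 :: (s.code ++ t.code)

/-- A formula as a string, in the same notation. -/
def Formula.code : Formula → List ℕ
  | .eq s t => 4 :: (s.code ++ t.code)
  | .le s t => 5 :: (s.code ++ t.code)
  | .lt s t => 6 :: (s.code ++ t.code)
  | .and φ ψ => 7 :: (φ.code ++ ψ.code)
  | .or φ ψ => 8 :: (φ.code ++ ψ.code)
  | .not φ => 9 :: φ.code

/-- At word size `w` the word memory of `s` starts with the string `u`, one symbol per register. -/
def Config.Outputs (w : ℕ) (s : Config) (u : List ℕ) : Prop :=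
  u.length ≤ 2 ^ w ∧ ∀ i, (h : i < u.length) → s.W i = u[i]

/-- `Q` belongs to `∃ℝ`: some word RAM program transforms each instance `I`, in time polynomial in
the size `n` of `I` and at word size `⌈c log₂ n⌉`, into an ETR formula that is true iff `I` is a
yes-instance of `Q`. -/
def InExistsR (Q : DecisionProblem) : Prop :=
  ∃ (P : Program) (c : ℕ), 1 ≤ c ∧ (∀ ins ∈ P, ins.IsWord) ∧
    ∀ I : List ℤ, ∃ φ : Formula, (φ.ETRTrue ↔ Q I = true) ∧
      ∃ t ≤ (encode I).length ^ c, ∃ s : Config,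
        StopsAt P (wordSize c (encode I).length) [] (encode I) t s .halt ∧
        s.Outputs (wordSize c (encode I).length) φ.code

end RealRAM

/-!
A real verification algorithm and a system of polynomial conditions can be translated into each other,
for the same reason as in the Cook–Levin theorem: the run of a machine is described by a tableau, and
a formula can be evaluated by a machine.

*From verification algorithms to formulas.* The verification algorithm stops after at most `N ^ c`
steps on inputs of length `N`, and a word size of `⌈c log₂ N⌉` means that there are fewer than
`2 * N ^ c` registers of each kind. So the run is described by polynomially many real variables: one for
every register and every time, together with the program counter and the address and value of the
write operation at that time. That these variables describe a run is a quantifier-free condition of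
polynomial size; indirect addressing and word operations are described by conjunctions over all words
or pairs of words, division by `z * y = x`, and a square root by `0 ≤ z` and `z * z = x`. The lengths
of the certificates and the number of registers are guessed by a disjunction. Since the verification
algorithm halts on all inputs, it never gets stuck, and partial operations need no special treatment.
The formula is true iff some certificate is accepted, hence iff the instance is a yes-instance
(`verifierScheme_etrTrue_iff`).

The formula must also be produced by a word RAM. It is therefore written as a `FormulaScheme`, with
bounded quantifiers whose bounds, and whose numerals and indices of variables, are arithmetic
expressions. A scheme is at the same time a description of a loop program that outputs its instances,
and the time bound and the length bound are read off from the scheme (`FormulaScheme.gen_spec`,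
`FormulaScheme.length_le`). Together this is `IsRealVerifier.inExistsR`.

*From formulas to verification algorithms.* Given a word RAM reduction, the verification algorithm
finds the end of the instance in its input, simulates the reduction at the word size of the reduction
(`simulate_spec`), and evaluates the resulting formula at the point given by the real certificate, with
a stack of real numbers on which truth values are represented by `0` and `1`
(`foldr_evalSymbol_formula`, `evaluate_spec`). No square roots are used. On inputs that do not start
with an instance, the simulation is cut off by a clock, and whatever is in the memory is evaluated, so
that the algorithm still halts in time (`verifier_stopsAt`). A formula of the reduction contains only
polynomially many variables, because their symbols fit into words. Together this is
`InExistsR.hasRealVerifier`.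

*Programming.* Both programs are written in a structured language `Cmd` with word variables, scratch
registers for the evaluation of expressions, and a memory; the translation into machine code preserves
the meaning and the number of steps (`Cmd.Big.run_code`). The variables occupy the first registers, in
which the input is given, so these are saved first: the reduction packs `64` bits into one word, and
the verification algorithm, whose input may consist of arbitrary words, copies them to real registers.
-/

namespace RealRAM

/-! ### Runs of the machine -/

theorem run_add (P : Program) (w t₁ t₂ : ℕ) (s : Config) :
    run P w (t₁ + t₂) s = (run P w t₁ s).bind (run P w t₂) := by
  induction t₁ generalizing s with
  | zero => simp [run]
  | succ t ih =>
    rw [Nat.succ_add]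
    simp only [run, Option.bind_assoc]
    congr 1
    funext s'
    exact ih s'

theorem run_trans {P : Program} {w t₁ t₂ : ℕ} {s s₁ s₂ : Config} (h₁ : run P w t₁ s = some s₁)
    (h₂ : run P w t₂ s₁ = some s₂) : run P w (t₁ + t₂) s = some s₂ := by
  rw [run_add, h₁]; exact h₂

theorem run_one {P : Program} {w : ℕ} {s s₁ : Config} (h : step P w s = some s₁) :
    run P w 1 s = some s₁ := by
  simp [run, h]

/-- The instructions `L` stand in the program `P` from index `off` on. -/
def CodeAt (P : Program) (off : ℕ) (L : List Instr) : Prop :=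
  ∃ pre post, P = pre ++ L ++ post ∧ pre.length = off

theorem CodeAt.left {P : Program} {off : ℕ} {L L' : List Instr} (h : CodeAt P off (L ++ L')) :
    CodeAt P off L := by
  obtain ⟨pre, post, rfl, rfl⟩ := h
  exact ⟨pre, L' ++ post, by simp, rfl⟩

theorem CodeAt.right {P : Program} {off : ℕ} {L L' : List Instr} (h : CodeAt P off (L ++ L')) :
    CodeAt P (off + L.length) L' := by
  obtain ⟨pre, post, rfl, rfl⟩ := h
  exact ⟨pre ++ L, post, by simp, by simp⟩

theorem CodeAt.head {P : Program} {off : ℕ} {i : Instr} {L : List Instr}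
    (h : CodeAt P off (i :: L)) : P[off]? = some i := by
  obtain ⟨pre, post, rfl, rfl⟩ := h
  simp

theorem CodeAt.tail {P : Program} {off : ℕ} {i : Instr} {L : List Instr}
    (h : CodeAt P off (i :: L)) : CodeAt P (off + 1) L :=
  CodeAt.right (L := [i]) h

/-- All constants of the program are words of size `w`. -/
def GoodWords (P : Program) (w : ℕ) : Prop := ∀ ins ∈ P, ∀ a ∈ ins.words, a < 2 ^ w

theorem step_eq {P : Program} {w : ℕ} (hP : GoodWords P w) {s : Config} {ins : Instr}
    (h : P[s.pc]? = some ins) : step P w s = ins.exec w s := by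
  rw [step, h]
  exact if_pos (hP ins (List.mem_of_getElem? h))

/-- A version of `step_eq` that exposes the program counter as a separate variable. -/
theorem run_instr {P : Program} {w : ℕ} (hP : GoodWords P w) {s s' : Config} {off : ℕ}
    {ins : Instr} {L : List Instr} (hc : CodeAt P off (ins :: L)) (hs : s.pc = off)
    (he : ins.exec w s = some s') : run P w 1 s = some s' :=
  run_one (by rw [step_eq hP (hs ▸ hc.head), he])

/-! ### Arithmetic expressions over word variables -/

/-- Binary operations of the expression language, all of them total on the natural numbers. -/
inductive BinOp where
  | add | mul | divS | modS | land

/-- Division and remainder are taken with respect to the successor of the second operand, so that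
they are never undefined. -/
def BinOp.eval : BinOp → ℕ → ℕ → ℕ
  | .add, a, b => a + b
  | .mul, a, b => a * b
  | .divS, a, b => a / (b + 1)
  | .modS, a, b => a % (b + 1)
  | .land, a, b => a &&& b

/-- Code that replaces the content of register `d` by the result of the operation on the registers
`d` and `d + 1`. -/
def BinOp.code (d : ℕ) : BinOp → List Instr
  | .add => [.wArith .add d d (d + 1)]
  | .mul => [.wArith .mulLow d d (d + 1)]
  | .divS => [.wConst (d + 2) 1, .wArith .add (d + 1) (d + 1) (d + 2), .wArith .div d d (d + 1)]
  | .modS => [.wConst (d + 2) 1, .wArith .add (d + 1) (d + 1) (d + 2), .wArith .mod d d (d + 1)]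
  | .land => [.wArith .nand d d (d + 1), .wArith .nand d d d]

/-- Arithmetic expressions over word variables. -/
inductive WExpr where
  | const (k : ℕ)
  | var (i : ℕ)
  | op (o : BinOp) (e f : WExpr)

namespace WExpr

/-- Value of an expression in the natural numbers, without reduction modulo the number of words. -/
def eval (V : ℕ → ℕ) : WExpr → ℕ
  | const k => k
  | var i => V i
  | op o e f => o.eval (e.eval V) (f.eval V)

/-- No subexpression overflows at word size `w`, even after adding `1`. -/
def Ok (w : ℕ) (V : ℕ → ℕ) : WExpr → Prop
  | const k => k + 1 < 2 ^ w
  | var i => V i + 1 < 2 ^ w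
  | op o e f => e.Ok w V ∧ f.Ok w V ∧ o.eval (e.eval V) (f.eval V) + 1 < 2 ^ w

/-- Code that computes the value of an expression in register `d`, with the registers above `d` as
scratch space. -/
def code (d : ℕ) : WExpr → List Instr
  | const k => [.wConst d k]
  | var i => [.wCopy d i]
  | op o e f => e.code d ++ (f.code (d + 1) ++ o.code d)

/-- The length of the code, which does not depend on `d`. -/
def len : WExpr → ℕ
  | const _ => 1
  | var _ => 1
  | op o e f => e.len + (f.len + (o.code 0).length)

/-- The variables of the expression are below `32`, and its code with target `d` stays below
register `64`. -/
def WF (d : ℕ) : WExpr → Prop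
  | const _ => d < 64
  | var i => i < 32 ∧ d < 64
  | op _ e f => e.WF d ∧ f.WF (d + 1) ∧ d + 2 < 64

theorem length_code (e : WExpr) (d : ℕ) : (e.code d).length = e.len := by
  induction e generalizing d with
  | const k => rfl
  | var i => rfl
  | op o e f he hf =>
    have : (o.code d).length = (o.code 0).length := by cases o <;> rfl
    simp [code, len, he, hf, this]

theorem Ok.eval_lt {w : ℕ} {V : ℕ → ℕ} {e : WExpr} (h : e.Ok w V) : e.eval V + 1 < 2 ^ w := by
  cases e with
  | const k => exact h
  | var i => exact h
  | op o e f => exact h.2.2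

end WExpr

theorem nand_nand {w y z : ℕ} (hy : y < 2 ^ w) :
    2 ^ w - (((2 ^ w - ((y &&& z) + 1)) &&& (2 ^ w - ((y &&& z) + 1))) + 1) = y &&& z := by
  have : y &&& z ≤ y := Nat.and_le_left
  rw [Nat.and_self]
  omega

theorem BinOp.run_code {P : Program} {w : ℕ} (hP : GoodWords P w) (o : BinOp) {off d a b : ℕ}
    {s : Config} (hc : CodeAt P off (o.code d)) (hs : s.pc = off)
    (ha : s.W d = a) (hb : s.W (d + 1) = b) (ha' : a < 2 ^ w) (hb' : b + 1 < 2 ^ w)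
    (ho : o.eval a b < 2 ^ w) :
    ∃ s', run P w (o.code d).length s = some s' ∧ s'.pc = off + (o.code d).length ∧
      s'.W d = o.eval a b ∧ (∀ i, i < d ∨ d + 2 < i → s'.W i = s.W i) ∧ s'.R = s.R := by
  have upd : ∀ (W : ℕ → ℕ) (i j v : ℕ), i ≠ j → Function.update W j v i = W i :=
    fun W i j v h => Function.update_of_ne h _ _
  cases o with
  | add =>
    refine ⟨s.setW d (a + b), run_instr hP hc hs ?_, by simp [Config.setW, hs, code],
      by simp [Config.setW, eval], ?_, rfl⟩
    · simp [Instr.exec, WordOp.eval, ha, hb]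
      rw [Nat.mod_eq_of_lt (show a + b < 2 ^ w from ho)]
    · intro i hi
      exact upd _ _ _ _ (by omega)
  | mul =>
    refine ⟨s.setW d (a * b), run_instr hP hc hs ?_, by simp [Config.setW, hs, code],
      by simp [Config.setW, eval], ?_, rfl⟩
    · simp [Instr.exec, WordOp.eval, ha, hb]
      rw [Nat.mod_eq_of_lt (show a * b < 2 ^ w from ho)]
    · intro i hi
      exact upd _ _ _ _ (by omega)
  | divS =>
    subst hs
    have r₁ := run_instr (s' := s.setW (d + 2) 1) hP hc rfl rfl
    have r₂ := run_instr (s := s.setW (d + 2) 1) (s' := (s.setW (d + 2) 1).setW (d + 1) (b + 1))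
      hP hc.tail rfl
      (by simp [Instr.exec, WordOp.eval, Config.setW, hb, Nat.mod_eq_of_lt hb'])
    have r₃ := run_instr (s := (s.setW (d + 2) 1).setW (d + 1) (b + 1))
      (s' := ((s.setW (d + 2) 1).setW (d + 1) (b + 1)).setW d (a / (b + 1))) hP hc.tail.tail rfl
      (by simp [Instr.exec, WordOp.eval, Config.setW, ha])
    refine ⟨_, run_trans (run_trans r₁ r₂) r₃,
      by simp [Config.setW, code], by simp [Config.setW, eval], ?_, rfl⟩
    · intro i hi
      simp only [Config.setW]
      rw [upd _ _ _ _ (by omega), upd _ _ _ _ (by omega), upd _ _ _ _ (by omega)]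
  | modS =>
    subst hs
    have r₁ := run_instr (s' := s.setW (d + 2) 1) hP hc rfl rfl
    have r₂ := run_instr (s := s.setW (d + 2) 1) (s' := (s.setW (d + 2) 1).setW (d + 1) (b + 1))
      hP hc.tail rfl
      (by simp [Instr.exec, WordOp.eval, Config.setW, hb, Nat.mod_eq_of_lt hb'])
    have r₃ := run_instr (s := (s.setW (d + 2) 1).setW (d + 1) (b + 1))
      (s' := ((s.setW (d + 2) 1).setW (d + 1) (b + 1)).setW d (a % (b + 1))) hP hc.tail.tail rfl
      (by simp [Instr.exec, WordOp.eval, Config.setW, ha])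
    refine ⟨_, run_trans (run_trans r₁ r₂) r₃,
      by simp [Config.setW, code], by simp [Config.setW, eval], ?_, rfl⟩
    · intro i hi
      simp only [Config.setW]
      rw [upd _ _ _ _ (by omega), upd _ _ _ _ (by omega), upd _ _ _ _ (by omega)]
  | land =>
    subst hs
    have r₁ := run_instr (s' := s.setW d (2 ^ w - ((a &&& b) + 1))) hP hc rfl
      (by simp [Instr.exec, WordOp.eval, ha, hb])
    have hn := nand_nand (z := b) ha'
    rw [Nat.and_self] at hn
    have r₂ := run_instr (s := s.setW d (2 ^ w - ((a &&& b) + 1)))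
      (s' := (s.setW d (2 ^ w - ((a &&& b) + 1))).setW d (a &&& b)) hP hc.tail rfl
      (by simp [Instr.exec, WordOp.eval, Config.setW, hn])
    refine ⟨_, run_trans r₁ r₂,
      by simp [Config.setW, code], by simp [Config.setW, eval], ?_, rfl⟩
    · intro i hi
      simp only [Config.setW]
      rw [upd _ _ _ _ (by omega), upd _ _ _ _ (by omega)]

theorem WExpr.run_code {P : Program} {w : ℕ} (hP : GoodWords P w) {V : ℕ → ℕ} (e : WExpr)
    {off d : ℕ} {s : Config} (hc : CodeAt P off (e.code d)) (hd : 32 ≤ d) (hwf : e.WF d)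
    (hok : e.Ok w V) (hs : s.pc = off) (hV : ∀ i < 32, s.W i = V i) :
    ∃ s', run P w e.len s = some s' ∧ s'.pc = off + e.len ∧ s'.W d = e.eval V ∧
      (∀ i, i < d ∨ 64 ≤ i → s'.W i = s.W i) ∧ s'.R = s.R := by
  induction e generalizing off d s with
  | const k =>
    have : d < 64 := hwf
    refine ⟨s.setW d k, run_instr hP hc hs rfl, by simp [Config.setW, hs, len],
      by simp [Config.setW, eval], fun i hi => Function.update_of_ne (by omega) _ _, rfl⟩
  | var i =>
    have : d < 64 := hwf.2
    refine ⟨s.setW d (s.W i), run_instr hP hc hs rfl, by simp [Config.setW, hs, len],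
      by simp [Config.setW, eval, hV i hwf.1],
      fun i hi => Function.update_of_ne (by omega) _ _, rfl⟩
  | op o e f he hf =>
    obtain ⟨h1, h2, h3⟩ := hwf
    obtain ⟨o1, o2, o3⟩ := hok
    obtain ⟨s₁, r₁, p₁, v₁, f₁, R₁⟩ := he hc.left hd h1 o1 hs hV
    have c₂ := hc.right
    rw [length_code] at c₂
    obtain ⟨s₂, r₂, p₂, v₂, f₂, R₂⟩ := hf c₂.left (by omega) h2 o2 p₁
      (fun i hi => by rw [f₁ i (by omega), hV i hi])
    have c₃ := c₂.right
    rw [length_code] at c₃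
    obtain ⟨s₃, r₃, p₃, v₃, f₃, R₃⟩ := o.run_code hP c₃ p₂
      (by rw [f₂ d (by omega), v₁]) v₂ (by have := o1.eval_lt; omega) o2.eval_lt
      (by omega)
    have hl : (o.code d).length = (o.code 0).length := by cases o <;> rfl
    rw [hl] at r₃ p₃
    refine ⟨s₃, run_trans r₁ (run_trans r₂ r₃), by rw [p₃, len]; omega, v₃, ?_, by rw [R₃, R₂, R₁]⟩
    intro i hi
    rw [f₃ i (by omega), f₂ i (by omega), f₁ i (by omega)]

/-! ### A structured language and its translation into machine code -/

/-- Abstract memory of a structured program: `V` are the word variables (registers `W[0..31]`), `M`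
is the word memory (registers from `W[64]` on), `R` are the real variables (registers `R[0..3]`),
and `S` is the real memory (registers from `R[4]` on). The registers `W[32..63]` are scratch space
of the compiled expressions and invisible here. -/
structure Store where
  V : ℕ → ℕ
  M : ℕ → ℕ
  R : ℕ → ℝ
  S : ℕ → ℝ

/-- Tests of structured programs. -/
inductive Test where
  | lt (e f : WExpr)
  | eq (e f : WExpr)
  | rzero (i : ℕ)
  | rpos (i : ℕ)

namespace Test

/-- Truth of a test. -/
def Holds (σ : Store) : Test → Prop
  | lt e f => e.eval σ.V < f.eval σ.V
  | eq e f => e.eval σ.V = f.eval σ.V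
  | rzero i => σ.R i = 0
  | rpos i => 0 < σ.R i

/-- The operands of a test do not overflow at word size `w`. -/
def Ok (w : ℕ) (V : ℕ → ℕ) : Test → Prop
  | lt e f => e.Ok w V ∧ f.Ok w V
  | eq e f => e.Ok w V ∧ f.Ok w V
  | rzero _ => True
  | rpos _ => True

/-- Code that jumps to `l` if the test holds. -/
def code (l : ℕ) : Test → List Instr
  | lt e f => e.code 32 ++ (f.code 33 ++ [.wIfLt 32 33 l])
  | eq e f => e.code 32 ++ (f.code 33 ++ [.wIfEq 32 33 l])
  | rzero i => [.rIfZero i l]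
  | rpos i => [.rIfPos i l]

/-- Length of the code. -/
def len : Test → ℕ
  | lt e f => e.len + f.len + 1
  | eq e f => e.len + f.len + 1
  | rzero _ => 1
  | rpos _ => 1

/-- The code uses variables and scratch registers only as intended. -/
def WF : Test → Prop
  | lt e f => e.WF 32 ∧ f.WF 33
  | eq e f => e.WF 32 ∧ f.WF 33
  | rzero i => i < 4
  | rpos i => i < 4

theorem length_code (t : Test) (l : ℕ) : (t.code l).length = t.len := by
  cases t <;> simp [code, len, WExpr.length_code] <;> omega

end Test

/-- Structured programs. -/
inductive Cmd where
  | skip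
  /-- assign the value of an expression to a word variable -/
  | assign (v : ℕ) (e : WExpr)
  /-- read the word memory at address `e` into a word variable -/
  | load (v : ℕ) (e : WExpr)
  /-- write `f` into the word memory at address `e` -/
  | store (e f : WExpr)
  /-- assign `e - f` to a word variable -/
  | sub (v : ℕ) (e f : WExpr)
  /-- assign a constant to a real variable -/
  | rconst (i k : ℕ)
  | rarith (o : RealOp) (i j k : ℕ)
  /-- read the real memory at address `e` into a real variable -/
  | rload (i : ℕ) (e : WExpr)
  /-- write a real variable into the real memory at address `e` -/
  | rstore (e : WExpr) (i : ℕ)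
  /-- read the word memory at address `e` into a real variable -/
  | rword (i : ℕ) (e : WExpr)
  | seq (c₁ c₂ : Cmd)
  | ite (t : Test) (c₁ c₂ : Cmd)
  | loop (t : Test) (c : Cmd)

namespace Cmd

/-- Length of the code. -/
def size : Cmd → ℕ
  | skip => 0
  | assign _ e => e.len + 1
  | load _ e => e.len + 1
  | store e f => e.len + f.len + 1
  | sub _ e f => e.len + f.len + 1
  | rconst _ _ => 1
  | rarith _ _ _ _ => 1
  | rload _ e => e.len + 1
  | rstore e _ => e.len + 1
  | rword _ e => e.len + 2
  | seq c₁ c₂ => c₁.size + c₂.size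
  | ite t c₁ c₂ => t.len + c₂.size + 1 + c₁.size
  | loop t c => t.len + 1 + c.size + 1

/-- The machine code of a structured program that starts at instruction `off`. -/
def code : Cmd → ℕ → List Instr
  | skip, _ => []
  | assign v e, _ => e.code 32 ++ [.wCopy v 32]
  | load v e, _ => e.code 32 ++ [.wLoad v 32]
  | store e f, _ => e.code 32 ++ (f.code 33 ++ [.wStore 32 33])
  | sub v e f, _ => e.code 32 ++ (f.code 33 ++ [.wArith .sub v 32 33])
  | rconst i k, _ => [.rCastConst i k]
  | rarith o i j k, _ => [.rArith o i j k]
  | rload i e, _ => e.code 32 ++ [.rLoad i 32]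
  | rstore e i, _ => e.code 32 ++ [.rStore 32 i]
  | rword i e, _ => e.code 32 ++ [.wLoad 32 32, .rCastWord i 32]
  | seq c₁ c₂, off => c₁.code off ++ c₂.code (off + c₁.size)
  | ite t c₁ c₂, off =>
    t.code (off + t.len + c₂.size + 1) ++ (c₂.code (off + t.len) ++
      (.goto (off + t.len + c₂.size + 1 + c₁.size) :: c₁.code (off + t.len + c₂.size + 1)))
  | loop t c, off =>
    t.code (off + t.len + 1) ++ (.goto (off + t.len + 1 + c.size + 1) ::
      (c.code (off + t.len + 1) ++ [.goto off]))

/-- The program respects the division of the registers into variables, scratch space and memory. -/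
def WF : Cmd → Prop
  | skip => True
  | assign v e => v < 32 ∧ e.WF 32
  | load v e => v < 32 ∧ e.WF 32
  | store e f => e.WF 32 ∧ f.WF 33
  | sub v e f => v < 32 ∧ e.WF 32 ∧ f.WF 33
  | rconst i _ => i < 4
  | rarith _ i j k => i < 4 ∧ j < 4 ∧ k < 4
  | rload i e => i < 4 ∧ e.WF 32
  | rstore e i => i < 4 ∧ e.WF 32
  | rword i e => i < 4 ∧ e.WF 32
  | seq c₁ c₂ => c₁.WF ∧ c₂.WF
  | ite t c₁ c₂ => t.WF ∧ c₁.WF ∧ c₂.WF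
  | loop t c => t.WF ∧ c.WF

theorem length_code (c : Cmd) (off : ℕ) : (c.code off).length = c.size := by
  induction c generalizing off with
  | seq c₁ c₂ h₁ h₂ => simp [code, size, h₁, h₂]
  | ite t c₁ c₂ h₁ h₂ => simp [code, size, h₁, h₂, Test.length_code]; omega
  | loop t c h => simp [code, size, h, Test.length_code]; omega
  | _ => simp [code, size, WExpr.length_code] <;> omega

/-- Big-step semantics at word size `w`: `Big w c σ σ' t` says that `c`, started in `σ`, ends in
`σ'` after `t` machine steps. Programs that overflow, subtract to a negative result, access the
variables or the scratch space as memory, or execute an undefined operation have no derivation. -/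
inductive Big (w : ℕ) : Cmd → Store → Store → ℕ → Prop
  | skip (σ : Store) : Big w skip σ σ 0
  | assign (σ : Store) (v : ℕ) (e : WExpr) (h : e.Ok w σ.V) :
    Big w (assign v e) σ { σ with V := Function.update σ.V v (e.eval σ.V) } (e.len + 1)
  | load (σ : Store) (v : ℕ) (e : WExpr) (h : e.Ok w σ.V) (h' : 64 ≤ e.eval σ.V) :
    Big w (load v e) σ { σ with V := Function.update σ.V v (σ.M (e.eval σ.V)) } (e.len + 1)
  | store (σ : Store) (e f : WExpr) (h : e.Ok w σ.V) (h' : f.Ok w σ.V) (h'' : 64 ≤ e.eval σ.V) :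
    Big w (store e f) σ { σ with M := Function.update σ.M (e.eval σ.V) (f.eval σ.V) }
      (e.len + f.len + 1)
  | sub (σ : Store) (v : ℕ) (e f : WExpr) (h : e.Ok w σ.V) (h' : f.Ok w σ.V)
    (h'' : f.eval σ.V ≤ e.eval σ.V) :
    Big w (sub v e f) σ { σ with V := Function.update σ.V v (e.eval σ.V - f.eval σ.V) }
      (e.len + f.len + 1)
  | rconst (σ : Store) (i k : ℕ) :
    Big w (rconst i k) σ { σ with R := Function.update σ.R i (k : ℝ) } 1
  | rarith (σ : Store) (o : RealOp) (i j k : ℕ) (x : ℝ) (h : o.eval (σ.R j) (σ.R k) = some x) :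
    Big w (rarith o i j k) σ { σ with R := Function.update σ.R i x } 1
  | rload (σ : Store) (i : ℕ) (e : WExpr) (h : e.Ok w σ.V) (h' : 4 ≤ e.eval σ.V) :
    Big w (rload i e) σ { σ with R := Function.update σ.R i (σ.S (e.eval σ.V)) } (e.len + 1)
  | rstore (σ : Store) (e : WExpr) (i : ℕ) (h : e.Ok w σ.V) (h' : 4 ≤ e.eval σ.V) :
    Big w (rstore e i) σ { σ with S := Function.update σ.S (e.eval σ.V) (σ.R i) } (e.len + 1)
  | rword (σ : Store) (i : ℕ) (e : WExpr) (h : e.Ok w σ.V) (h' : 64 ≤ e.eval σ.V) :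
    Big w (rword i e) σ { σ with R := Function.update σ.R i (σ.M (e.eval σ.V) : ℝ) } (e.len + 2)
  | seq {σ σ₁ σ₂ : Store} {c₁ c₂ : Cmd} {t₁ t₂ : ℕ} (h₁ : Big w c₁ σ σ₁ t₁)
    (h₂ : Big w c₂ σ₁ σ₂ t₂) : Big w (seq c₁ c₂) σ σ₂ (t₁ + t₂)
  | iteT {σ σ₁ : Store} {t : Test} {c₁ c₂ : Cmd} {t₁ : ℕ} (h : t.Ok w σ.V) (h' : t.Holds σ)
    (h₁ : Big w c₁ σ σ₁ t₁) : Big w (ite t c₁ c₂) σ σ₁ (t.len + t₁)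
  | iteF {σ σ₁ : Store} {t : Test} {c₁ c₂ : Cmd} {t₁ : ℕ} (h : t.Ok w σ.V) (h' : ¬ t.Holds σ)
    (h₁ : Big w c₂ σ σ₁ t₁) : Big w (ite t c₁ c₂) σ σ₁ (t.len + (t₁ + 1))
  | loopF {σ : Store} {t : Test} {c : Cmd} (h : t.Ok w σ.V) (h' : ¬ t.Holds σ) :
    Big w (loop t c) σ σ (t.len + 1)
  | loopT {σ σ₁ σ₂ : Store} {t : Test} {c : Cmd} {t₁ t₂ : ℕ} (h : t.Ok w σ.V) (h' : t.Holds σ)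
    (h₁ : Big w c σ σ₁ t₁) (h₂ : Big w (loop t c) σ₁ σ₂ t₂) :
    Big w (loop t c) σ σ₂ (t.len + (t₁ + (1 + t₂)))

end Cmd

/-- The machine registers of `s` hold the abstract store `σ`. -/
structure Rel (s : Config) (σ : Store) : Prop where
  V : ∀ i < 32, s.W i = σ.V i
  M : ∀ a, 64 ≤ a → s.W a = σ.M a
  R : ∀ i < 4, s.R i = σ.R i
  S : ∀ a, 4 ≤ a → s.R a = σ.S a

section Translation

variable {P : Program} {w : ℕ} (hP : GoodWords P w)
include hP

theorem run_operand {e : WExpr} {L : List Instr} {off : ℕ} {s : Config} {σ : Store}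
    (hc : CodeAt P off (e.code 32 ++ L)) (he : e.WF 32) (oe : e.Ok w σ.V)
    (hs : s.pc = off) (hr : Rel s σ) :
    ∃ s', run P w e.len s = some s' ∧ s'.pc = off + e.len ∧ Rel s' σ ∧
      s'.W 32 = e.eval σ.V ∧ CodeAt P (off + e.len) L := by
  obtain ⟨s₁, r₁, p₁, v₁, f₁, R₁⟩ := e.run_code hP hc.left le_rfl he oe hs hr.V
  have c₂ := hc.right
  rw [WExpr.length_code] at c₂
  refine ⟨s₁, r₁, p₁, ⟨?_, ?_, ?_, ?_⟩, v₁, c₂⟩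
  · intro i hi; rw [f₁ i (by omega), hr.V i hi]
  · intro i hi; rw [f₁ i (by omega), hr.M i hi]
  · intro i hi; rw [R₁, hr.R i hi]
  · intro i hi; rw [R₁, hr.S i hi]

theorem run_operands {e f : WExpr} {L : List Instr} {off : ℕ} {s : Config} {σ : Store}
    (hc : CodeAt P off (e.code 32 ++ (f.code 33 ++ L))) (he : e.WF 32) (hf : f.WF 33)
    (oe : e.Ok w σ.V) (of : f.Ok w σ.V) (hs : s.pc = off) (hr : Rel s σ) :
    ∃ s', run P w (e.len + f.len) s = some s' ∧ s'.pc = off + (e.len + f.len) ∧ Rel s' σ ∧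
      s'.W 32 = e.eval σ.V ∧ s'.W 33 = f.eval σ.V ∧ CodeAt P (off + (e.len + f.len)) L := by
  obtain ⟨s₁, r₁, p₁, q₁, v₁, c₂⟩ := run_operand hP hc he oe hs hr
  obtain ⟨s₂, r₂, p₂, v₂, f₂, R₂⟩ := f.run_code hP c₂.left (by omega) hf of p₁ q₁.V
  have c₃ := c₂.right
  rw [WExpr.length_code] at c₃
  refine ⟨s₂, run_trans r₁ r₂, by rw [p₂]; omega, ⟨?_, ?_, ?_, ?_⟩, ?_, v₂,
    by rwa [← add_assoc]⟩
  · intro i hi; rw [f₂ i (by omega), q₁.V i hi]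
  · intro i hi; rw [f₂ i (by omega), q₁.M i hi]
  · intro i hi; rw [R₂, q₁.R i hi]
  · intro i hi; rw [R₂, q₁.S i hi]
  · rw [f₂ 32 (by omega), v₁]

theorem Test.run_code {t : Test} {l off : ℕ} {L : List Instr} {s : Config} {σ : Store}
    (hc : CodeAt P off (t.code l ++ L)) (ht : t.WF) (ot : t.Ok w σ.V) (hs : s.pc = off)
    (hr : Rel s σ) :
    ∃ s', run P w t.len s = some s' ∧ (t.Holds σ → s'.pc = l) ∧
      (¬ t.Holds σ → s'.pc = off + t.len) ∧ Rel s' σ ∧ CodeAt P (off + t.len) L := by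
  have c' := hc.right
  rw [Test.length_code] at c'
  cases t with
  | lt e f =>
    obtain ⟨s₁, r₁, p₁, q₁, v₁, v₂, c₂⟩ := run_operands hP hc.left ht.1 ht.2 ot.1 ot.2 hs hr
    refine ⟨_, run_trans r₁ (run_instr hP c₂ p₁ rfl), ?_, ?_, ?_, c'⟩
    · intro h
      have : s₁.W 32 < s₁.W 33 := by rw [v₁, v₂]; exact h
      simp [Config.jumpIf, this, Config.jump]
    · intro h
      have : ¬ s₁.W 32 < s₁.W 33 := by rw [v₁, v₂]; exact h
      simp only [Config.jumpIf, this, Config.jump, if_false, p₁, len]; omega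
    · unfold Config.jumpIf
      split <;> exact ⟨q₁.V, q₁.M, q₁.R, q₁.S⟩
  | eq e f =>
    obtain ⟨s₁, r₁, p₁, q₁, v₁, v₂, c₂⟩ := run_operands hP hc.left ht.1 ht.2 ot.1 ot.2 hs hr
    refine ⟨_, run_trans r₁ (run_instr hP c₂ p₁ rfl), ?_, ?_, ?_, c'⟩
    · intro h
      have : s₁.W 32 = s₁.W 33 := by rw [v₁, v₂]; exact h
      simp [Config.jumpIf, this, Config.jump]
    · intro h
      have : ¬ s₁.W 32 = s₁.W 33 := by rw [v₁, v₂]; exact h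
      simp only [Config.jumpIf, this, Config.jump, if_false, p₁, len]; omega
    · unfold Config.jumpIf
      split <;> exact ⟨q₁.V, q₁.M, q₁.R, q₁.S⟩
  | rzero i =>
    refine ⟨_, run_instr hP hc hs rfl, ?_, ?_, ?_, c'⟩
    · intro h
      have : s.R i = 0 := (hr.R i ht).trans h
      simp [Config.jumpIf, this, Config.jump]
    · intro h
      have : ¬ s.R i = 0 := by rw [hr.R i ht]; exact h
      simp [Config.jumpIf, this, Config.jump, hs, len]
    · unfold Config.jumpIf
      split <;> exact ⟨hr.V, hr.M, hr.R, hr.S⟩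
  | rpos i =>
    refine ⟨_, run_instr hP hc hs rfl, ?_, ?_, ?_, c'⟩
    · intro h
      have : 0 < s.R i := by rw [hr.R i ht]; exact h
      simp [Config.jumpIf, this, Config.jump]
    · intro h
      have : ¬ 0 < s.R i := by rw [hr.R i ht]; exact h
      simp only [Config.jumpIf, this, Config.jump, if_false, hs, len]
    · unfold Config.jumpIf
      split <;> exact ⟨hr.V, hr.M, hr.R, hr.S⟩

omit hP in
theorem Rel.setV {s : Config} {σ : Store} (hr : Rel s σ) {v x y : ℕ} (hv : v < 32) (hx : x = y) :
    Rel (s.setW v x) { σ with V := Function.update σ.V v y } := by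
  subst hx
  refine ⟨fun i hi => ?_, fun a ha => ?_, hr.R, hr.S⟩
  · by_cases h : i = v
    · subst h; simp [Config.setW]
    · simp [Config.setW, h, hr.V i hi]
  · simp [Config.setW, hr.M a ha, show a ≠ v by omega]

omit hP in
theorem Rel.setM {s : Config} {σ : Store} (hr : Rel s σ) {v v' x y : ℕ} (hv : 64 ≤ v)
    (hv' : v' = v) (hx : x = y) :
    Rel (s.setW v' x) { σ with M := Function.update σ.M v y } := by
  subst hx hv'
  refine ⟨fun i hi => ?_, fun a ha => ?_, hr.R, hr.S⟩
  · simp [Config.setW, hr.V i hi, show i ≠ v' by omega]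
  · by_cases h : a = v'
    · subst h; simp [Config.setW]
    · simp [Config.setW, h, hr.M a ha]

omit hP in
theorem Rel.setR {s : Config} {σ : Store} (hr : Rel s σ) {v : ℕ} {x y : ℝ} (hv : v < 4)
    (hx : x = y) : Rel (s.setR v x) { σ with R := Function.update σ.R v y } := by
  subst hx
  refine ⟨hr.V, hr.M, fun i hi => ?_, fun a ha => ?_⟩
  · by_cases h : i = v
    · subst h; simp [Config.setR]
    · simp [Config.setR, h, hr.R i hi]
  · simp [Config.setR, hr.S a ha, show a ≠ v by omega]

omit hP in
theorem Rel.setS {s : Config} {σ : Store} (hr : Rel s σ) {v v' : ℕ} {x y : ℝ} (hv : 4 ≤ v)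
    (hv' : v' = v) (hx : x = y) :
    Rel (s.setR v' x) { σ with S := Function.update σ.S v y } := by
  subst hx hv'
  refine ⟨hr.V, hr.M, fun i hi => ?_, fun a ha => ?_⟩
  · simp [Config.setR, hr.R i hi, show i ≠ v' by omega]
  · by_cases h : a = v'
    · subst h; simp [Config.setR]
    · simp [Config.setR, h, hr.S a ha]

/-- The translation is correct, and its running time is exactly the one of the semantics. -/
theorem Cmd.Big.run_code {c : Cmd} {σ σ' : Store} {t : ℕ} (h : Cmd.Big w c σ σ' t) {off : ℕ}
    {s : Config} (hwf : c.WF) (hc : CodeAt P off (c.code off)) (hs : s.pc = off) (hr : Rel s σ) :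
    ∃ s', run P w t s = some s' ∧ s'.pc = off + c.size ∧ Rel s' σ' := by
  induction h generalizing off s with
  | skip σ => exact ⟨s, rfl, hs, hr⟩
  | assign σ v e h =>
    obtain ⟨s₁, r₁, p₁, q₁, v₁, c₁⟩ := run_operand hP hc hwf.2 h hs hr
    refine ⟨_, run_trans r₁ (run_instr hP c₁ p₁ rfl), ?_, q₁.setV hwf.1 v₁⟩
    simp [Config.setW, p₁, size, add_assoc]
  | load σ v e h h' =>
    obtain ⟨s₁, r₁, p₁, q₁, v₁, c₁⟩ := run_operand hP hc hwf.2 h hs hr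
    refine ⟨_, run_trans r₁ (run_instr hP c₁ p₁ rfl), ?_, q₁.setV hwf.1 ?_⟩
    · simp [Config.setW, p₁, size, add_assoc]
    · rw [v₁, q₁.M _ h']
  | store σ e f h h' h'' =>
    obtain ⟨s₁, r₁, p₁, q₁, v₁, v₂, c₁⟩ := run_operands hP hc hwf.1 hwf.2 h h' hs hr
    refine ⟨_, run_trans r₁ (run_instr hP c₁ p₁ rfl), ?_, q₁.setM h'' v₁ v₂⟩
    simp [Config.setW, p₁, size, add_assoc]
  | sub σ v e f h h' h'' =>
    obtain ⟨s₁, r₁, p₁, q₁, v₁, v₂, c₁⟩ := run_operands hP hc hwf.2.1 hwf.2.2 h h' hs hr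
    refine ⟨_, run_trans r₁ (run_instr hP c₁ p₁ rfl), ?_, q₁.setV hwf.1 ?_⟩
    · simp [Config.setW, p₁, size, add_assoc]
    · have := h.eval_lt
      rw [v₁, v₂, show e.eval σ.V + 2 ^ w - f.eval σ.V = e.eval σ.V - f.eval σ.V + 2 ^ w by omega,
        Nat.add_mod_right, Nat.mod_eq_of_lt (by omega)]
  | rconst σ i k =>
    exact ⟨_, run_instr hP hc hs rfl, by simp [Config.setR, hs, size], hr.setR hwf rfl⟩
  | rarith σ o i j k x h =>
    refine ⟨s.setR i x, run_instr hP hc hs ?_, by simp [Config.setR, hs, size], hr.setR hwf.1 rfl⟩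
    simp [Instr.exec, hr.R j hwf.2.1, hr.R k hwf.2.2, h]
  | rload σ i e h h' =>
    obtain ⟨s₁, r₁, p₁, q₁, v₁, c₁⟩ := run_operand hP hc hwf.2 h hs hr
    refine ⟨_, run_trans r₁ (run_instr hP c₁ p₁ rfl), ?_, q₁.setR hwf.1 ?_⟩
    · simp [Config.setR, p₁, size, add_assoc]
    · rw [v₁, q₁.S _ h']
  | rstore σ e i h h' =>
    obtain ⟨s₁, r₁, p₁, q₁, v₁, c₁⟩ := run_operand hP hc hwf.2 h hs hr
    refine ⟨_, run_trans r₁ (run_instr hP c₁ p₁ rfl), ?_, q₁.setS h' v₁ (q₁.R i hwf.1)⟩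
    simp [Config.setR, p₁, size, add_assoc]
  | rword σ i e h h' =>
    obtain ⟨s₁, r₁, p₁, q₁, v₁, c₁⟩ := run_operand hP hc hwf.2 h hs hr
    have q₂ : Rel (s₁.setW 32 (σ.M (e.eval σ.V))) σ :=
      ⟨fun j hj => by simp [Config.setW, q₁.V j hj, show j ≠ 32 by omega],
        fun a ha => by simp [Config.setW, q₁.M a ha, show a ≠ 32 by omega], q₁.R, q₁.S⟩
    refine ⟨_, run_trans r₁ (run_trans
      (run_instr (s' := s₁.setW 32 (σ.M (e.eval σ.V))) hP c₁ p₁ ?_)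
      (run_instr hP c₁.tail (by simp [Config.setW, p₁]) rfl)), ?_, q₂.setR hwf.1 ?_⟩
    · simp [Instr.exec, v₁, q₁.M _ h']
    · simp [Config.setW, Config.setR, p₁, size, add_assoc]
    · simp [Config.setW]
  | @seq σ σ₁ σ₂ c₁ c₂ t₁ t₂ h₁ h₂ ih₁ ih₂ =>
    obtain ⟨s₁, r₁, p₁, q₁⟩ := ih₁ hwf.1 hc.left hs hr
    have c' := hc.right
    rw [length_code] at c'
    obtain ⟨s₂, r₂, p₂, q₂⟩ := ih₂ hwf.2 c' p₁ q₁
    exact ⟨s₂, run_trans r₁ r₂, by rw [p₂, size, add_assoc], q₂⟩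
  | @iteT σ σ₁ t c₁ c₂ t₁ h h' h₁ ih =>
    obtain ⟨s₁, r₁, p₁, -, q₁, c'⟩ := Test.run_code hP hc hwf.1 h hs hr
    have c'' := c'.right.tail
    rw [length_code] at c''
    obtain ⟨s₂, r₂, p₂, q₂⟩ := ih hwf.2.1 c'' (p₁ h') q₁
    exact ⟨s₂, run_trans r₁ r₂, by rw [p₂, size]; omega, q₂⟩
  | @iteF σ σ₁ t c₁ c₂ t₁ h h' h₁ ih =>
    obtain ⟨s₁, r₁, -, p₁, q₁, c'⟩ := Test.run_code hP hc hwf.1 h hs hr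
    obtain ⟨s₂, r₂, p₂, q₂⟩ := ih hwf.2.2 c'.left (p₁ h') q₁
    have c'' := c'.right
    rw [length_code] at c''
    refine ⟨_, run_trans r₁ (run_trans r₂ (run_instr hP c'' p₂ rfl)), ?_, q₂.V, q₂.M, q₂.R, q₂.S⟩
    simp only [Config.jump, size]; omega
  | @loopF σ t c h h' =>
    obtain ⟨s₁, r₁, -, p₁, q₁, c'⟩ := Test.run_code hP hc hwf.1 h hs hr
    refine ⟨_, run_trans r₁ (run_instr hP c' (p₁ h') rfl), ?_, q₁.V, q₁.M, q₁.R, q₁.S⟩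
    simp only [Config.jump, size]; omega
  | @loopT σ σ₁ σ₂ t c t₁ t₂ h h' h₁ h₂ ih₁ ih₂ =>
    obtain ⟨s₁, r₁, p₁, -, q₁, c'⟩ := Test.run_code hP hc hwf.1 h hs hr
    obtain ⟨s₂, r₂, p₂, q₂⟩ := ih₁ hwf.2 c'.tail.left (p₁ h') q₁
    have c'' := c'.tail.right
    rw [length_code] at c''
    have r₃ := run_instr (s' := s₂.jump off) hP c'' p₂ rfl
    obtain ⟨s₃, r₄, p₄, q₄⟩ := ih₂ (s := s₂.jump off) hwf hc rfl ⟨q₂.V, q₂.M, q₂.R, q₂.S⟩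
    exact ⟨s₃, run_trans r₁ (run_trans r₂ (run_trans r₃ r₄)), p₄, q₄⟩

end Translation

/-! ### Reasoning about structured programs -/

namespace Cmd

/-- Started in `σ`, the program ends within `T` steps in a store that satisfies `Q`. -/
def Ends (w : ℕ) (c : Cmd) (T : ℕ) (Q : Store → Prop) (σ : Store) : Prop :=
  ∃ σ' t, t ≤ T ∧ Big w c σ σ' t ∧ Q σ'

theorem Ends.mono {w : ℕ} {c : Cmd} {T T' : ℕ} {Q Q' : Store → Prop} {σ : Store}
    (h : Ends w c T Q σ) (hT : T ≤ T') (hQ : ∀ σ', Q σ' → Q' σ') : Ends w c T' Q' σ := by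
  obtain ⟨σ', t, h₁, h₂, h₃⟩ := h
  exact ⟨σ', t, h₁.trans hT, h₂, hQ _ h₃⟩

theorem Ends.seq {w : ℕ} {c₁ c₂ : Cmd} {T₁ T₂ : ℕ} {Q : Store → Prop} {σ : Store}
    (h : Ends w c₁ T₁ (fun σ₁ => Ends w c₂ T₂ Q σ₁) σ) : Ends w (.seq c₁ c₂) (T₁ + T₂) Q σ := by
  obtain ⟨σ₁, t₁, h₁, b₁, σ₂, t₂, h₂, b₂, q⟩ := h
  exact ⟨σ₂, t₁ + t₂, by omega, .seq b₁ b₂, q⟩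

theorem Ends.seq' {w : ℕ} {c₁ c₂ : Cmd} {T₁ T₂ : ℕ} {Q Q' : Store → Prop} {σ : Store}
    (h : Ends w c₁ T₁ Q' σ) (h' : ∀ σ₁, Q' σ₁ → Ends w c₂ T₂ Q σ₁) :
    Ends w (.seq c₁ c₂) (T₁ + T₂) Q σ :=
  Ends.seq (h.mono le_rfl h')

theorem Ends.ite {w : ℕ} {t : Test} {c₁ c₂ : Cmd} {T : ℕ} {Q : Store → Prop} {σ : Store}
    (h : t.Ok w σ.V) (h₁ : t.Holds σ → Ends w c₁ T Q σ) (h₂ : ¬ t.Holds σ → Ends w c₂ T Q σ) :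
    Ends w (.ite t c₁ c₂) (t.len + (T + 1)) Q σ := by
  by_cases h' : t.Holds σ
  · obtain ⟨σ₁, t₁, l, b, q⟩ := h₁ h'
    exact ⟨σ₁, _, by omega, .iteT h h' b, q⟩
  · obtain ⟨σ₁, t₁, l, b, q⟩ := h₂ h'
    exact ⟨σ₁, _, by omega, .iteF h h' b, q⟩

/-- Rule for loops: `I j` is an invariant before iteration `j`, and there are `m` iterations. -/
theorem Ends.loop {w : ℕ} {t : Test} {c : Cmd} {T m : ℕ} (I : ℕ → Store → Prop)
    (hstep : ∀ j < m, ∀ σ, I j σ → t.Ok w σ.V ∧ t.Holds σ ∧ Ends w c T (I (j + 1)) σ)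
    (hend : ∀ σ, I m σ → t.Ok w σ.V ∧ ¬ t.Holds σ) {σ : Store} (h : I 0 σ) :
    Ends w (.loop t c) (m * (t.len + T + 1) + (t.len + 1)) (I m) σ := by
  have key : ∀ k j σ, j + k = m → I j σ →
      Ends w (.loop t c) (k * (t.len + T + 1) + (t.len + 1)) (I m) σ := by
    intro k
    induction k with
    | zero =>
      intro j σ hj hσ
      obtain rfl : j = m := by omega
      obtain ⟨h₁, h₂⟩ := hend σ hσ
      exact ⟨σ, _, by omega, .loopF h₁ h₂, hσ⟩
    | succ k ih =>
      intro j σ hj hσ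
      obtain ⟨h₁, h₂, σ₁, t₁, l₁, b₁, q₁⟩ := hstep j (by omega) σ hσ
      obtain ⟨σ₂, t₂, l₂, b₂, q₂⟩ := ih (j + 1) σ₁ (by omega) q₁
      refine ⟨σ₂, _, ?_, .loopT h₁ h₂ b₁ b₂, q₂⟩
      rw [Nat.succ_mul]
      omega
  exact key m 0 σ (by omega) h

/-- A bound for the running time of a program without loops. -/
def cost : Cmd → ℕ
  | seq c₁ c₂ => c₁.cost + c₂.cost
  | ite t c₁ c₂ => t.len + (max c₁.cost c₂.cost + 1)
  | c => c.size

/-- Weakest precondition of a program without loops. -/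
def wp (w : ℕ) : Cmd → (Store → Prop) → Store → Prop
  | skip, Q, σ => Q σ
  | assign v e, Q, σ =>
    e.Ok w σ.V ∧ Q { σ with V := Function.update σ.V v (e.eval σ.V) }
  | load v e, Q, σ => e.Ok w σ.V ∧ 64 ≤ e.eval σ.V ∧
    Q { σ with V := Function.update σ.V v (σ.M (e.eval σ.V)) }
  | store e f, Q, σ => e.Ok w σ.V ∧ f.Ok w σ.V ∧ 64 ≤ e.eval σ.V ∧
    Q { σ with M := Function.update σ.M (e.eval σ.V) (f.eval σ.V) }
  | sub v e f, Q, σ => e.Ok w σ.V ∧ f.Ok w σ.V ∧ f.eval σ.V ≤ e.eval σ.V ∧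
    Q { σ with V := Function.update σ.V v (e.eval σ.V - f.eval σ.V) }
  | rconst i k, Q, σ => Q { σ with R := Function.update σ.R i (k : ℝ) }
  | rarith o i j k, Q, σ => ∃ x, o.eval (σ.R j) (σ.R k) = some x ∧
    Q { σ with R := Function.update σ.R i x }
  | rload i e, Q, σ => e.Ok w σ.V ∧ 4 ≤ e.eval σ.V ∧
    Q { σ with R := Function.update σ.R i (σ.S (e.eval σ.V)) }
  | rstore e i, Q, σ => e.Ok w σ.V ∧ 4 ≤ e.eval σ.V ∧
    Q { σ with S := Function.update σ.S (e.eval σ.V) (σ.R i) }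
  | rword i e, Q, σ => e.Ok w σ.V ∧ 64 ≤ e.eval σ.V ∧
    Q { σ with R := Function.update σ.R i (σ.M (e.eval σ.V) : ℝ) }
  | seq c₁ c₂, Q, σ => c₁.wp w (c₂.wp w Q) σ
  | ite t c₁ c₂, Q, σ => t.Ok w σ.V ∧ (t.Holds σ → c₁.wp w Q σ) ∧ (¬ t.Holds σ → c₂.wp w Q σ)
  | loop _ _, _, _ => False

theorem Ends.of_wp {w : ℕ} {c : Cmd} {Q : Store → Prop} {σ : Store} (h : c.wp w Q σ) :
    Ends w c c.cost Q σ := by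
  induction c generalizing Q σ with
  | skip => exact ⟨_, _, le_rfl, .skip σ, h⟩
  | assign v e => exact ⟨_, _, le_rfl, .assign σ v e h.1, h.2⟩
  | load v e => exact ⟨_, _, le_rfl, .load σ v e h.1 h.2.1, h.2.2⟩
  | store e f => exact ⟨_, _, le_rfl, .store σ e f h.1 h.2.1 h.2.2.1, h.2.2.2⟩
  | sub v e f => exact ⟨_, _, le_rfl, .sub σ v e f h.1 h.2.1 h.2.2.1, h.2.2.2⟩
  | rconst i k => exact ⟨_, _, le_rfl, .rconst σ i k, h⟩
  | rarith o i j k =>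
    obtain ⟨x, hx, hq⟩ := h
    exact ⟨_, _, le_rfl, .rarith σ o i j k x hx, hq⟩
  | rload i e => exact ⟨_, _, le_rfl, .rload σ i e h.1 h.2.1, h.2.2⟩
  | rstore e i => exact ⟨_, _, le_rfl, .rstore σ e i h.1 h.2.1, h.2.2⟩
  | rword i e => exact ⟨_, _, le_rfl, .rword σ i e h.1 h.2.1, h.2.2⟩
  | seq c₁ c₂ h₁ h₂ => exact (h₁ h).seq' fun _ h' => h₂ h'
  | ite t c₁ c₂ h₁ h₂ =>
    exact Ends.ite h.1 (fun h' => (h₁ (h.2.1 h')).mono (le_max_left _ _) fun _ => id)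
      (fun h' => (h₂ (h.2.2 h')).mono (le_max_right _ _) fun _ => id)
  | loop t c => exact h.elim

end Cmd

/-! ### Formula schemes and their generation -/

/-- Unary numerals; all numbers that occur in the formulas below are polynomially bounded. -/
def Term.numeral : ℕ → Term
  | 0 => .zero
  | k + 1 => .add .one (numeral k)

theorem Term.code_numeral (k : ℕ) :
    (Term.numeral k).code = (List.range k).flatMap (fun _ => [2, 1]) ++ [0] := by
  induction k with
  | zero => rfl
  | succ k ih => simp [numeral, code, ih, List.range_succ_eq_map, List.flatMap_map]

@[simp]
theorem Term.eval_numeral (v : ℕ → ℝ) (k : ℕ) : (Term.numeral k).eval v = k := by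
  induction k with
  | zero => simp [numeral, eval]
  | succ k ih => simp [numeral, eval, ih]; ring

/-- Conjunction of a list of formulas. -/
def Formula.bigAnd (l : List Formula) : Formula :=
  l.foldr .and (.eq .zero .zero)

/-- Disjunction of a list of formulas. -/
def Formula.bigOr (l : List Formula) : Formula :=
  l.foldr .or (.lt .zero .zero)

theorem Formula.code_bigAnd (l : List Formula) :
    (bigAnd l).code = l.flatMap (fun φ => 7 :: φ.code) ++ [4, 0, 0] := by
  induction l with
  | nil => rfl
  | cons φ l ih =>
    have : bigAnd (φ :: l) = .and φ (bigAnd l) := rfl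
    simp [this, code, ih]

theorem Formula.code_bigOr (l : List Formula) :
    (bigOr l).code = l.flatMap (fun φ => 8 :: φ.code) ++ [6, 0, 0] := by
  induction l with
  | nil => rfl
  | cons φ l ih =>
    have : bigOr (φ :: l) = .or φ (bigOr l) := rfl
    simp [this, code, ih]

theorem Formula.holds_bigAnd (v : ℕ → ℝ) (l : List Formula) :
    (bigAnd l).Holds v ↔ ∀ φ ∈ l, φ.Holds v := by
  induction l with
  | nil => simp [bigAnd, Holds]
  | cons φ l ih =>
    have : bigAnd (φ :: l) = .and φ (bigAnd l) := rfl
    simp [this, Holds, ih]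

theorem Formula.holds_bigOr (v : ℕ → ℝ) (l : List Formula) :
    (bigOr l).Holds v ↔ ∃ φ ∈ l, φ.Holds v := by
  induction l with
  | nil => simp [bigOr, Holds]
  | cons φ l ih =>
    have : bigOr (φ :: l) = .or φ (bigOr l) := rfl
    simp [this, Holds, ih]

/-- Term schemes: terms whose numerals and variable indices are computed by expressions. The value
of `inp e` is bit number `e` of the input. -/
inductive TermScheme where
  | num (e : WExpr)
  | var (e : WExpr)
  | inp (e : WExpr)
  | add (s t : TermScheme)
  | mul (s t : TermScheme)

/-- Formula schemes. In `all e F` and `ex e F`, the scheme `F` is instantiated for all values below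
`e` of a new word variable, whose number is the number of enclosing quantifiers. `cond e f F G`
stands for `F` if `e < f` and for `G` otherwise. -/
inductive FormulaScheme where
  | eq (s t : TermScheme)
  | lt (s t : TermScheme)
  | and (F G : FormulaScheme)
  | or (F G : FormulaScheme)
  | not (F : FormulaScheme)
  | all (e : WExpr) (F : FormulaScheme)
  | ex (e : WExpr) (F : FormulaScheme)
  | cond (e f : WExpr) (F G : FormulaScheme)

/-- The instance of a term scheme for the input bits `inp` and the word variables `V`. -/
def TermScheme.toTerm (inp V : ℕ → ℕ) : TermScheme → Term
  | num e => .numeral (e.eval V)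
  | var e => .var (e.eval V)
  | .inp e => if inp (e.eval V) = 0 then .zero else .one
  | add s t => .add (s.toTerm inp V) (t.toTerm inp V)
  | mul s t => .mul (s.toTerm inp V) (t.toTerm inp V)

/-- The instance of a formula scheme inside `d` quantifiers. -/
def FormulaScheme.toFormula (inp : ℕ → ℕ) : FormulaScheme → ℕ → (ℕ → ℕ) → Formula
  | eq s t, _, V => .eq (s.toTerm inp V) (t.toTerm inp V)
  | lt s t, _, V => .lt (s.toTerm inp V) (t.toTerm inp V)
  | and F G, d, V => .and (F.toFormula inp d V) (G.toFormula inp d V)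
  | or F G, d, V => .or (F.toFormula inp d V) (G.toFormula inp d V)
  | not F, d, V => .not (F.toFormula inp d V)
  | all e F, d, V => .bigAnd ((List.range (e.eval V)).map fun i =>
      F.toFormula inp (d + 1) (Function.update V d i))
  | ex e F, d, V => .bigOr ((List.range (e.eval V)).map fun i =>
      F.toFormula inp (d + 1) (Function.update V d i))
  | cond e f F G, d, V =>
      if e.eval V < f.eval V then F.toFormula inp d V else G.toFormula inp d V

namespace WExpr

/-- All variables of the expression are below `d`. -/
def Below (d : ℕ) : WExpr → Prop
  | const _ => True
  | var i => i < d
  | op _ e f => e.Below d ∧ f.Below d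

theorem Below.eval_congr {d : ℕ} {e : WExpr} (h : e.Below d) {V V' : ℕ → ℕ}
    (hV : ∀ i < d, V i = V' i) : e.eval V = e.eval V' := by
  induction e with
  | const k => rfl
  | var i => exact hV i h
  | op o e f he hf => simp only [eval, he h.1, hf h.2]

/-- Exponent of a polynomial bound for the values of an expression. -/
def deg : WExpr → ℕ
  | const k => k
  | var _ => 1
  | op _ e f => e.deg + f.deg + 1

theorem WF.mono {d d' : ℕ} (h : d' ≤ d) {e : WExpr} (he : e.WF d) : e.WF d' := by
  induction e generalizing d d' with
  | const k => exact lt_of_le_of_lt h he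
  | var i => exact ⟨he.1, lt_of_le_of_lt h he.2⟩
  | op o e f h₁ h₂ =>
    exact ⟨h₁ h he.1, h₂ (Nat.succ_le_succ h) he.2.1, by have := he.2.2; omega⟩

end WExpr

theorem le_pow_of_le {X x a b : ℕ} (hX : 2 ≤ X) (h : x ≤ X ^ a) (hab : a ≤ b) : x ≤ X ^ b :=
  h.trans (Nat.pow_le_pow_right (by omega) hab)

theorem const_le_pow {X : ℕ} (hX : 2 ≤ X) (k : ℕ) : k ≤ X ^ k := (Nat.lt_pow_self hX).le

theorem add_le_pow {X x y a b : ℕ} (hX : 2 ≤ X) (hx : x ≤ X ^ a) (hy : y ≤ X ^ b) :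
    x + y ≤ X ^ (a + b + 1) := by
  have h₁ := le_pow_of_le hX hx (Nat.le_add_right a b)
  have h₂ := le_pow_of_le hX hy (Nat.le_add_left b a)
  rw [pow_succ]
  nlinarith

theorem mul_le_pow {X x y a b : ℕ} (hx : x ≤ X ^ a) (hy : y ≤ X ^ b) : x * y ≤ X ^ (a + b) := by
  rw [pow_add]; exact Nat.mul_le_mul hx hy

theorem BinOp.eval_le {X x y a b : ℕ} (o : BinOp) (hX : 2 ≤ X) (hx : x ≤ X ^ a) (hy : y ≤ X ^ b) :
    o.eval x y ≤ X ^ (a + b + 1) := by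
  cases o with
  | add => exact add_le_pow hX hx hy
  | mul => exact le_pow_of_le hX (mul_le_pow hx hy) (Nat.le_succ _)
  | divS => exact le_pow_of_le hX ((Nat.div_le_self _ _).trans hx) (by omega)
  | modS => exact le_pow_of_le hX ((Nat.mod_le _ _).trans hx) (by omega)
  | land => exact le_pow_of_le hX (Nat.and_le_left.trans hx) (by omega)

theorem WExpr.Below.eval_le {d X : ℕ} {e : WExpr} (h : e.Below d) (hX : 2 ≤ X) {V : ℕ → ℕ}
    (hV : ∀ i < d, V i ≤ X) : e.eval V ≤ X ^ e.deg := by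
  induction e with
  | const k => exact const_le_pow hX k
  | var i => simpa [eval, deg] using hV i h
  | op o e f he hf => exact o.eval_le hX (he h.1) (hf h.2)

theorem WExpr.Below.ok {d X w : ℕ} {e : WExpr} (h : e.Below d) (hX : 2 ≤ X) {V : ℕ → ℕ}
    (hV : ∀ i < d, V i ≤ X) (hw : X ^ e.deg + 1 < 2 ^ w) : e.Ok w V := by
  induction e with
  | const k => exact lt_of_le_of_lt (Nat.succ_le_succ (const_le_pow hX k)) hw
  | var i => exact lt_of_le_of_lt (Nat.succ_le_succ (by simpa [deg] using hV i h)) hw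
  | op o e f he hf =>
    have := h.eval_le hX hV
    refine ⟨he h.1 ?_, hf h.2 ?_, lt_of_le_of_lt (Nat.succ_le_succ this) hw⟩
    · have := le_pow_of_le hX le_rfl (show e.deg ≤ (op o e f).deg by simp [deg]; omega)
      omega
    · have := le_pow_of_le hX le_rfl (show f.deg ≤ (op o e f).deg by simp [deg]; omega)
      omega

/-- Append the value of an expression to the output. Variable `30` points to the end of the
output. -/
def emit (e : WExpr) : Cmd :=
  .seq (.store (.var 30) e) (.assign 30 (.op .add (.var 30) (.const 1)))

/-- `v := v + 1` -/
def incr (v : ℕ) : Cmd := .assign v (.op .add (.var v) (.const 1))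

/-- A loop that emits `h` and then runs `g`, for all values of variable `d` below `e`. -/
def emitLoop (d h : ℕ) (e : WExpr) (g : Cmd) : Cmd :=
  .loop (.lt (.var d) e) (.seq (emit (.const h)) (.seq g (incr d)))

/-- Program that outputs the instance of a term scheme. Variable `31` holds the address of the first
input bit. -/
def TermScheme.gen (d : ℕ) : TermScheme → Cmd
  | num e => .seq (.assign d (.const 0))
      (.seq (emitLoop d 2 e (emit (.const 1))) (emit (.const 0)))
  | var e => emit (.op .add (.const 10) e)
  | inp e => .seq (.load 29 (.op .add (.var 31) e)) (emit (.var 29))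
  | add s t => .seq (emit (.const 2)) (.seq (s.gen d) (t.gen d))
  | mul s t => .seq (emit (.const 3)) (.seq (s.gen d) (t.gen d))

/-- Program that outputs the instance of a formula scheme inside `d` quantifiers. -/
def FormulaScheme.gen : FormulaScheme → ℕ → Cmd
  | eq s t, d => .seq (emit (.const 4)) (.seq (s.gen d) (t.gen d))
  | lt s t, d => .seq (emit (.const 6)) (.seq (s.gen d) (t.gen d))
  | and F G, d => .seq (emit (.const 7)) (.seq (F.gen d) (G.gen d))
  | or F G, d => .seq (emit (.const 8)) (.seq (F.gen d) (G.gen d))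
  | not F, d => .seq (emit (.const 9)) (F.gen d)
  | all e F, d => .seq (.assign d (.const 0)) (.seq (emitLoop d 7 e (F.gen (d + 1)))
      (.seq (emit (.const 4)) (.seq (emit (.const 0)) (emit (.const 0)))))
  | ex e F, d => .seq (.assign d (.const 0)) (.seq (emitLoop d 8 e (F.gen (d + 1)))
      (.seq (emit (.const 6)) (.seq (emit (.const 0)) (emit (.const 0)))))
  | cond e f F G, d => .ite (.lt e f) (F.gen d) (G.gen d)

/-- Expressions that may occur inside `d` quantifiers. -/
def WExpr.Fits (d : ℕ) (e : WExpr) : Prop := e.Below d ∧ e.WF 34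

/-- All expressions may occur inside `d` quantifiers. -/
def TermScheme.WF (d : ℕ) : TermScheme → Prop
  | num e => e.Fits d
  | var e => e.Fits d
  | inp e => e.Fits d
  | add s t => s.WF d ∧ t.WF d
  | mul s t => s.WF d ∧ t.WF d

/-- All expressions respect the number of enclosing quantifiers, which are at most `28`, so that the
variables from `29` on are free for the generating program. -/
def FormulaScheme.WF : FormulaScheme → ℕ → Prop
  | eq s t, d => s.WF d ∧ t.WF d
  | lt s t, d => s.WF d ∧ t.WF d
  | and F G, d => F.WF d ∧ G.WF d
  | or F G, d => F.WF d ∧ G.WF d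
  | not F, d => F.WF d
  | all e F, d => d < 28 ∧ e.Fits d ∧ F.WF (d + 1)
  | ex e F, d => d < 28 ∧ e.Fits d ∧ F.WF (d + 1)
  | cond e f F G, d => e.Fits d ∧ f.Fits d ∧ F.WF d ∧ G.WF d

theorem TermScheme.wf_gen {T : TermScheme} {d : ℕ} (hd : d ≤ 28) (h : T.WF d) : (T.gen d).WF := by
  induction T with
  | num e =>
    have h33 := h.2.mono (show 33 ≤ 34 by omega)
    simp only [gen, emitLoop, emit, incr, Cmd.WF, Test.WF, WExpr.WF, h33, and_true]
    omega
  | var e =>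
    have h34 := h.2
    simp only [gen, emit, Cmd.WF, WExpr.WF, h34, true_and]
    omega
  | inp e =>
    have h33 := h.2.mono (show 33 ≤ 34 by omega)
    simp only [gen, emit, Cmd.WF, WExpr.WF, h33, true_and]
    omega
  | add s t hs ht => exact ⟨by simp [emit, Cmd.WF, WExpr.WF], hs h.1, ht h.2⟩
  | mul s t hs ht => exact ⟨by simp [emit, Cmd.WF, WExpr.WF], hs h.1, ht h.2⟩

theorem FormulaScheme.wf_gen {F : FormulaScheme} {d : ℕ} (hd : d ≤ 28) (h : F.WF d) :
    (F.gen d).WF := by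
  induction F generalizing d with
  | eq s t =>
    exact ⟨by simp [emit, Cmd.WF, WExpr.WF], TermScheme.wf_gen hd h.1, TermScheme.wf_gen hd h.2⟩
  | lt s t =>
    exact ⟨by simp [emit, Cmd.WF, WExpr.WF], TermScheme.wf_gen hd h.1, TermScheme.wf_gen hd h.2⟩
  | and F G hF hG => exact ⟨by simp [emit, Cmd.WF, WExpr.WF], hF hd h.1, hG hd h.2⟩
  | or F G hF hG => exact ⟨by simp [emit, Cmd.WF, WExpr.WF], hF hd h.1, hG hd h.2⟩
  | not F hF => exact ⟨by simp [emit, Cmd.WF, WExpr.WF], hF hd h⟩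
  | all e F hF =>
    have h33 := h.2.1.2.mono (show 33 ≤ 34 by omega)
    have := hF h.1 h.2.2
    simp only [gen, emitLoop, emit, incr, Cmd.WF, Test.WF, WExpr.WF, h33, this, and_true, true_and]
    omega
  | ex e F hF =>
    have h33 := h.2.1.2.mono (show 33 ≤ 34 by omega)
    have := hF h.1 h.2.2
    simp only [gen, emitLoop, emit, incr, Cmd.WF, Test.WF, WExpr.WF, h33, this, and_true, true_and]
    omega
  | cond e f F G hF hG =>
    exact ⟨⟨h.1.2.mono (by omega), h.2.1.2.mono (by omega)⟩, hF hd h.2.2.1, hG hd h.2.2.2⟩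

/-- The list `L` written into the memory from address `o` on. -/
def splice (M : ℕ → ℕ) (o : ℕ) (L : List ℕ) (a : ℕ) : ℕ :=
  if o ≤ a then L.getD (a - o) (M a) else M a

theorem splice_append (M : ℕ → ℕ) (o : ℕ) (L L' : List ℕ) :
    splice (splice M o L) (o + L.length) L' = splice M o (L ++ L') := by
  funext a
  unfold splice
  by_cases h₁ : o ≤ a
  · by_cases h₂ : o + L.length ≤ a
    · rw [if_pos h₂, if_pos h₁, if_pos h₁, List.getD_append_right _ _ _ _ (by omega),
        List.getD_eq_default L _ (by omega), Nat.sub_sub]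
    · rw [if_neg h₂, if_pos h₁, if_pos h₁, List.getD_append _ _ _ _ (by omega)]
  · rw [if_neg (by omega), if_neg h₁, if_neg h₁]

theorem splice_singleton (M : ℕ → ℕ) (o x : ℕ) : splice M o [x] = Function.update M o x := by
  funext a
  unfold splice
  by_cases h : a = o
  · subst h; simp
  · rw [Function.update_of_ne h]
    split
    · rw [List.getD_eq_default _ _ (by simp; omega)]
    · rfl

theorem splice_of_le (M : ℕ → ℕ) {o a : ℕ} {L : List ℕ} (h : o + L.length ≤ a) :
    splice M o L a = M a := by
  unfold splice
  rw [List.getD_eq_default _ _ (by omega), ite_self]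

theorem splice_get (M : ℕ → ℕ) (o : ℕ) (L : List ℕ) (i : ℕ) (h : i < L.length) :
    splice M o L (o + i) = L[i] := by
  unfold splice
  rw [if_pos (by omega), Nat.add_sub_cancel_left, List.getD_eq_getElem _ _ h]

/-- The list `L` is appended to the output, and the variables below `d` keep their values. -/
structure Emits (d : ℕ) (L : List ℕ) (σ σ' : Store) : Prop where
  out : σ'.V 30 = σ.V 30 + L.length
  mem : σ'.M = splice σ.M (σ.V 30) L
  base : σ'.V 31 = σ.V 31
  vars : ∀ i < d, σ'.V i = σ.V i

theorem Emits.append {d : ℕ} {L L' : List ℕ} {σ σ₁ σ₂ : Store} (h : Emits d L σ σ₁)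
    (h' : Emits d L' σ₁ σ₂) : Emits d (L ++ L') σ σ₂ where
  out := by rw [h'.out, h.out, List.length_append, add_assoc]
  mem := by rw [h'.mem, h.mem, h.out, splice_append]
  base := h'.base.trans h.base
  vars i hi := (h'.vars i hi).trans (h.vars i hi)

/-- There is space for `n` more output symbols below the input, which is still in place. -/
structure Room (inp : ℕ → ℕ) (n : ℕ) (σ : Store) : Prop where
  out : 64 ≤ σ.V 30
  room : σ.V 30 + n ≤ σ.V 31
  inp : ∀ j, σ.M (σ.V 31 + j) = inp j

theorem Room.emits {inp : ℕ → ℕ} {n n' d : ℕ} {σ σ' : Store} {L : List ℕ} (h : Room inp n σ)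
    (h' : Emits d L σ σ') (hn : L.length + n' ≤ n) : Room inp n' σ' where
  out := by rw [h'.out]; have := h.out; omega
  room := by rw [h'.out, h'.base]; have := h.room; omega
  inp j := by rw [h'.base, h'.mem, splice_of_le _ (by have := h.room; omega), h.inp]

theorem Cmd.Ends.emits_seq {w d T₁ T₂ n : ℕ} {inp : ℕ → ℕ} {g₁ g₂ : Cmd} {L₁ L₂ : List ℕ}
    {σ : Store} (hr : Room inp n σ) (hn : L₁.length + L₂.length ≤ n)
    (h₁ : Cmd.Ends w g₁ T₁ (Emits d L₁ σ) σ)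
    (h₂ : ∀ σ₁, Emits d L₁ σ σ₁ → Room inp L₂.length σ₁ → Cmd.Ends w g₂ T₂ (Emits d L₂ σ₁) σ₁) :
    Cmd.Ends w (.seq g₁ g₂) (T₁ + T₂) (Emits d (L₁ ++ L₂) σ) σ :=
  h₁.seq' fun σ₁ h => (h₂ σ₁ h (hr.emits h hn)).mono le_rfl fun _ h' => h.append h'

theorem emit_spec {w d n : ℕ} {inp : ℕ → ℕ} {e : WExpr} {σ : Store} (hd : d ≤ 30)
    (hok : e.Ok w σ.V) (hr : Room inp n σ) (hn : 1 ≤ n) (hw : σ.V 31 + 1 < 2 ^ w) :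
    Cmd.Ends w (emit e) (e.len + 6) (Emits d [e.eval σ.V] σ) σ := by
  have h₁ := hr.out
  have h₂ := hr.room
  have : (emit e).cost = e.len + 6 := by
    simp [emit, Cmd.cost, Cmd.size, WExpr.len, BinOp.code]; omega
  rw [← this]
  refine Cmd.Ends.of_wp ?_
  simp only [emit, Cmd.wp, WExpr.Ok, WExpr.eval, BinOp.eval]
  refine ⟨by omega, hok, h₁, by omega, ?_⟩
  refine ⟨by simp, by simp [splice_singleton], by simp, fun i hi => ?_⟩
  simp [show i ≠ 30 by omega]

theorem emitConst_spec {w d n h : ℕ} {inp : ℕ → ℕ} {σ : Store} (hd : d ≤ 30)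
    (hok : h + 1 < 2 ^ w) (hr : Room inp n σ) (hn : 1 ≤ n) (hw : σ.V 31 + 1 < 2 ^ w) :
    Cmd.Ends w (emit (.const h)) 7 (Emits d [h] σ) σ :=
  emit_spec hd hok hr hn hw

theorem length_flatMap_range_le (f : ℕ → List ℕ) {j m : ℕ} (h : j ≤ m) :
    ((List.range j).flatMap f).length ≤ ((List.range m).flatMap f).length := by
  induction m, h using Nat.le_induction with
  | base => exact le_rfl
  | succ m _ ih => rw [List.range_succ, List.flatMap_append, List.length_append]; omega

theorem WExpr.Ok.congr {w d : ℕ} {e : WExpr} {V V' : ℕ → ℕ} (h : e.Ok w V) (hb : e.Below d)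
    (hV : ∀ i < d, V i = V' i) : e.Ok w V' := by
  induction e with
  | const k => exact h
  | var i => simpa [Ok, hV i hb] using h
  | op o e f he hf =>
    refine ⟨he h.1 hb.1, hf h.2.1 hb.2, ?_⟩
    rw [← hb.1.eval_congr hV, ← hb.2.eval_congr hV]
    exact h.2.2

theorem emitLoop_spec {w d h T m : ℕ} {inp : ℕ → ℕ} {e : WExpr} {g : Cmd} (L : ℕ → List ℕ)
    {σ₀ : Store} (hd : d ≤ 28) (he : e.Below d) (hm : e.eval σ₀.V = m) (hok : e.Ok w σ₀.V)
    (hr : Room inp ((List.range m).flatMap fun i => h :: L i).length σ₀)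
    (hh : h + 1 < 2 ^ w) (hw : σ₀.V 31 + 1 < 2 ^ w) (h₀ : σ₀.V d = 0)
    (hg : ∀ i < m, ∀ σ, σ.V d = i → (∀ j < d, σ.V j = σ₀.V j) → σ.V 31 = σ₀.V 31 →
      Room inp (L i).length σ → Cmd.Ends w g T (Emits (d + 1) (L i) σ) σ) :
    Cmd.Ends w (emitLoop d h e g) (m * ((e.len + 2) + (7 + (T + 4)) + 1) + (e.len + 3))
      (Emits d ((List.range m).flatMap fun i => h :: L i) σ₀) σ₀ := by
  have hlen : (Test.lt (.var d) e).len = e.len + 2 := by simp [Test.len, WExpr.len]; omega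
  have hm' : m + 1 < 2 ^ w := hm ▸ hok.eval_lt
  have key := Cmd.Ends.loop (w := w) (t := .lt (.var d) e)
    (c := .seq (emit (.const h)) (.seq g (incr d))) (T := 7 + (T + 4)) (m := m)
    (fun j σ => Emits d ((List.range j).flatMap fun i => h :: L i) σ₀ σ ∧ σ.V d = j)
    ?_ ?_ (σ := σ₀) ⟨⟨by simp, by funext a; simp [splice], rfl, fun _ _ => rfl⟩, h₀⟩
  · rw [hlen] at key
    exact key.mono le_rfl fun σ hσ => hσ.1
  · rintro j hj σ ⟨hE, hjd⟩
    have hev : e.eval σ.V = m := by rw [he.eval_congr hE.vars, hm]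
    have hl := length_flatMap_range_le (fun i => h :: L i) (Nat.succ_le_of_lt hj)
    simp only [Nat.succ_eq_add_one, List.range_succ, List.flatMap_append, List.length_append,
      List.flatMap_cons, List.flatMap_nil, List.length_nil, List.length_cons] at hl
    have hr₁ : Room inp ((L j).length + 1) σ := hr.emits hE (by omega)
    refine ⟨⟨?_, hok.congr he fun i hi => (hE.vars i hi).symm⟩, ?_, ?_⟩
    · simp only [WExpr.Ok]; omega
    · simp only [Test.Holds, WExpr.eval]; omega
    · have e₁ := emitConst_spec (d := d + 1) (by omega) hh hr₁ (by omega) (by rwa [hE.base])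
      refine e₁.seq' fun σ₁ h₁ => ?_
      have hr₂ : Room inp (L j).length σ₁ := hr₁.emits h₁ (by simp; omega)
      have e₂ := hg j hj σ₁ (by rw [h₁.vars d (by omega), hjd])
        (fun i hi => by rw [h₁.vars i (by omega), hE.vars i hi])
        (by rw [h₁.base, hE.base]) hr₂
      refine e₂.seq' fun σ₂ h₂ => ?_
      have hd₂ : σ₂.V d = j := by rw [h₂.vars d (by omega), h₁.vars d (by omega), hjd]
      have : (incr d).cost = 4 := rfl
      rw [← this]
      refine Cmd.Ends.of_wp ?_
      simp only [incr, Cmd.wp, WExpr.Ok, WExpr.eval, BinOp.eval]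
      refine ⟨by omega, ?_, by simp [hd₂]⟩
      have h₁₂ := h₁.append h₂
      rw [List.range_succ, List.flatMap_append]
      refine hE.append ⟨?_, ?_, ?_, fun i hi => ?_⟩
      · simpa [show (30 : ℕ) ≠ d by omega] using h₁₂.out
      · simpa using h₁₂.mem
      · simpa [show (31 : ℕ) ≠ d by omega] using h₁₂.base
      · simpa [show i ≠ d by omega] using h₁₂.vars i (by omega)
  · rintro σ ⟨hE, hjd⟩
    have hev : e.eval σ.V = m := by rw [he.eval_congr hE.vars, hm]
    refine ⟨⟨?_, hok.congr he fun i hi => (hE.vars i hi).symm⟩, ?_⟩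
    · simp only [WExpr.Ok]; omega
    · simp only [Test.Holds, WExpr.eval]; omega

/-- Exponent of a polynomial bound for the time to generate an instance of a term scheme. -/
def TermScheme.deg : TermScheme → ℕ
  | num e => e.deg + (e.len + 21) + (e.len + 12) + 1
  | var e => e.deg + e.len + 20
  | inp e => e.deg + e.len + 20
  | add s t => 7 + (s.deg + t.deg + 1) + 1
  | mul s t => 7 + (s.deg + t.deg + 1) + 1

/-- Exponent of a polynomial bound for the time to generate an instance of a formula scheme. -/
def FormulaScheme.deg : FormulaScheme → ℕ
  | eq s t => 7 + (s.deg + t.deg + 1) + 1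
  | lt s t => 7 + (s.deg + t.deg + 1) + 1
  | and F G => 7 + (F.deg + G.deg + 1) + 1
  | or F G => 7 + (F.deg + G.deg + 1) + 1
  | not F => 7 + F.deg + 1
  | all e F => e.deg + (e.len + 14 + (e.deg + 1) * F.deg + 1) + (e.len + 26) + 1
  | ex e F => e.deg + (e.len + 14 + (e.deg + 1) * F.deg + 1) + (e.len + 26) + 1
  | cond e f F G => e.deg + f.deg + ((e.len + f.len + 2) + (F.deg + G.deg) + 1)

theorem length_flatMap_le {m B : ℕ} {f : ℕ → List ℕ} (h : ∀ i < m, (f i).length ≤ B) :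
    ((List.range m).flatMap f).length ≤ m * B := by
  induction m with
  | zero => simp
  | succ m ih =>
    have h₁ := ih fun i hi => h i (by omega)
    have h₂ := h m (by omega)
    rw [List.range_succ, List.flatMap_append, List.length_append, Nat.succ_mul]
    simp only [List.flatMap_cons, List.flatMap_nil, List.append_nil]
    omega

section Bounds

variable {X : ℕ} (hX : 2 ≤ X) {inp : ℕ → ℕ}
include hX

theorem three_le_pow {x y a b : ℕ} (hx : x ≤ X ^ a) (hy : y ≤ X ^ b) :
    7 + (x + y) ≤ X ^ (7 + (a + b + 1) + 1) :=
  add_le_pow hX (const_le_pow hX 7) (add_le_pow hX hx hy)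

theorem num_le_pow {m : ℕ} {e : WExpr} (hm : m ≤ X ^ e.deg) :
    m * (e.len + 21) + (e.len + 12) ≤ X ^ (TermScheme.num e).deg :=
  add_le_pow hX (mul_le_pow hm (const_le_pow hX _)) (const_le_pow hX _)

theorem all_le_pow {m T : ℕ} {e : WExpr} {F : FormulaScheme} (hm : m ≤ X ^ e.deg)
    (hT : T ≤ (X ^ (e.deg + 1)) ^ F.deg) :
    m * (e.len + 14 + T) + (e.len + 26) ≤ X ^ (FormulaScheme.all e F).deg := by
  rw [← pow_mul] at hT
  exact add_le_pow hX (mul_le_pow hm (add_le_pow hX (const_le_pow hX _) hT)) (const_le_pow hX _)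

theorem update_le_pow {d i : ℕ} {V : ℕ → ℕ} {e : WExpr} (hV : ∀ i < d, V i ≤ X)
    (hi : i ≤ X ^ e.deg) : ∀ j < d + 1, Function.update V d i j ≤ X ^ (e.deg + 1) := by
  intro j hj
  by_cases h : j = d
  · subst h
    simpa using le_pow_of_le hX hi (Nat.le_succ _)
  · rw [Function.update_of_ne h]
    exact (hV j (by omega)).trans (Nat.le_self_pow (by omega) X)

theorem two_le_pow (k : ℕ) : 2 ≤ X ^ (k + 1) := hX.trans (Nat.le_self_pow (by omega) X)

theorem TermScheme.length_le {T : TermScheme} {d : ℕ} {V : ℕ → ℕ} (hwf : T.WF d)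
    (hV : ∀ i < d, V i ≤ X) : (T.toTerm inp V).code.length ≤ X ^ T.deg := by
  induction T with
  | num e =>
    have h₁ := hwf.1.eval_le hX hV
    have h₂ := length_flatMap_le (m := e.eval V) (f := fun _ => [2, 1]) (B := 2) fun _ _ => le_rfl
    refine le_trans ?_ (num_le_pow hX h₁)
    rw [toTerm, Term.code_numeral, List.length_append]
    simp only [List.length_singleton]
    nlinarith
  | var e =>
    exact Nat.one_le_pow _ _ (by omega)
  | inp e =>
    rw [toTerm]
    split <;> exact Nat.one_le_pow _ _ (by omega)
  | add s t hs ht =>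
    refine le_trans ?_ (three_le_pow hX (hs hwf.1) (ht hwf.2))
    simp only [toTerm, Term.code, List.length_cons, List.length_append]; omega
  | mul s t hs ht =>
    refine le_trans ?_ (three_le_pow hX (hs hwf.1) (ht hwf.2))
    simp only [toTerm, Term.code, List.length_cons, List.length_append]; omega

omit hX in
theorem FormulaScheme.length_le (hX : 2 ≤ X) {F : FormulaScheme} {d : ℕ} {V : ℕ → ℕ}
    (hwf : F.WF d) (hV : ∀ i < d, V i ≤ X) : (F.toFormula inp d V).code.length ≤ X ^ F.deg := by
  induction F generalizing d V X with
  | eq s t =>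
    refine le_trans ?_
      (three_le_pow hX (TermScheme.length_le (inp := inp) hX hwf.1 hV)
        (TermScheme.length_le (inp := inp) hX hwf.2 hV))
    simp only [toFormula, Formula.code, List.length_cons, List.length_append]; omega
  | lt s t =>
    refine le_trans ?_
      (three_le_pow hX (TermScheme.length_le (inp := inp) hX hwf.1 hV)
        (TermScheme.length_le (inp := inp) hX hwf.2 hV))
    simp only [toFormula, Formula.code, List.length_cons, List.length_append]; omega
  | and F G hF hG =>
    refine le_trans ?_ (three_le_pow hX (hF hX hwf.1 hV) (hG hX hwf.2 hV))
    simp only [toFormula, Formula.code, List.length_cons, List.length_append]; omega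
  | or F G hF hG =>
    refine le_trans ?_ (three_le_pow hX (hF hX hwf.1 hV) (hG hX hwf.2 hV))
    simp only [toFormula, Formula.code, List.length_cons, List.length_append]; omega
  | not F hF =>
    refine le_trans ?_ (add_le_pow hX (const_le_pow hX 7) (hF hX hwf hV))
    simp [toFormula, Formula.code]
  | all e F hF =>
    have h₁ := hwf.2.1.1.eval_le hX hV
    refine le_trans ?_ (all_le_pow hX h₁ le_rfl)
    rw [toFormula, Formula.code_bigAnd, List.length_append, List.flatMap_map]
    refine Nat.add_le_add ((length_flatMap_le fun i hi => ?_).trans le_rfl) (by simp)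
    have := hF (two_le_pow hX e.deg) hwf.2.2 (update_le_pow hX hV (hi.le.trans h₁))
    simp only [List.length_cons]; omega
  | ex e F hF =>
    have h₁ := hwf.2.1.1.eval_le hX hV
    refine le_trans ?_ (all_le_pow hX h₁ le_rfl)
    rw [toFormula, Formula.code_bigOr, List.length_append, List.flatMap_map]
    refine Nat.add_le_add ((length_flatMap_le fun i hi => ?_).trans le_rfl) (by simp)
    have := hF (two_le_pow hX e.deg) hwf.2.2 (update_le_pow hX hV (hi.le.trans h₁))
    simp only [List.length_cons]; omega
  | cond e f F G hF hG =>
    rw [toFormula]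
    split
    · exact le_pow_of_le hX (hF hX hwf.2.2.1 hV) (by simp only [deg]; omega)
    · exact le_pow_of_le hX (hG hX hwf.2.2.2 hV) (by simp only [deg]; omega)

/-- Two emitting programs after an emitted symbol. -/
theorem emitNode_spec {w d h n₁ n₂ : ℕ} {g₁ g₂ : Cmd} {L₁ L₂ : List ℕ} {σ : Store} (hd : d ≤ 28)
    (hh : h < 10) (hw : 10 + σ.V 31 + 1 < 2 ^ w) (hr : Room inp (h :: (L₁ ++ L₂)).length σ)
    (h₁ : ∀ σ', (∀ i < d, σ'.V i = σ.V i) → σ'.V 31 = σ.V 31 → Room inp L₁.length σ' →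
      Cmd.Ends w g₁ (X ^ n₁) (Emits d L₁ σ') σ')
    (h₂ : ∀ σ', (∀ i < d, σ'.V i = σ.V i) → σ'.V 31 = σ.V 31 → Room inp L₂.length σ' →
      Cmd.Ends w g₂ (X ^ n₂) (Emits d L₂ σ') σ') :
    Cmd.Ends w (.seq (emit (.const h)) (.seq g₁ g₂)) (X ^ (7 + (n₁ + n₂ + 1) + 1))
      (Emits d (h :: (L₁ ++ L₂)) σ) σ := by
  refine Cmd.Ends.mono (Q := Emits d ([h] ++ (L₁ ++ L₂)) σ) ?_
    (three_le_pow hX (le_refl (X ^ n₁)) (le_refl (X ^ n₂))) fun _ h => h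
  refine Cmd.Ends.emits_seq hr (by simp; omega)
    (emitConst_spec (by omega) (by omega) hr (by simp) (by omega)) fun σ₁ e₁ r₁ => ?_
  have r₁' : Room inp L₁.length σ₁ :=
    ⟨r₁.out, by have := r₁.room; rw [List.length_append] at this; omega, r₁.inp⟩
  refine Cmd.Ends.emits_seq r₁ (by simp) (h₁ σ₁ e₁.vars e₁.base r₁') fun σ₂ e₂ r₂ => ?_
  exact h₂ σ₂ (fun i hi => (e₂.vars i hi).trans (e₁.vars i hi)) (e₂.base.trans e₁.base) r₂

theorem TermScheme.gen_spec {w d : ℕ} {T : TermScheme} {V : ℕ → ℕ} (hd : d ≤ 28) (hwf : T.WF d)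
    (hV : ∀ i < d, V i ≤ X) (hinp : ∀ j, inp j = 0 ∨ inp j = 1) {σ : Store}
    (hσ : ∀ i < d, σ.V i = V i) (hr : Room inp (T.toTerm inp V).code.length σ)
    (hw : X ^ T.deg + 20 + σ.V 31 < 2 ^ w) :
    Cmd.Ends w (T.gen d) (X ^ T.deg) (Emits d (T.toTerm inp V).code σ) σ := by
  induction T generalizing σ with
  | num e =>
    have hσX : ∀ i < d, σ.V i ≤ X := fun i hi => hσ i hi ▸ hV i hi
    have h₁ := hwf.1.eval_le hX hV
    have h₂ : e.eval σ.V = e.eval V := hwf.1.eval_congr hσ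
    have hdeg := le_pow_of_le hX le_rfl (show e.deg ≤ (num e).deg by simp [deg]; omega)
    have hok : e.Ok w σ.V := hwf.1.ok hX hσX (by omega)
    refine Cmd.Ends.mono (T := 2 + ((e.eval V * ((e.len + 2) + (7 + (7 + 4)) + 1) + (e.len + 3))
      + 7)) (Q := Emits d (Term.numeral (e.eval V)).code σ) ?_ ?_ fun _ h => h
    · have hc : Cmd.wp w (.assign d (.const 0))
          (fun σ₁ => Emits d [] σ σ₁ ∧ σ₁.V d = 0) σ := by
        refine ⟨by simp only [WExpr.Ok]; omega, ⟨?_, ?_, ?_, fun i hi => ?_⟩, ?_⟩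
        · simp [show (30 : ℕ) ≠ d by omega]
        · funext a; simp [splice]
        · simp [show (31 : ℕ) ≠ d by omega]
        · simp [show i ≠ d by omega]
        · simp [WExpr.eval]
      refine (Cmd.Ends.of_wp hc).seq' fun σ₁ h₃ => ?_
      obtain ⟨h₃, h₄⟩ := h₃
      have hr₁ := hr.emits (n' := (Term.numeral (e.eval V)).code.length) h₃ (by simp [toTerm])
      have hb := h₃.base
      have h₅ : e.eval σ₁.V = e.eval V := by rw [hwf.1.eval_congr h₃.vars, h₂]
      rw [Term.code_numeral] at hr₁ ⊢
      have key := emitLoop_spec (w := w) (h := 2) (g := emit (.const 1)) (T := 7) (inp := inp)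
        (fun _ => [1]) hd hwf.1 h₅ (hok.congr hwf.1 fun i hi => (h₃.vars i hi).symm)
        ⟨hr₁.out, by have := hr₁.room; rw [List.length_append] at this; omega, hr₁.inp⟩
        (by omega) (by omega) h₄ (fun i _ σ' _ _ h₆ h₇ =>
          emitConst_spec (by omega) (by omega) h₇ (by simp) (by omega))
      refine (Cmd.Ends.emits_seq (L₂ := [0]) hr₁ (by simp) key fun σ₂ h₆ h₇ => ?_).mono le_rfl
        fun σ' h' => by simpa using h₃.append h'
      exact emitConst_spec (by omega) (by omega) h₇ (by simp) (by rw [h₆.base]; omega)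
    · refine le_trans (le_of_eq ?_) (num_le_pow hX h₁)
      ring
  | var e =>
    have hσX : ∀ i < d, σ.V i ≤ X := fun i hi => hσ i hi ▸ hV i hi
    have h₂ : e.eval σ.V = e.eval V := hwf.1.eval_congr hσ
    have hb : (WExpr.op .add (.const 10) e).Below d := ⟨trivial, hwf.1⟩
    have hdeg := le_pow_of_le hX le_rfl
      (show (WExpr.op .add (.const 10) e).deg ≤ (var e).deg by simp [deg, WExpr.deg]; omega)
    have := emit_spec (d := d) (by omega) (hb.ok hX hσX (w := w) (by omega)) hr (by
      simp [toTerm, Term.code]) (by omega)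
    refine this.mono (((const_le_pow hX _).trans (le_pow_of_le hX le_rfl ?_))) fun σ' h' => ?_
    · simp [deg, WExpr.len, BinOp.code]; omega
    · simpa [WExpr.eval, BinOp.eval, h₂, toTerm, Term.code] using h'
  | inp e =>
    have hσX : ∀ i < d, σ.V i ≤ X := fun i hi => hσ i hi ▸ hV i hi
    have h₁ := hwf.1.eval_le hX hV
    have h₂ : e.eval σ.V = e.eval V := hwf.1.eval_congr hσ
    have hdeg := le_pow_of_le hX le_rfl (show e.deg ≤ (TermScheme.inp e).deg by simp [deg]; omega)
    have hok : e.Ok w σ.V := hwf.1.ok hX hσX (by omega)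
    have ho := hr.out
    have hrm := hr.room
    have hc : Cmd.wp w (.load 29 (.op .add (.var 31) e))
        (fun σ₁ => Emits d [] σ σ₁ ∧ σ₁.V 29 = inp (e.eval V)) σ := by
      refine ⟨⟨?_, hok, ?_⟩, ?_, ⟨?_, ?_, ?_, fun i hi => ?_⟩, ?_⟩
      · simp only [WExpr.Ok]; omega
      · simp only [WExpr.eval, BinOp.eval]; omega
      · simp only [WExpr.eval, BinOp.eval]; omega
      · simp
      · funext a; simp [splice]
      · simp
      · simp [show i ≠ 29 by omega]
      · simp [WExpr.eval, BinOp.eval, hr.inp, h₂]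
    have h1 : (toTerm inp V (.inp e)).code = [inp (e.eval V)] := by
      rw [toTerm]
      rcases hinp (e.eval V) with h | h <;> simp [h, Term.code]
    have h2 : 7 + e.len + 3 ≤ X ^ (TermScheme.inp e).deg :=
      (const_le_pow hX _).trans (le_pow_of_le hX le_rfl (by simp [deg]; omega))
    rw [h1] at hr ⊢
    refine Cmd.Ends.mono ((Cmd.Ends.of_wp hc).seq' (T₂ := 7) fun σ₁ h₃ => ?_) ?_ fun _ h => h
    · obtain ⟨h₃, h₄⟩ := h₃
      have hr₁ := hr.emits (n' := 1) h₃ (by simp)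
      have hb := h₃.base
      have := emit_spec (w := w) (d := d) (e := .var 29) (by omega)
        (by simp only [WExpr.Ok]; rcases hinp (e.eval V) with h | h <;> omega) hr₁ le_rfl (by omega)
      refine this.mono le_rfl fun σ' h' => ?_
      simpa [WExpr.eval, h₄] using h₃.append h'
    · refine le_trans ?_ h2
      simp [Cmd.cost, Cmd.size, WExpr.len, BinOp.code]; omega
  | add s t hs ht =>
    have d₁ := le_pow_of_le hX le_rfl (show s.deg ≤ (add s t).deg by simp [deg]; omega)
    have d₂ := le_pow_of_le hX le_rfl (show t.deg ≤ (add s t).deg by simp [deg]; omega)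
    exact emitNode_spec hX hd (by omega) (by omega) hr
      (fun σ' h₁ h₂ h₃ => hs hwf.1 (fun i hi => (h₁ i hi).trans (hσ i hi)) h₃ (by rw [h₂]; omega))
      (fun σ' h₁ h₂ h₃ => ht hwf.2 (fun i hi => (h₁ i hi).trans (hσ i hi)) h₃ (by rw [h₂]; omega))
  | mul s t hs ht =>
    have d₁ := le_pow_of_le hX le_rfl (show s.deg ≤ (mul s t).deg by simp [deg]; omega)
    have d₂ := le_pow_of_le hX le_rfl (show t.deg ≤ (mul s t).deg by simp [deg]; omega)
    exact emitNode_spec hX hd (by omega) (by omega) hr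
      (fun σ' h₁ h₂ h₃ => hs hwf.1 (fun i hi => (h₁ i hi).trans (hσ i hi)) h₃ (by rw [h₂]; omega))
      (fun σ' h₁ h₂ h₃ => ht hwf.2 (fun i hi => (h₁ i hi).trans (hσ i hi)) h₃ (by rw [h₂]; omega))

/-- Common part of the two quantifiers: a loop over the instances, with a separating symbol `h`
before each of them, and three symbols at the end. -/
theorem emitQuantifier_spec {w d h k : ℕ} {e : WExpr} {F : FormulaScheme} {V : ℕ → ℕ} (hd : d < 28)
    (he : e.Below d) (hh : h < 10) (hk : k < 10) (hV : ∀ i < d, V i ≤ X) {σ : Store}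
    (hσ : ∀ i < d, σ.V i = V i) (L : ℕ → List ℕ)
    (hr : Room inp (((List.range (e.eval V)).flatMap fun i => h :: L i) ++ [k, 0, 0]).length σ)
    (hw : X ^ (FormulaScheme.all e F).deg + 20 + σ.V 31 < 2 ^ w)
    (hF : ∀ i < e.eval V, ∀ σ', (∀ j < d + 1, σ'.V j = Function.update V d i j) →
      σ'.V 31 = σ.V 31 → Room inp (L i).length σ' →
      Cmd.Ends w (F.gen (d + 1)) ((X ^ (e.deg + 1)) ^ F.deg) (Emits (d + 1) (L i) σ') σ') :
    Cmd.Ends w (.seq (.assign d (.const 0)) (.seq (emitLoop d h e (F.gen (d + 1)))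
      (.seq (emit (.const k)) (.seq (emit (.const 0)) (emit (.const 0))))))
      (X ^ (FormulaScheme.all e F).deg)
      (Emits d (((List.range (e.eval V)).flatMap fun i => h :: L i) ++ [k, 0, 0]) σ) σ := by
  have hσX : ∀ i < d, σ.V i ≤ X := fun i hi => hσ i hi ▸ hV i hi
  have h₁ := he.eval_le hX hV
  have h₂ : e.eval σ.V = e.eval V := he.eval_congr hσ
  have hdeg := le_pow_of_le hX le_rfl
    (show e.deg ≤ (FormulaScheme.all e F).deg by simp [FormulaScheme.deg]; omega)
  have hok : e.Ok w σ.V := he.ok hX hσX (by omega)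
  refine Cmd.Ends.mono (T := 2 + ((e.eval V * ((e.len + 2) +
    (7 + ((X ^ (e.deg + 1)) ^ F.deg + 4)) + 1) + (e.len + 3)) + (7 + (7 + 7))))
    ?_ ?_ fun _ h => h
  · have hc : Cmd.wp w (.assign d (.const 0))
        (fun σ₁ => Emits d [] σ σ₁ ∧ σ₁.V d = 0) σ := by
      refine ⟨by simp only [WExpr.Ok]; omega, ⟨?_, ?_, ?_, fun i hi => ?_⟩, ?_⟩
      · simp [show (30 : ℕ) ≠ d by omega]
      · funext a; simp [splice]
      · simp [show (31 : ℕ) ≠ d by omega]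
      · simp [show i ≠ d by omega]
      · simp [WExpr.eval]
    refine (Cmd.Ends.of_wp hc).seq' fun σ₁ h₃ => ?_
    obtain ⟨h₃, h₄⟩ := h₃
    have hr₁ := hr.emits (n' := (((List.range (e.eval V)).flatMap fun i => h :: L i)
      ++ [k, 0, 0]).length) h₃ (by simp)
    have hb := h₃.base
    have h₅ : e.eval σ₁.V = e.eval V := by rw [he.eval_congr h₃.vars, h₂]
    have key := emitLoop_spec (w := w) (h := h) (g := F.gen (d + 1))
      (T := (X ^ (e.deg + 1)) ^ F.deg) (inp := inp)
      L hd.le he h₅ (hok.congr he fun i hi => (h₃.vars i hi).symm)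
      ⟨hr₁.out, by have := hr₁.room; rw [List.length_append] at this; omega, hr₁.inp⟩
      (by omega) (by omega) h₄ (fun i hi σ' g₁ g₂ g₃ g₄ => hF i hi σ' (fun j hj => ?_)
        (by rw [g₃, hb]) g₄)
    · refine (Cmd.Ends.emits_seq (L₂ := [k, 0, 0]) hr₁ (by simp) key fun σ₂ e₂ r₂ => ?_).mono le_rfl
        fun σ' h' => by simpa using h₃.append h'
      have b₂ := e₂.base
      refine Cmd.Ends.emits_seq (L₁ := [k]) (L₂ := [0, 0]) r₂ (by simp)
        (emitConst_spec (by omega) (by omega) r₂ (by simp) (by omega)) fun σ₃ e₃ r₃ => ?_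
      have b₃ := e₃.base
      refine Cmd.Ends.emits_seq (L₁ := [0]) (L₂ := [0]) r₃ (by simp)
        (emitConst_spec (by omega) (by omega) r₃ (by simp) (by omega)) fun σ₄ e₄ r₄ => ?_
      have b₄ := e₄.base
      exact emitConst_spec (by omega) (by omega) r₄ (by simp) (by omega)
    · by_cases hjd : j = d
      · subst hjd; simpa using g₁
      · rw [Function.update_of_ne hjd, g₂ j (by omega), h₃.vars j (by omega), hσ j (by omega)]
  · refine le_trans (le_of_eq ?_) (all_le_pow hX h₁ le_rfl)
    ring

omit hX in
/-- The generator of a formula scheme is correct, and its running time is polynomial. -/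
theorem FormulaScheme.gen_spec (hX : 2 ≤ X) {w d : ℕ} {F : FormulaScheme} {V : ℕ → ℕ} (hd : d ≤ 28)
    (hwf : F.WF d) (hV : ∀ i < d, V i ≤ X) (hinp : ∀ j, inp j = 0 ∨ inp j = 1) {σ : Store}
    (hσ : ∀ i < d, σ.V i = V i) (hr : Room inp (F.toFormula inp d V).code.length σ)
    (hw : X ^ F.deg + 20 + σ.V 31 < 2 ^ w) :
    Cmd.Ends w (F.gen d) (X ^ F.deg) (Emits d (F.toFormula inp d V).code σ) σ := by
  induction F generalizing d V X σ with
  | eq s t =>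
    have d₁ := le_pow_of_le hX le_rfl (show s.deg ≤ (eq s t).deg by simp [deg]; omega)
    have d₂ := le_pow_of_le hX le_rfl (show t.deg ≤ (eq s t).deg by simp [deg]; omega)
    exact emitNode_spec hX hd (by omega) (by omega) hr
      (fun σ' h₁ h₂ h₃ => TermScheme.gen_spec hX hd hwf.1 hV hinp
        (fun i hi => (h₁ i hi).trans (hσ i hi)) h₃ (by rw [h₂]; omega))
      (fun σ' h₁ h₂ h₃ => TermScheme.gen_spec hX hd hwf.2 hV hinp
        (fun i hi => (h₁ i hi).trans (hσ i hi)) h₃ (by rw [h₂]; omega))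
  | lt s t =>
    have d₁ := le_pow_of_le hX le_rfl (show s.deg ≤ (lt s t).deg by simp [deg]; omega)
    have d₂ := le_pow_of_le hX le_rfl (show t.deg ≤ (lt s t).deg by simp [deg]; omega)
    exact emitNode_spec hX hd (by omega) (by omega) hr
      (fun σ' h₁ h₂ h₃ => TermScheme.gen_spec hX hd hwf.1 hV hinp
        (fun i hi => (h₁ i hi).trans (hσ i hi)) h₃ (by rw [h₂]; omega))
      (fun σ' h₁ h₂ h₃ => TermScheme.gen_spec hX hd hwf.2 hV hinp
        (fun i hi => (h₁ i hi).trans (hσ i hi)) h₃ (by rw [h₂]; omega))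
  | and F G hF hG =>
    have d₁ := le_pow_of_le hX le_rfl (show F.deg ≤ (and F G).deg by simp [deg]; omega)
    have d₂ := le_pow_of_le hX le_rfl (show G.deg ≤ (and F G).deg by simp [deg]; omega)
    exact emitNode_spec hX hd (by omega) (by omega) hr
      (fun σ' h₁ h₂ h₃ => hF hX hd hwf.1 hV
        (fun i hi => (h₁ i hi).trans (hσ i hi)) h₃ (by rw [h₂]; omega))
      (fun σ' h₁ h₂ h₃ => hG hX hd hwf.2 hV
        (fun i hi => (h₁ i hi).trans (hσ i hi)) h₃ (by rw [h₂]; omega))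
  | or F G hF hG =>
    have d₁ := le_pow_of_le hX le_rfl (show F.deg ≤ (or F G).deg by simp [deg]; omega)
    have d₂ := le_pow_of_le hX le_rfl (show G.deg ≤ (or F G).deg by simp [deg]; omega)
    exact emitNode_spec hX hd (by omega) (by omega) hr
      (fun σ' h₁ h₂ h₃ => hF hX hd hwf.1 hV
        (fun i hi => (h₁ i hi).trans (hσ i hi)) h₃ (by rw [h₂]; omega))
      (fun σ' h₁ h₂ h₃ => hG hX hd hwf.2 hV
        (fun i hi => (h₁ i hi).trans (hσ i hi)) h₃ (by rw [h₂]; omega))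
  | not F hF =>
    have d₁ := le_pow_of_le hX le_rfl (show F.deg ≤ (not F).deg by simp [deg]; omega)
    refine (Cmd.Ends.emits_seq (L₁ := [9]) hr (by simp [toFormula, Formula.code]; omega)
      (emitConst_spec (by omega) (by omega) hr (by simp [toFormula, Formula.code]) (by omega))
      fun σ₁ h₁ r₁ => hF hX hd hwf hV
        (fun i hi => (h₁.vars i hi).trans (hσ i hi)) r₁ (by rw [h₁.base]; omega)).mono
      (add_le_pow hX (const_le_pow hX 7) le_rfl) fun _ h => h
  | all e F hF =>
    have h₁ := hwf.2.1.1.eval_le hX hV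
    have hb : (X ^ (e.deg + 1)) ^ F.deg ≤ X ^ (all e F).deg := by
      rw [← pow_mul]; exact le_pow_of_le hX le_rfl (by simp only [deg]; omega)
    rw [toFormula, Formula.code_bigAnd, List.flatMap_map] at hr ⊢
    exact emitQuantifier_spec hX hwf.1 hwf.2.1.1 (by omega) (by omega) hV hσ _ hr hw
      fun i hi σ' g₁ g₂ g₃ => hF (two_le_pow hX e.deg) hwf.1 hwf.2.2
        (update_le_pow hX hV (hi.le.trans h₁)) g₁ g₃ (by
          rw [g₂]; exact (Nat.add_le_add_right (Nat.add_le_add_right hb 20) _).trans_lt hw)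
  | ex e F hF =>
    have h₁ := hwf.2.1.1.eval_le hX hV
    have hb : (X ^ (e.deg + 1)) ^ F.deg ≤ X ^ (ex e F).deg := by
      rw [← pow_mul]; exact le_pow_of_le hX le_rfl (by simp only [deg]; omega)
    rw [toFormula, Formula.code_bigOr, List.flatMap_map] at hr ⊢
    exact emitQuantifier_spec hX hwf.1 hwf.2.1.1 (by omega) (by omega) hV hσ _ hr hw
      fun i hi σ' g₁ g₂ g₃ => hF (two_le_pow hX e.deg) hwf.1 hwf.2.2
        (update_le_pow hX hV (hi.le.trans h₁)) g₁ g₃ (by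
          rw [g₂]; exact (Nat.add_le_add_right (Nat.add_le_add_right hb 20) _).trans_lt hw)
  | cond e f F G hF hG =>
    have hσX : ∀ i < d, σ.V i ≤ X := fun i hi => hσ i hi ▸ hV i hi
    have d₁ := le_pow_of_le hX le_rfl (show e.deg ≤ (cond e f F G).deg by simp [deg]; omega)
    have d₂ := le_pow_of_le hX le_rfl (show f.deg ≤ (cond e f F G).deg by simp [deg]; omega)
    have d₃ := le_pow_of_le hX le_rfl (show F.deg ≤ (cond e f F G).deg by simp [deg]; omega)
    have d₄ := le_pow_of_le hX le_rfl (show G.deg ≤ (cond e f F G).deg by simp [deg]; omega)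
    have e₁ : e.eval σ.V = e.eval V := hwf.1.1.eval_congr hσ
    have e₂ : f.eval σ.V = f.eval V := hwf.2.1.1.eval_congr hσ
    refine (Cmd.Ends.ite (t := .lt e f) (T := X ^ (F.deg + G.deg))
      ⟨hwf.1.1.ok hX hσX (by omega), hwf.2.1.1.ok hX hσX (by omega)⟩
      (fun h => ?_) (fun h => ?_)).mono ?_ fun _ h => h
    · simp only [Test.Holds, e₁, e₂] at h
      rw [toFormula, if_pos h] at hr ⊢
      exact (hF hX hd hwf.2.2.1 hV hσ hr (by omega)).mono
        (le_pow_of_le hX le_rfl (by omega)) fun _ h => h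
    · simp only [Test.Holds, e₁, e₂] at h
      rw [toFormula, if_neg h] at hr ⊢
      exact (hG hX hd hwf.2.2.2 hV hσ hr (by omega)).mono
        (le_pow_of_le hX le_rfl (by omega)) fun _ h => h
    · have := add_le_pow hX (const_le_pow hX (e.len + f.len + 2)) (le_refl (X ^ (F.deg + G.deg)))
      refine le_trans ?_ (le_pow_of_le hX this (show _ ≤ (cond e f F G).deg by
        simp only [deg]; omega))
      simp only [Test.len]; omega

end Bounds

/-! ### The effect of an instruction -/

/-- The effect of one instruction: the address of a word register and its new content, the address
of a real register and its new content, and the new program counter. -/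
structure Effect where
  aw : ℕ
  vw : ℕ
  ar : ℕ
  vr : ℝ
  pc : ℕ

/-- The effect of an instruction at word size `w`. The address `2 ^ w`, which is not a word, stands
for the absence of a write operation; stopping instructions change nothing. -/
noncomputable def Instr.effect (w : ℕ) (s : Config) : Instr → Effect
  | .wConst i j => ⟨i, j, 2 ^ w, 0, s.pc + 1⟩
  | .wCopy i j => ⟨i, s.W j, 2 ^ w, 0, s.pc + 1⟩
  | .wStore i j => ⟨s.W i, s.W j, 2 ^ w, 0, s.pc + 1⟩
  | .wLoad i j => ⟨i, s.W (s.W j), 2 ^ w, 0, s.pc + 1⟩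
  | .wArith o i j k => ⟨i, (o.eval w (s.W j) (s.W k)).getD 0, 2 ^ w, 0, s.pc + 1⟩
  | .wIfEq i j l => ⟨2 ^ w, 0, 2 ^ w, 0, if s.W i = s.W j then l else s.pc + 1⟩
  | .wIfLt i j l => ⟨2 ^ w, 0, 2 ^ w, 0, if s.W i < s.W j then l else s.pc + 1⟩
  | .rZero i => ⟨2 ^ w, 0, i, 0, s.pc + 1⟩
  | .rOne i => ⟨2 ^ w, 0, i, 1, s.pc + 1⟩
  | .rCopy i j => ⟨2 ^ w, 0, i, s.R j, s.pc + 1⟩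
  | .rStore i j => ⟨2 ^ w, 0, s.W i, s.R j, s.pc + 1⟩
  | .rLoad i j => ⟨2 ^ w, 0, i, s.R (s.W j), s.pc + 1⟩
  | .rCastConst i j => ⟨2 ^ w, 0, i, j, s.pc + 1⟩
  | .rCastWord i j => ⟨2 ^ w, 0, i, s.W j, s.pc + 1⟩
  | .rArith o i j k => ⟨2 ^ w, 0, i, (o.eval (s.R j) (s.R k)).getD 0, s.pc + 1⟩
  | .rSqrt i j => ⟨2 ^ w, 0, i, √(s.R j), s.pc + 1⟩
  | .rIfZero i l => ⟨2 ^ w, 0, 2 ^ w, 0, if s.R i = 0 then l else s.pc + 1⟩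
  | .rIfPos i l => ⟨2 ^ w, 0, 2 ^ w, 0, if 0 < s.R i then l else s.pc + 1⟩
  | .goto l => ⟨2 ^ w, 0, 2 ^ w, 0, l⟩
  | .halt => ⟨2 ^ w, 0, 2 ^ w, 0, s.pc⟩
  | .accept => ⟨2 ^ w, 0, 2 ^ w, 0, s.pc⟩
  | .reject => ⟨2 ^ w, 0, 2 ^ w, 0, s.pc⟩

/-- The stopping instructions. -/
def Instr.IsStop (ins : Instr) : Prop := ins = .halt ∨ ins = .accept ∨ ins = .reject

/-- On the registers with addresses below `2 ^ w`, the configuration `s'` results from `s` by the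
effect `e`. -/
structure Effect.Leads (w : ℕ) (e : Effect) (s s' : Config) : Prop where
  pc : s'.pc = e.pc
  W : ∀ a < 2 ^ w, s'.W a = if a = e.aw then e.vw else s.W a
  R : ∀ a < 2 ^ w, s'.R a = if a = e.ar then e.vr else s.R a

theorem Config.leads_setW (w : ℕ) (s : Config) (i x : ℕ) :
    (Effect.mk i x (2 ^ w) 0 (s.pc + 1)).Leads w s (s.setW i x) where
  pc := rfl
  W a _ := by simp [Config.setW, Function.update_apply]
  R a ha := by simp [Config.setW, ha.ne]

theorem Config.leads_setR (w : ℕ) (s : Config) (i : ℕ) (x : ℝ) :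
    (Effect.mk (2 ^ w) 0 i x (s.pc + 1)).Leads w s (s.setR i x) where
  pc := rfl
  W a ha := by simp [Config.setR, ha.ne]
  R a _ := by simp [Config.setR, Function.update_apply]

theorem Config.leads_jump (w : ℕ) (s : Config) (l : ℕ) :
    (Effect.mk (2 ^ w) 0 (2 ^ w) 0 l).Leads w s (s.jump l) where
  pc := rfl
  W a ha := by simp [Config.jump, ha.ne]
  R a ha := by simp [Config.jump, ha.ne]

theorem Config.leads_jumpIf (w : ℕ) (s : Config) (p : Prop) [Decidable p] (l : ℕ) :
    (Effect.mk (2 ^ w) 0 (2 ^ w) 0 (if p then l else s.pc + 1)).Leads w s (s.jumpIf p l) := by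
  unfold Config.jumpIf
  split <;> exact s.leads_jump w _

theorem Instr.leads_effect {w : ℕ} {s s' : Config} {ins : Instr} (h : ins.exec w s = some s') :
    (ins.effect w s).Leads w s s' := by
  cases ins with
  | wArith o i j k =>
    simp only [exec, Option.map_eq_some_iff] at h
    obtain ⟨x, hx, rfl⟩ := h
    simpa [effect, hx] using s.leads_setW w i x
  | rArith o i j k =>
    simp only [exec, Option.map_eq_some_iff] at h
    obtain ⟨x, hx, rfl⟩ := h
    simpa [effect, hx] using s.leads_setR w i x
  | rSqrt i j =>
    simp only [exec] at h
    split at h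
    · obtain rfl := Option.some.inj h
      exact s.leads_setR w _ _
    · cases h
  | halt => cases h
  | accept => cases h
  | reject => cases h
  | wConst | wCopy | wStore | wLoad => obtain rfl := Option.some.inj h; exact s.leads_setW w _ _
  | wIfEq | wIfLt | rIfZero | rIfPos => obtain rfl := Option.some.inj h; exact s.leads_jumpIf w _ _
  | goto => obtain rfl := Option.some.inj h; exact s.leads_jump w _
  | _ => obtain rfl := Option.some.inj h; exact s.leads_setR w _ _

theorem WordOp.eval_lt {w : ℕ} {o : WordOp} {y z x : ℕ} (hy : y < 2 ^ w) (hz : z < 2 ^ w)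
    (h : o.eval w y z = some x) : x < 2 ^ w := by
  have hpos : 0 < 2 ^ w := by positivity
  cases o with
  | add => obtain rfl := Option.some.inj h; exact Nat.mod_lt _ hpos
  | sub => obtain rfl := Option.some.inj h; exact Nat.mod_lt _ hpos
  | mulLow => obtain rfl := Option.some.inj h; exact Nat.mod_lt _ hpos
  | mulHigh =>
    obtain rfl := Option.some.inj h
    exact Nat.div_lt_of_lt_mul (Nat.mul_lt_mul'' hy hz)
  | div =>
    simp only [eval] at h
    split at h
    · cases h
    · obtain rfl := Option.some.inj h
      exact (Nat.div_le_self _ _).trans_lt hy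
  | mod =>
    simp only [eval] at h
    split at h
    · cases h
    · obtain rfl := Option.some.inj h
      exact (Nat.mod_le _ _).trans_lt hy
  | nand => obtain rfl := Option.some.inj h; omega

/-- The word registers always hold words. -/
theorem step_words {P : Program} {w : ℕ} {s s' : Config} (h : step P w s = some s')
    (hs : ∀ a, s.W a < 2 ^ w) (a : ℕ) : s'.W a < 2 ^ w := by
  have upd : ∀ i x, x < 2 ^ w → (s.setW i x).W a < 2 ^ w := by
    intro i x hx
    simp only [Config.setW, Function.update_apply]
    split
    · exact hx
    · exact hs a
  have jmp : ∀ (p : Prop) [Decidable p] l, (s.jumpIf p l).W a < 2 ^ w := by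
    intro p _ l
    unfold Config.jumpIf
    split <;> exact hs a
  unfold step at h
  split at h
  · cases h
  · rename_i ins _
    split at h
    · rename_i hw
      cases ins with
      | wArith o i j k =>
        simp only [Instr.exec, Option.map_eq_some_iff] at h
        obtain ⟨x, hx, rfl⟩ := h
        exact upd _ _ (WordOp.eval_lt (hs _) (hs _) hx)
      | rArith o i j k =>
        simp only [Instr.exec, Option.map_eq_some_iff] at h
        obtain ⟨x, hx, rfl⟩ := h
        exact hs a
      | rSqrt i j =>
        simp only [Instr.exec] at h
        split at h
        · obtain rfl := Option.some.inj h
          exact hs a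
        · cases h
      | halt => cases h
      | accept => cases h
      | reject => cases h
      | wConst i j =>
        obtain rfl := Option.some.inj h
        exact upd _ _ (hw j (by simp [Instr.words]))
      | wCopy | wStore | wLoad => obtain rfl := Option.some.inj h; exact upd _ _ (hs _)
      | wIfEq | wIfLt | rIfZero | rIfPos => obtain rfl := Option.some.inj h; exact jmp _ _
      | _ => obtain rfl := Option.some.inj h; exact hs a
    · cases h

/-! ### The tableau of a computation as a formula scheme -/

/-- Truth of an instance of a formula scheme. -/
def FormulaScheme.Sat (inp : ℕ → ℕ) (v : ℕ → ℝ) (F : FormulaScheme) (d : ℕ) (V : ℕ → ℕ) : Prop :=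
  (F.toFormula inp d V).Holds v

/-- Value of an instance of a term scheme. -/
noncomputable def TermScheme.val (inp : ℕ → ℕ) (v : ℕ → ℝ) (T : TermScheme) (V : ℕ → ℕ) : ℝ :=
  (T.toTerm inp V).eval v

section Sat

variable {inp : ℕ → ℕ} {v : ℕ → ℝ} {V : ℕ → ℕ} {d : ℕ}

theorem TermScheme.val_num (e : WExpr) : (num e).val inp v V = e.eval V :=
  Term.eval_numeral v _

theorem TermScheme.val_add (s t : TermScheme) :
    (add s t).val inp v V = s.val inp v V + t.val inp v V := rfl

theorem TermScheme.val_mul (s t : TermScheme) :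
    (mul s t).val inp v V = s.val inp v V * t.val inp v V := rfl

theorem TermScheme.val_inp (hinp : ∀ j, inp j = 0 ∨ inp j = 1) (e : WExpr) :
    (TermScheme.inp e).val inp v V = inp (e.eval V) := by
  unfold val toTerm
  rcases hinp (e.eval V) with h | h <;> simp [h, Term.eval]

namespace FormulaScheme

theorem sat_eq (s t : TermScheme) :
    (eq s t).Sat inp v d V ↔ s.val inp v V = t.val inp v V := Iff.rfl

theorem sat_lt (s t : TermScheme) :
    (lt s t).Sat inp v d V ↔ s.val inp v V < t.val inp v V := Iff.rfl

theorem sat_and (F G : FormulaScheme) :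
    (and F G).Sat inp v d V ↔ F.Sat inp v d V ∧ G.Sat inp v d V := Iff.rfl

theorem sat_or (F G : FormulaScheme) :
    (or F G).Sat inp v d V ↔ F.Sat inp v d V ∨ G.Sat inp v d V := Iff.rfl

theorem sat_not (F : FormulaScheme) : (not F).Sat inp v d V ↔ ¬ F.Sat inp v d V := Iff.rfl

theorem sat_all (e : WExpr) (F : FormulaScheme) :
    (all e F).Sat inp v d V ↔ ∀ i < e.eval V, F.Sat inp v (d + 1) (Function.update V d i) := by
  simp [Sat, toFormula, Formula.holds_bigAnd]

theorem sat_ex (e : WExpr) (F : FormulaScheme) :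
    (ex e F).Sat inp v d V ↔ ∃ i < e.eval V, F.Sat inp v (d + 1) (Function.update V d i) := by
  simp [Sat, toFormula, Formula.holds_bigOr]

theorem sat_cond (e f : WExpr) (F G : FormulaScheme) :
    (cond e f F G).Sat inp v d V ↔
      if e.eval V < f.eval V then F.Sat inp v d V else G.Sat inp v d V := by
  unfold Sat
  rw [toFormula]
  split <;> rfl

end FormulaScheme

end Sat

/-- Index of the real variable of family `f` for time `t` and address `a`, where `M` is the number
of addresses. The families are: `0` word registers, `1` real registers, `2` program counter, `3` and
`4` address and value of a word write operation, `5` and `6` the same for real write operations. -/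
def cellIndex (M f t a : ℕ) : ℕ := (t * M + a) * 7 + f

/-- The variable with this index. In the schemes, word variable `3` is the number of addresses minus
one. -/
def cell (f : ℕ) (t a : WExpr) : TermScheme :=
  .var (.op .add (.op .mul (.op .add (.op .mul t (.op .add (.var 3) (.const 1))) a) (.const 7))
    (.const f))

/-- The number of addresses. -/
def numCells : WExpr := .op .add (.var 3) (.const 1)

/-- Variable of family `f` at the current time, which is word variable `4`. -/
def now (f : ℕ) (a : WExpr) : TermScheme := cell f (.var 4) a

/-- Variable of family `f` at the next time. -/
def later (f : ℕ) (a : WExpr) : TermScheme := cell f (.op .add (.var 4) (.const 1)) a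

/-- The word write operation of the current step is `W[a] ← x`. -/
def writesW (a x : TermScheme) : FormulaScheme :=
  .and (.eq (now 3 (.const 0)) a) (.eq (now 4 (.const 0)) x)

/-- The real write operation of the current step is `R[a] ← x`. -/
def writesR (a x : TermScheme) : FormulaScheme :=
  .and (.eq (now 5 (.const 0)) a) (.eq (now 6 (.const 0)) x)

/-- No word register is written: the address is the number of addresses. -/
def noW : FormulaScheme := writesW (.num numCells) (.num (.const 0))

/-- No real register is written. -/
def noR : FormulaScheme := writesR (.num numCells) (.num (.const 0))

/-- The next program counter is `l`. -/
def goesTo (l : ℕ) : FormulaScheme := .eq (later 2 (.const 0)) (.num (.const l))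

/-- Graph of a word operation, parametrized by two words (word variables `5` and `6`): the two
operands, and two numbers whose difference is the result. Every pair of operands for which the
operation is defined occurs for some values of the parameters: subtraction is parametrized by its
result, and the divisor by its predecessor. -/
def opEntry : WordOp → WExpr × WExpr × WExpr × WExpr
  | .add => (.var 5, .var 6, .const 0, .op .modS (.op .add (.var 5) (.var 6)) (.var 3))
  | .sub => (.op .modS (.op .add (.var 5) (.var 6)) (.var 3), .var 6, .const 0, .var 5)
  | .mulLow => (.var 5, .var 6, .const 0, .op .modS (.op .mul (.var 5) (.var 6)) (.var 3))
  | .mulHigh => (.var 5, .var 6, .const 0, .op .divS (.op .mul (.var 5) (.var 6)) (.var 3))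
  | .div => (.var 5, .op .add (.var 6) (.const 1), .const 0, .op .divS (.var 5) (.var 6))
  | .mod => (.var 5, .op .add (.var 6) (.const 1), .const 0, .op .modS (.var 5) (.var 6))
  | .nand => (.var 5, .var 6, .op .add (.op .land (.var 5) (.var 6)) (.const 1),
      .op .add (.var 3) (.const 1))

/-- The real variable `z` is the result of a real operation. -/
def realOpScheme (z x y : TermScheme) : RealOp → FormulaScheme
  | .add => .eq z (.add x y)
  | .sub => .eq (.add z y) x
  | .mul => .eq z (.mul x y)
  | .div => .eq (.mul z y) x

/-- The next program counter is `l` if `F` holds and `l'` otherwise. -/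
def branchScheme (F : FormulaScheme) (l l' : ℕ) : FormulaScheme :=
  .and (.or (.not F) (goesTo l)) (.or F (goesTo l'))

/-- The variables for the write operations and for the next program counter describe the effect of
the instruction with index `l`. -/
def effectScheme (l : ℕ) : Instr → FormulaScheme
  | .wConst i j => .and (writesW (.num (.const i)) (.num (.const j))) (.and noR (goesTo (l + 1)))
  | .wCopy i j => .and (writesW (.num (.const i)) (now 0 (.const j))) (.and noR (goesTo (l + 1)))
  | .wStore i j => .and (writesW (now 0 (.const i)) (now 0 (.const j))) (.and noR (goesTo (l + 1)))
  | .wLoad i j => .and (.and (.eq (now 3 (.const 0)) (.num (.const i)))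
      (.all numCells (.or (.not (.eq (now 0 (.const j)) (.num (.var 5))))
        (.eq (now 4 (.const 0)) (now 0 (.var 5)))))) (.and noR (goesTo (l + 1)))
  | .wArith o i j k => .and (.and (.eq (now 3 (.const 0)) (.num (.const i)))
      (.all numCells (.all numCells (.or (.not (.and
          (.eq (now 0 (.const j)) (.num (opEntry o).1))
          (.eq (now 0 (.const k)) (.num (opEntry o).2.1))))
        (.eq (.add (now 4 (.const 0)) (.num (opEntry o).2.2.1)) (.num (opEntry o).2.2.2))))))
      (.and noR (goesTo (l + 1)))
  | .wIfEq i j l' => .and noW (.and noR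
      (branchScheme (.eq (now 0 (.const i)) (now 0 (.const j))) l' (l + 1)))
  | .wIfLt i j l' => .and noW (.and noR
      (branchScheme (.lt (now 0 (.const i)) (now 0 (.const j))) l' (l + 1)))
  | .rZero i => .and noW (.and (writesR (.num (.const i)) (.num (.const 0))) (goesTo (l + 1)))
  | .rOne i => .and noW (.and (writesR (.num (.const i)) (.num (.const 1))) (goesTo (l + 1)))
  | .rCopy i j => .and noW (.and (writesR (.num (.const i)) (now 1 (.const j))) (goesTo (l + 1)))
  | .rStore i j => .and noW (.and (writesR (now 0 (.const i)) (now 1 (.const j))) (goesTo (l + 1)))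
  | .rLoad i j => .and noW (.and (.and (.eq (now 5 (.const 0)) (.num (.const i)))
      (.all numCells (.or (.not (.eq (now 0 (.const j)) (.num (.var 5))))
        (.eq (now 6 (.const 0)) (now 1 (.var 5)))))) (goesTo (l + 1)))
  | .rCastConst i j =>
      .and noW (.and (writesR (.num (.const i)) (.num (.const j))) (goesTo (l + 1)))
  | .rCastWord i j =>
      .and noW (.and (writesR (.num (.const i)) (now 0 (.const j))) (goesTo (l + 1)))
  | .rArith o i j k => .and noW (.and (.and (.eq (now 5 (.const 0)) (.num (.const i)))
      (realOpScheme (now 6 (.const 0)) (now 1 (.const j)) (now 1 (.const k)) o)) (goesTo (l + 1)))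
  | .rSqrt i j => .and noW (.and (.and (.eq (now 5 (.const 0)) (.num (.const i)))
      (.and (.not (.lt (now 6 (.const 0)) (.num (.const 0))))
        (.eq (.mul (now 6 (.const 0)) (now 6 (.const 0))) (now 1 (.const j))))) (goesTo (l + 1)))
  | .rIfZero i l' => .and noW (.and noR
      (branchScheme (.eq (now 1 (.const i)) (.num (.const 0))) l' (l + 1)))
  | .rIfPos i l' => .and noW (.and noR
      (branchScheme (.lt (.num (.const 0)) (now 1 (.const i))) l' (l + 1)))
  | .goto l' => .and noW (.and noR (goesTo l'))
  | .halt => .and noW (.and noR (goesTo l))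
  | .accept => .and noW (.and noR (goesTo l))
  | .reject => .and noW (.and noR (goesTo l))

/-- The real variables for time `t` describe the registers with addresses below `M` and the program
counter of `s`. -/
structure Describes (M : ℕ) (v : ℕ → ℝ) (t : ℕ) (s : Config) : Prop where
  W : ∀ a < M, v (cellIndex M 0 t a) = s.W a
  R : ∀ a < M, v (cellIndex M 1 t a) = s.R a
  pc : v (cellIndex M 2 t 0) = s.pc

/-- The auxiliary variables for time `t` describe the effect `e`. -/
def Effect.Described (M : ℕ) (v : ℕ → ℝ) (t : ℕ) (e : Effect) : Prop :=
  (v (cellIndex M 3 t 0) = e.aw ∧ v (cellIndex M 4 t 0) = e.vw) ∧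
  (v (cellIndex M 5 t 0) = e.ar ∧ v (cellIndex M 6 t 0) = e.vr) ∧
  v (cellIndex M 2 (t + 1) 0) = e.pc

theorem opEntry_iff {w y z x : ℕ} {o : WordOp} (hy : y < 2 ^ w) (hz : z < 2 ^ w)
    (h : o.eval w y z = some x) {V : ℕ → ℕ} (hV : V 3 + 1 = 2 ^ w) (r : ℝ) :
    (∀ a < 2 ^ w, ∀ b < 2 ^ w,
      y = (opEntry o).1.eval (Function.update (Function.update V 5 a) 6 b) →
      z = (opEntry o).2.1.eval (Function.update (Function.update V 5 a) 6 b) →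
      r + ((opEntry o).2.2.1.eval (Function.update (Function.update V 5 a) 6 b) : ℕ) =
        ((opEntry o).2.2.2.eval (Function.update (Function.update V 5 a) 6 b) : ℕ)) ↔ r = x := by
  have key : ∀ f g : ℕ → ℕ → ℕ, ∀ p q : ℕ → ℕ → ℕ,
      (∃ a < 2 ^ w, ∃ b < 2 ^ w, y = f a b ∧ z = g a b) →
      (∀ a < 2 ^ w, ∀ b < 2 ^ w, y = f a b → z = g a b → x + p a b = q a b) →
      ((∀ a < 2 ^ w, ∀ b < 2 ^ w, y = f a b → z = g a b → r + (p a b : ℝ) = (q a b : ℝ)) ↔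
        r = x) := by
    intro f g p q ⟨a, ha, b, hb, h₁, h₂⟩ h'
    constructor
    · intro H
      have e₁ := H a ha b hb h₁ h₂
      have e₂ : ((x : ℝ)) + (p a b : ℝ) = (q a b : ℝ) := by exact_mod_cast h' a ha b hb h₁ h₂
      linarith
    · rintro rfl a ha b hb h₁ h₂
      exact_mod_cast h' a ha b hb h₁ h₂
  have hpos : 0 < 2 ^ w := by positivity
  refine key (fun a b => (opEntry o).1.eval (Function.update (Function.update V 5 a) 6 b))
    (fun a b => (opEntry o).2.1.eval (Function.update (Function.update V 5 a) 6 b))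
    (fun a b => (opEntry o).2.2.1.eval (Function.update (Function.update V 5 a) 6 b))
    (fun a b => (opEntry o).2.2.2.eval (Function.update (Function.update V 5 a) 6 b)) ?_ ?_
  · cases o with
    | sub =>
      refine ⟨(y + 2 ^ w - z) % 2 ^ w, Nat.mod_lt _ hpos, z, hz, ?_, ?_⟩ <;>
        simp [opEntry, WExpr.eval, BinOp.eval, hV]
      rw [show y + 2 ^ w - z + z = y + 2 ^ w by omega, Nat.add_mod_right, Nat.mod_eq_of_lt hy]
    | div =>
      have : z ≠ 0 := by rintro rfl; simp [WordOp.eval] at h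
      refine ⟨y, hy, z - 1, by omega, ?_, ?_⟩ <;> simp [opEntry, WExpr.eval, BinOp.eval]
      omega
    | mod =>
      have : z ≠ 0 := by rintro rfl; simp [WordOp.eval] at h
      refine ⟨y, hy, z - 1, by omega, ?_, ?_⟩ <;> simp [opEntry, WExpr.eval, BinOp.eval]
      omega
    | _ => exact ⟨y, hy, z, hz, by simp [opEntry, WExpr.eval], by simp [opEntry, WExpr.eval]⟩
  · intro a ha b hb h₁ h₂
    cases o with
    | sub =>
      simp [opEntry, WExpr.eval, BinOp.eval, hV, WordOp.eval] at *
      subst h₂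
      rw [← h, h₁]
      rcases lt_or_ge (a + z) (2 ^ w) with h₃ | h₃
      · rw [Nat.mod_eq_of_lt h₃, show a + z + 2 ^ w - z = a + 2 ^ w by omega, Nat.add_mod_right,
          Nat.mod_eq_of_lt ha]
      · have h₄ : (a + z) % 2 ^ w = a + z - 2 ^ w := by
          rw [Nat.mod_eq_sub_mod h₃, Nat.mod_eq_of_lt (by omega)]
        rw [h₄, show a + z - 2 ^ w + 2 ^ w - z = a by omega, Nat.mod_eq_of_lt ha]
    | nand =>
      simp [opEntry, WExpr.eval, BinOp.eval, hV, WordOp.eval] at *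
      subst h₁ h₂
      have : y &&& z ≤ y := Nat.and_le_left
      omega
    | div =>
      simp [opEntry, WExpr.eval, BinOp.eval, WordOp.eval] at *
      subst h₁ h₂
      exact (show _ = x by simpa using h).symm
    | mod =>
      simp [opEntry, WExpr.eval, BinOp.eval, WordOp.eval] at *
      subst h₁ h₂
      exact (show _ = x by simpa using h).symm
    | _ =>
      simp [opEntry, WExpr.eval, BinOp.eval, hV, WordOp.eval] at *
      subst h₁ h₂
      exact h.symm

theorem realOp_iff {o : RealOp} {y z x r : ℝ} (h : o.eval y z = some x) :
    (match o with
      | .add => r = y + z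
      | .sub => r + z = y
      | .mul => r = y * z
      | .div => r * z = y) ↔ r = x := by
  cases o with
  | add => obtain rfl := Option.some.inj h; rfl
  | sub => obtain rfl := Option.some.inj h; exact eq_sub_iff_add_eq.symm
  | mul => obtain rfl := Option.some.inj h; rfl
  | div =>
    simp only [RealOp.eval] at h
    split at h
    · cases h
    · rename_i hz
      obtain rfl := Option.some.inj h
      exact (eq_div_iff hz).symm

section Step

variable {w : ℕ} {inp : ℕ → ℕ} {v : ℕ → ℝ} {V : ℕ → ℕ} {d : ℕ}

theorem val_now (f : ℕ) (a : WExpr) :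
    (now f a).val inp v V = v (cellIndex (V 3 + 1) f (V 4) (a.eval V)) := rfl

theorem val_later (f : ℕ) (a : WExpr) :
    (later f a).val inp v V = v (cellIndex (V 3 + 1) f (V 4 + 1) (a.eval V)) := rfl

theorem eval_numCells : numCells.eval V = V 3 + 1 := rfl

open FormulaScheme in
theorem sat_effectScheme {s : Config} {l : ℕ} {ins : Instr} (hV : V 3 + 1 = 2 ^ w)
    (hl : s.pc = l) (hd : Describes (2 ^ w) v (V 4) s) (hW : ∀ a, s.W a < 2 ^ w)
    (hc : ∀ a ∈ ins.words, a < 2 ^ w) (hok : ins.IsStop ∨ ∃ s', ins.exec w s = some s') :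
    (effectScheme l ins).Sat inp v 5 V ↔ (ins.effect w s).Described (2 ^ w) v (V 4) := by
  have hb : ∀ (F : FormulaScheme) (p : Prop) [Decidable p] (l l' : ℕ), (F.Sat inp v 5 V ↔ p) →
      ((branchScheme F l l').Sat inp v 5 V ↔
        v (cellIndex (2 ^ w) 2 (V 4 + 1) 0) = ((if p then l else l' : ℕ) : ℝ)) := by
    intro F p _ l l' hF
    simp only [branchScheme, sat_and, sat_or, sat_not, hF, goesTo, sat_eq, val_later,
      TermScheme.val_num, WExpr.eval, hV]
    by_cases hp : p <;> simp [hp]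
  have h0 : ∀ a < 2 ^ w, v (cellIndex (2 ^ w) 0 (V 4) a) = s.W a := hd.W
  have h1 : ∀ a < 2 ^ w, v (cellIndex (2 ^ w) 1 (V 4) a) = s.R a := hd.R
  have hp : ((2 ^ w : ℕ) : ℝ) = 2 ^ w := by push_cast; rfl
  cases ins with
  | wLoad i j =>
    simp only [Instr.words, List.forall_mem_cons] at hc
    have : (∀ b < 2 ^ w, ¬ s.W j = b ∨ v (cellIndex (2 ^ w) 4 (V 4) 0) =
        v (cellIndex (2 ^ w) 0 (V 4) b)) ↔
        v (cellIndex (2 ^ w) 4 (V 4) 0) = s.W (s.W j) := by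
      rw [← h0 _ (hW j)]
      constructor
      · intro h; exact (h _ (hW j)).resolve_left fun h => h rfl
      · intro h b _
        by_cases hb : s.W j = b
        · subst hb; exact Or.inr h
        · exact Or.inl hb
    simp [effectScheme, noR, writesR, goesTo, sat_and, sat_eq, sat_all, sat_or, sat_not, val_now,
      val_later, TermScheme.val_num, WExpr.eval, eval_numCells, hV, h0 _ hc.2.1, this,
      Effect.Described, Instr.effect, hl]
  | rLoad i j =>
    simp only [Instr.words, List.forall_mem_cons] at hc
    have : (∀ b < 2 ^ w, ¬ s.W j = b ∨ v (cellIndex (2 ^ w) 6 (V 4) 0) =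
        v (cellIndex (2 ^ w) 1 (V 4) b)) ↔
        v (cellIndex (2 ^ w) 6 (V 4) 0) = s.R (s.W j) := by
      rw [← h1 _ (hW j)]
      constructor
      · intro h; exact (h _ (hW j)).resolve_left fun h => h rfl
      · intro h b _
        by_cases hb : s.W j = b
        · subst hb; exact Or.inr h
        · exact Or.inl hb
    simp [effectScheme, noW, writesW, goesTo, sat_and, sat_eq, sat_all, sat_or, sat_not, val_now,
      val_later, TermScheme.val_num, WExpr.eval, eval_numCells, hV, h0 _ hc.2.1, this,
      Effect.Described, Instr.effect, hl]
  | wArith o i j k =>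
    simp only [Instr.words, List.forall_mem_cons] at hc
    obtain ⟨s', hs'⟩ := hok.resolve_left (by simp [Instr.IsStop])
    simp only [Instr.exec, Option.map_eq_some_iff] at hs'
    obtain ⟨x, hx, -⟩ := hs'
    have := opEntry_iff (hW j) (hW k) hx hV (v (cellIndex (2 ^ w) 4 (V 4) 0))
    simp [effectScheme, noR, writesR, goesTo, sat_and, sat_eq, sat_all, sat_or, sat_not, val_now,
      val_later, TermScheme.val_num, TermScheme.val_add, WExpr.eval, eval_numCells, hV,
      h0 _ hc.2.1, h0 _ hc.2.2.1, Effect.Described, Instr.effect, hl, hx, ← this, imp_iff_not_or,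
      or_assoc]
  | rArith o i j k =>
    simp only [Instr.words, List.forall_mem_cons] at hc
    obtain ⟨s', hs'⟩ := hok.resolve_left (by simp [Instr.IsStop])
    simp only [Instr.exec, Option.map_eq_some_iff] at hs'
    obtain ⟨x, hx, -⟩ := hs'
    have := realOp_iff (r := v (cellIndex (2 ^ w) 6 (V 4) 0)) hx
    have hO : (realOpScheme (now 6 (.const 0)) (now 1 (.const j)) (now 1 (.const k)) o).Sat
        inp v 5 V ↔ v (cellIndex (2 ^ w) 6 (V 4) 0) = x := by
      rw [← this]
      cases o <;> simp [realOpScheme, sat_eq, val_now, TermScheme.val_add, TermScheme.val_mul, hV,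
        WExpr.eval, h1 _ hc.2.1, h1 _ hc.2.2.1]
    simp [effectScheme, noW, writesW, goesTo, sat_and, sat_eq, val_now, hO,
      val_later, TermScheme.val_num, WExpr.eval, eval_numCells, hV, Effect.Described,
      Instr.effect, hl, hx]
  | rSqrt i j =>
    simp only [Instr.words, List.forall_mem_cons] at hc
    obtain ⟨s', hs'⟩ := hok.resolve_left (by simp [Instr.IsStop])
    have hj : 0 ≤ s.R j := by
      by_contra h
      simp [Instr.exec, h] at hs'
    have : (0 ≤ v (cellIndex (2 ^ w) 6 (V 4) 0) ∧ v (cellIndex (2 ^ w) 6 (V 4) 0) *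
        v (cellIndex (2 ^ w) 6 (V 4) 0) = s.R j) ↔ v (cellIndex (2 ^ w) 6 (V 4) 0) = √(s.R j) := by
      constructor
      · rintro ⟨h₁, h₂⟩
        rw [← h₂, Real.sqrt_mul_self h₁]
      · intro h
        rw [h]
        exact ⟨Real.sqrt_nonneg _, Real.mul_self_sqrt hj⟩
    simp [effectScheme, noW, writesW, goesTo, sat_and, sat_eq, sat_not, sat_lt, val_now,
      val_later, TermScheme.val_num, TermScheme.val_mul, WExpr.eval, eval_numCells, hV,
      h1 _ hc.2.1, Effect.Described, Instr.effect, hl, ← this]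
  | wIfEq i j l' =>
    simp only [Instr.words, List.forall_mem_cons] at hc
    have := hb (.eq (now 0 (.const i)) (now 0 (.const j))) (s.W i = s.W j) l' (l + 1) (by
      simp [sat_eq, val_now, WExpr.eval, hV, h0 _ hc.1, h0 _ hc.2.1])
    simp [effectScheme, noW, noR, writesW, writesR, sat_and, this, sat_eq, val_now,
      TermScheme.val_num, WExpr.eval, eval_numCells, hV, Effect.Described, Instr.effect, hl]
  | wIfLt i j l' =>
    simp only [Instr.words, List.forall_mem_cons] at hc
    have := hb (.lt (now 0 (.const i)) (now 0 (.const j))) (s.W i < s.W j) l' (l + 1) (by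
      simp [sat_lt, val_now, WExpr.eval, hV, h0 _ hc.1, h0 _ hc.2.1])
    simp [effectScheme, noW, noR, writesW, writesR, sat_and, this, sat_eq, val_now,
      TermScheme.val_num, WExpr.eval, eval_numCells, hV, Effect.Described, Instr.effect, hl]
  | rIfZero i l' =>
    simp only [Instr.words, List.forall_mem_cons] at hc
    have := hb (.eq (now 1 (.const i)) (.num (.const 0))) (s.R i = 0) l' (l + 1) (by
      simp [sat_eq, val_now, WExpr.eval, TermScheme.val_num, hV, h1 _ hc.1])
    simp [effectScheme, noW, noR, writesW, writesR, sat_and, this, sat_eq, val_now,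
      TermScheme.val_num, WExpr.eval, eval_numCells, hV, Effect.Described, Instr.effect, hl]
  | rIfPos i l' =>
    simp only [Instr.words, List.forall_mem_cons] at hc
    have := hb (.lt (.num (.const 0)) (now 1 (.const i))) (0 < s.R i) l' (l + 1) (by
      simp [sat_lt, val_now, WExpr.eval, TermScheme.val_num, hV, h1 _ hc.1])
    simp [effectScheme, noW, noR, writesW, writesR, sat_and, this, sat_eq, val_now,
      TermScheme.val_num, WExpr.eval, eval_numCells, hV, Effect.Described, Instr.effect, hl]
  | wConst i j | wCopy i j | wStore i j | rCopy i j | rStore i j | rCastConst i j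
  | rCastWord i j =>
    simp only [Instr.words, List.forall_mem_cons] at hc
    simp [effectScheme, noW, noR, writesW, writesR, goesTo, sat_and, sat_eq, val_now, val_later,
      TermScheme.val_num, WExpr.eval, eval_numCells, hV, Effect.Described, Instr.effect, hl,
      h0 _ hc.1, h0 _ hc.2.1, h1 _ hc.2.1]
  | rZero | rOne | goto | halt | accept | reject =>
    simp [effectScheme, noW, noR, writesW, writesR, goesTo, sat_and, sat_eq, val_now, val_later,
      TermScheme.val_num, WExpr.eval, eval_numCells, hV, Effect.Described, Instr.effect, hl]

end Step

/-- The registers of family `f` change exactly at the address in family `fa`, where they take the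
value in family `fv`. -/
def frameScheme (f fa fv : ℕ) : FormulaScheme :=
  .all numCells (.or
    (.and (.eq (now fa (.const 0)) (.num (.var 5))) (.eq (later f (.var 5)) (now fv (.const 0))))
    (.and (.not (.eq (now fa (.const 0)) (.num (.var 5))))
      (.eq (later f (.var 5)) (now f (.var 5)))))

/-- If the program counter points to the instruction `ins` with index `l`, then the effect is that
of this instruction. -/
def instrScheme (l : ℕ) (ins : Instr) : FormulaScheme :=
  .or (.not (.eq (now 2 (.const 0)) (.num (.const l)))) (effectScheme l ins)

/-- Conjunction of `f l ins` over the instructions `ins` of a program and their indices `l`,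
counted from `k` on. -/
def conjInstr (f : ℕ → Instr → FormulaScheme) : ℕ → Program → FormulaScheme
  | _, [] => .eq (.num (.const 0)) (.num (.const 0))
  | k, ins :: P => .and (f k ins) (conjInstr f (k + 1) P)

/-- One time step of the program `P`. -/
def stepScheme (P : Program) : FormulaScheme :=
  .and (.and (frameScheme 0 3 4) (frameScheme 1 5 6)) (conjInstr instrScheme 0 P)

theorem sat_conjInstr {inp : ℕ → ℕ} {v : ℕ → ℝ} {V : ℕ → ℕ} {d : ℕ}
    (f : ℕ → Instr → FormulaScheme)
    (k : ℕ) (P : Program) :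
    (conjInstr f k P).Sat inp v d V ↔
      ∀ l ins, P[l]? = some ins → (f (k + l) ins).Sat inp v d V := by
  induction P generalizing k with
  | nil => simp [conjInstr, FormulaScheme.sat_eq]
  | cons ins P ih =>
    rw [conjInstr, FormulaScheme.sat_and, ih]
    constructor
    · rintro ⟨h₁, h₂⟩ l ins' h
      cases l with
      | zero => simp at h; subst h; exact h₁
      | succ l => simpa [add_assoc, add_comm 1 l] using h₂ l ins' (by simpa using h)
    · intro h
      refine ⟨h 0 ins (by simp), fun l ins' h' => ?_⟩
      simpa [add_assoc, add_comm 1 l] using h (l + 1) ins' (by simpa using h')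

open FormulaScheme in
theorem sat_frameScheme {w : ℕ} {inp : ℕ → ℕ} {v : ℕ → ℝ} {V : ℕ → ℕ} (hV : V 3 + 1 = 2 ^ w)
    (f fa fv : ℕ) {aw : ℕ} (h : v (cellIndex (2 ^ w) fa (V 4) 0) = aw) :
    (frameScheme f fa fv).Sat inp v 5 V ↔ ∀ a < 2 ^ w, v (cellIndex (2 ^ w) f (V 4 + 1) a) =
      if a = aw then v (cellIndex (2 ^ w) fv (V 4) 0) else v (cellIndex (2 ^ w) f (V 4) a) := by
  simp only [frameScheme, sat_all, sat_or, sat_and, sat_not, sat_eq, val_now, val_later,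
    TermScheme.val_num, WExpr.eval, eval_numCells, hV]
  refine forall_congr' fun a => imp_congr_right fun _ => ?_
  simp only [ne_eq, Nat.reduceEqDiff, not_false_eq_true, Function.update_of_ne,
    Function.update_self, hV, h, Nat.cast_inj]
  by_cases ha : a = aw
  · simp [ha]
  · simp [ha, Ne.symm ha]

/-- The scheme for one time step says that the variables for time `t` describe the effect of the
current instruction, and that those for time `t + 1` describe the next configuration. -/
theorem sat_stepScheme {P : Program} {w : ℕ} {inp : ℕ → ℕ} {v : ℕ → ℝ} {V : ℕ → ℕ} {s s' : Config}
    {ins : Instr} (hV : V 3 + 1 = 2 ^ w) (hd : Describes (2 ^ w) v (V 4) s)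
    (hW : ∀ a, s.W a < 2 ^ w) (hins : P[s.pc]? = some ins)
    (hc : ∀ a ∈ ins.words, a < 2 ^ w) (hok : ins.IsStop ∨ ∃ s', ins.exec w s = some s')
    (hL : (ins.effect w s).Leads w s s') :
    (stepScheme P).Sat inp v 5 V ↔
      (ins.effect w s).Described (2 ^ w) v (V 4) ∧ Describes (2 ^ w) v (V 4 + 1) s' := by
  have h₁ : (conjInstr instrScheme 0 P).Sat inp v 5 V ↔
      (ins.effect w s).Described (2 ^ w) v (V 4) := by
    rw [sat_conjInstr, ← sat_effectScheme (inp := inp) hV rfl hd hW hc hok]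
    simp only [instrScheme, FormulaScheme.sat_or, FormulaScheme.sat_not, FormulaScheme.sat_eq,
      val_now, hV, WExpr.eval, TermScheme.val_num, hd.pc, zero_add, Nat.cast_inj]
    constructor
    · intro h
      exact (h _ _ hins).resolve_left fun h => h rfl
    · intro h l ins' hl
      by_cases he : s.pc = l
      · subst he
        rw [hins] at hl
        obtain rfl := Option.some.inj hl
        exact Or.inr h
      · exact Or.inl he
  rw [stepScheme, FormulaScheme.sat_and, FormulaScheme.sat_and, h₁]
  have h₂ : ∀ h : (ins.effect w s).Described (2 ^ w) v (V 4),
      (((frameScheme 0 3 4).Sat inp v 5 V ∧ (frameScheme 1 5 6).Sat inp v 5 V) ↔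
        Describes (2 ^ w) v (V 4 + 1) s') := by
    rintro ⟨⟨d₁, d₂⟩, ⟨d₃, d₄⟩, d₅⟩
    rw [sat_frameScheme hV 0 3 4 d₁, sat_frameScheme hV 1 5 6 d₃, d₂, d₄]
    constructor
    · rintro ⟨f₁, f₂⟩
      refine ⟨fun a ha => ?_, fun a ha => ?_, by rw [d₅, hL.pc]⟩
      · rw [f₁ a ha, hL.W a ha, hd.W a ha]; split <;> rfl
      · rw [f₂ a ha, hL.R a ha, hd.R a ha]
    · rintro ⟨f₁, f₂, -⟩
      refine ⟨fun a ha => ?_, fun a ha => ?_⟩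
      · rw [f₁ a ha, hL.W a ha, hd.W a ha]; split <;> rfl
      · rw [f₂ a ha, hL.R a ha, hd.R a ha]
  constructor
  · rintro ⟨f, h⟩; exact ⟨h, (h₂ h).1 f⟩
  · rintro ⟨h, f⟩; exact ⟨(h₂ h).2 f, h⟩

/-! ### Traces of halting computations -/

/-- The configuration after `t` steps; the machine stays where it is after it has stopped. -/
noncomputable def trace (P : Program) (w : ℕ) (s : Config) : ℕ → Config
  | 0 => s
  | t + 1 => (step P w (trace P w s t)).getD (trace P w s t)

theorem run_succ' (P : Program) (w t : ℕ) (s : Config) :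
    run P w (t + 1) s = (run P w t s).bind (step P w) := by
  rw [run_add]
  congr 1
  funext s'
  simp [run]

theorem trace_of_run {P : Program} {w t : ℕ} {s s' : Config} (h : run P w t s = some s') :
    trace P w s t = s' := by
  induction t generalizing s' with
  | zero => exact Option.some.inj h
  | succ t ih =>
    rw [run_succ', Option.bind_eq_some_iff] at h
    obtain ⟨s₁, h₁, h₂⟩ := h
    rw [trace, ih h₁, h₂, Option.getD_some]

theorem Instr.IsStop.exec_eq {ins : Instr} (h : ins.IsStop) (w : ℕ) (s : Config) :
    ins.exec w s = none := by
  rcases h with rfl | rfl | rfl <;> rfl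

theorem Instr.IsStop.words_eq {ins : Instr} (h : ins.IsStop) : ins.words = [] := by
  rcases h with rfl | rfl | rfl <;> rfl

theorem Instr.IsStop.leads {ins : Instr} (h : ins.IsStop) (w : ℕ) (s : Config) :
    (ins.effect w s).Leads w s s := by
  rcases h with rfl | rfl | rfl <;> exact s.leads_jump w s.pc

theorem Instr.IsStop.step_eq {P : Program} {w : ℕ} {s : Config} {ins : Instr} (h : ins.IsStop)
    (hs : P[s.pc]? = some ins) : step P w s = none := by
  simp [step, hs, h.exec_eq]

theorem step_eq_some {P : Program} {w : ℕ} {s s' : Config} (h : step P w s = some s') :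
    ∃ ins, P[s.pc]? = some ins ∧ (∀ a ∈ ins.words, a < 2 ^ w) ∧ ins.exec w s = some s' := by
  unfold step at h
  split at h
  · cases h
  · rename_i ins hins
    split at h
    · rename_i hw
      exact ⟨ins, hins, hw, h⟩
    · cases h

section Trace

variable {P : Program} {w t₀ : ℕ} {x : List ℝ} {b : List ℕ} {s₀ : Config} {ins₀ : Instr}
  (h : StopsAt P w x b t₀ s₀ ins₀) (h₀ : ins₀.IsStop)
include h h₀

omit h₀ in
theorem trace_step_of_lt {t : ℕ} (ht : t < t₀) :
    step P w (trace P w (init x b) t) = some (trace P w (init x b) (t + 1)) := by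
  obtain ⟨k, rfl⟩ : ∃ k, t₀ = (t + 1) + k := ⟨t₀ - (t + 1), by omega⟩
  have h₁ := h.1
  rw [run_add, Option.bind_eq_some_iff] at h₁
  obtain ⟨s₁, h₂, -⟩ := h₁
  have h₃ := h₂
  rw [run_succ', Option.bind_eq_some_iff] at h₃
  obtain ⟨s₂, h₄, h₅⟩ := h₃
  rw [trace_of_run h₂, trace_of_run h₄, h₅]

theorem trace_of_le {t : ℕ} (ht : t₀ ≤ t) : trace P w (init x b) t = s₀ := by
  induction t, ht using Nat.le_induction with
  | base => exact trace_of_run h.1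
  | succ t _ ih => rw [trace, ih, h₀.step_eq h.2, Option.getD_none]

/-- A halting computation never gets stuck. -/
theorem exists_instr_trace (t : ℕ) :
    ∃ ins, P[(trace P w (init x b) t).pc]? = some ins ∧ (∀ a ∈ ins.words, a < 2 ^ w) ∧
      (ins.IsStop ∨ ∃ s', ins.exec w (trace P w (init x b) t) = some s') ∧
      (ins.effect w (trace P w (init x b) t)).Leads w (trace P w (init x b) t)
        (trace P w (init x b) (t + 1)) := by
  rcases lt_or_ge t t₀ with ht | ht
  · obtain ⟨ins, h₁, h₂, h₃⟩ := step_eq_some (trace_step_of_lt h ht)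
    exact ⟨ins, h₁, h₂, Or.inr ⟨_, h₃⟩, Instr.leads_effect h₃⟩
  · rw [trace_of_le h h₀ ht, trace_of_le h h₀ (by omega : t₀ ≤ t + 1)]
    exact ⟨ins₀, h.2, by simp [h₀.words_eq], Or.inl h₀, h₀.leads w s₀⟩

theorem StopsAt.unique {t₁ : ℕ} {s₁ : Config} {ins₁ : Instr} (h' : StopsAt P w x b t₁ s₁ ins₁)
    (h₁ : ins₁.IsStop) : s₀ = s₁ ∧ ins₀ = ins₁ := by
  have : s₀ = s₁ := (trace_of_le h h₀ (le_max_left t₀ t₁)).symm.trans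
    (trace_of_le h' h₁ (le_max_right t₀ t₁))
  subst this
  exact ⟨rfl, Option.some.inj (h.2.symm.trans h'.2)⟩

end Trace

theorem HaltsWithin.exists_stopsAt {P : Program} {w : ℕ} {x : List ℝ} {b : List ℕ} {T : ℕ}
    (h : HaltsWithin P w x b T) :
    ∃ t ≤ T, ∃ s ins, StopsAt P w x b t s ins ∧ ins.IsStop := by
  obtain ⟨t, ht, s, h | h | h⟩ := h
  · exact ⟨t, ht, s, _, h, Or.inl rfl⟩
  · exact ⟨t, ht, s, _, h, Or.inr (Or.inl rfl)⟩
  · exact ⟨t, ht, s, _, h, Or.inr (Or.inr rfl)⟩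

theorem not_accepts_and_rejects {P : Program} {w : ℕ} {x : List ℝ} {b : List ℕ}
    (h : Accepts P w x b) (h' : Rejects P w x b) : False := by
  obtain ⟨t, s, h⟩ := h
  obtain ⟨t', s', h'⟩ := h'
  exact Instr.noConfusion (StopsAt.unique h (Or.inr (Or.inl rfl)) h' (Or.inr (Or.inr rfl))).2

theorem trace_words {P : Program} {w : ℕ} {s : Config} (h : ∀ a, s.W a < 2 ^ w) (t a : ℕ) :
    (trace P w s t).W a < 2 ^ w := by
  induction t generalizing a with
  | zero => exact h a
  | succ t ih =>
    rw [trace]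
    cases hs : step P w (trace P w s t) with
    | none => exact ih a
    | some s' => exact step_words hs ih a

theorem init_words {w : ℕ} {x : List ℝ} {b : List ℕ} (h : ∀ u ∈ b, u < 2 ^ w) (a : ℕ) :
    (init x b).W a < 2 ^ w := by
  have : 0 < 2 ^ w := by positivity
  simp only [init]
  rcases lt_or_ge a b.length with ha | ha
  · rw [List.getD_eq_getElem _ _ ha]
    exact h _ (List.getElem_mem _)
  · rwa [List.getD_eq_default _ _ ha]

/-! ### Word sizes and codes of instances -/

theorem le_two_pow_wordSize (c N : ℕ) : N ^ c ≤ 2 ^ wordSize c N :=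
  Nat.le_pow_clog (by norm_num) _

theorem two_pow_wordSize_lt {c N : ℕ} (hN : 2 ≤ N) : 2 ^ wordSize c N < 2 * N ^ c := by
  have h1 : 1 ≤ N ^ c := Nat.one_le_pow _ _ (by omega)
  rcases h1.eq_or_lt with h | h
  · rw [wordSize, ← h]; simp
  · have h₂ := Nat.pow_pred_clog_lt_self (b := 2) (by norm_num) h
    have h₃ : 0 < wordSize c N := Nat.clog_pos (by norm_num) h
    obtain ⟨k, hk⟩ : ∃ k, wordSize c N = k + 1 := ⟨wordSize c N - 1, by omega⟩
    change 2 ^ (wordSize c N).pred < _ at h₂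
    rw [hk] at h₂ ⊢
    rw [pow_succ]
    simp only [Nat.pred_succ] at h₂
    omega

/-- A power of two between `N ^ c` and `2 * N ^ c` is unique. -/
theorem eq_two_pow_wordSize {c N k : ℕ} (h₁ : N ^ c ≤ 2 ^ k) (h₂ : 2 ^ k < 2 * N ^ c) :
    k = wordSize c N := by
  have h₃ : wordSize c N ≤ k := Nat.clog_le_of_le_pow h₁
  rcases h₃.eq_or_lt with h | h
  · exact h.symm
  · have h₄ := le_two_pow_wordSize c N
    have h₅ : 2 ^ (wordSize c N + 1) ≤ 2 ^ k := Nat.pow_le_pow_right (by norm_num) h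
    rw [pow_succ] at h₅
    omega

theorem encode_bits {I : List ℤ} : ∀ b ∈ encode I, b = 0 ∨ b = 1 := by
  intro b hb
  simp only [encode, List.mem_append, List.mem_flatMap, encodeInt, List.mem_cons,
    List.not_mem_nil, or_false] at hb
  rcases hb with ⟨z, -, ⟨β, -, h⟩ | h⟩ | h
  · rcases h with rfl | rfl
    · exact Or.inr rfl
    · cases β <;> simp
  · omega
  · omega

theorem two_le_length_encode (I : List ℤ) : 2 ≤ (encode I).length := by simp [encode]

theorem getD_bits {b : List ℕ} (h : ∀ u ∈ b, u = 0 ∨ u = 1) (j : ℕ) :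
    b.getD j 0 = 0 ∨ b.getD j 0 = 1 := by
  rcases lt_or_ge j b.length with hj | hj
  · rw [List.getD_eq_getElem _ _ hj]
    exact h _ (List.getElem_mem _)
  · rw [List.getD_eq_default _ _ hj]
    exact Or.inl rfl

theorem one_le_wordSize {c N : ℕ} (hc : 1 ≤ c) (hN : 2 ≤ N) : 1 ≤ wordSize c N :=
  Nat.clog_pos (by norm_num) (Nat.one_lt_pow (by omega) (by omega))

theorem two_le_two_pow_wordSize {c N : ℕ} (hc : 1 ≤ c) (hN : 2 ≤ N) : 2 ≤ 2 ^ wordSize c N :=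
  (Nat.pow_le_pow_right (by norm_num) (one_le_wordSize hc hN) : 2 ^ 1 ≤ _)

/-! ### The formula scheme of a verification algorithm -/

/-- The power `e ^ c`. -/
def powExpr (e : WExpr) : ℕ → WExpr
  | 0 => .const 1
  | c + 1 => .op .mul (powExpr e c) e

theorem eval_powExpr (e : WExpr) (c : ℕ) (V : ℕ → ℕ) :
    (powExpr e c).eval V = e.eval V ^ c := by
  induction c with
  | zero => rfl
  | succ c ih => simp [powExpr, WExpr.eval, BinOp.eval, ih, pow_succ]

/-- Total length of the input: word variable `0` is the size of the instance, `1` is the number of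
real certificates, and `2` is the number of word certificates. -/
def totalExpr : WExpr := .op .add (.var 1) (.op .add (.var 0) (.var 2))

/-- The variables for time `0` describe an initial configuration. -/
def initScheme : FormulaScheme :=
  .and (.eq (cell 2 (.const 0) (.const 0)) (.num (.const 0))) (.all numCells (.and
    (.cond (.var 4) (.var 0) (.eq (cell 0 (.const 0) (.var 4)) (.inp (.var 4)))
      (.cond (.var 4) (.op .add (.var 0) (.var 2))
        (.ex numCells (.eq (cell 0 (.const 0) (.var 4)) (.num (.var 5))))
        (.eq (cell 0 (.const 0) (.var 4)) (.num (.const 0)))))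
    (.cond (.var 4) (.var 1) (.eq (.num (.const 0)) (.num (.const 0)))
      (.eq (cell 1 (.const 0) (.var 4)) (.num (.const 0))))))

/-- At time `e`, the program counter does not point to `ins`, if this is an accepting instruction
with index `l`. -/
def notAcceptScheme (e : WExpr) (l : ℕ) : Instr → FormulaScheme
  | .accept => .not (.eq (cell 2 e (.const 0)) (.num (.const l)))
  | _ => .eq (.num (.const 0)) (.num (.const 0))

/-- The variables describe an accepting computation. -/
def tableauScheme (P : Program) (c : ℕ) : FormulaScheme :=
  .and initScheme (.and (.all (powExpr totalExpr c) (stepScheme P))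
    (.not (conjInstr (notAcceptScheme (powExpr totalExpr c)) 0 P)))

/-- A contradiction. -/
def falseScheme : FormulaScheme := .lt (.num (.const 0)) (.num (.const 0))

/-- The formula for the verification algorithm `P` with constant `c`, where word variable `0` is the
size of the instance: for some lengths of the certificates and for the right word size there is an
accepting computation. The number of addresses is guessed: it is the power of two `M` with
`N ^ c ≤ M < 2 * N ^ c`, where `N` is the total length of the input. Powers of two are recognized by
`M &&& (M - 1) = 0`. -/
def verifierScheme (P : Program) (c : ℕ) : FormulaScheme :=
  .ex (.op .add (powExpr (.var 0) c) (.const 1)) (.ex (.op .add (powExpr (.var 0) c) (.const 1))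
    (.ex (.op .mul (.const 2) (powExpr totalExpr c))
      (.cond (.op .land numCells (.var 3)) (.const 1)
        (.cond numCells (powExpr totalExpr c) falseScheme
          (.cond numCells (.op .mul (.const 2) (powExpr totalExpr c)) (tableauScheme P c)
            falseScheme)) falseScheme)))

section Tableau

variable {w : ℕ} {inp : ℕ → ℕ} {v : ℕ → ℝ} {V : ℕ → ℕ}

theorem val_cell (f : ℕ) (t a : WExpr) :
    (cell f t a).val inp v V = v (cellIndex (V 3 + 1) f (t.eval V) (a.eval V)) := rfl

open FormulaScheme in
theorem sat_initScheme (hinp : ∀ j, inp j = 0 ∨ inp j = 1) (hV : V 3 + 1 = 2 ^ w) :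
    initScheme.Sat inp v 4 V ↔ v (cellIndex (2 ^ w) 2 0 0) = 0 ∧ ∀ a < 2 ^ w,
      (if a < V 0 then v (cellIndex (2 ^ w) 0 0 a) = inp a else
        if a < V 0 + V 2 then ∃ b < 2 ^ w, v (cellIndex (2 ^ w) 0 0 a) = (b : ℕ) else
          v (cellIndex (2 ^ w) 0 0 a) = 0) ∧
      (if a < V 1 then True else v (cellIndex (2 ^ w) 1 0 a) = 0) := by
  simp [initScheme, sat_and, sat_all, sat_cond, sat_ex, sat_eq, val_cell, TermScheme.val_num,
    TermScheme.val_inp hinp, eval_numCells, WExpr.eval, BinOp.eval, hV]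

open FormulaScheme in
theorem sat_not_conj_notAccept {P : Program} {e : WExpr} {d l : ℕ} (hV : V 3 + 1 = 2 ^ w)
    (hl : v (cellIndex (2 ^ w) 2 (e.eval V) 0) = l) :
    (FormulaScheme.not (conjInstr (notAcceptScheme e) 0 P)).Sat inp v d V ↔
      P[l]? = some .accept := by
  have key : ∀ k ins, (notAcceptScheme e k ins).Sat inp v d V ↔ ¬ (ins = .accept ∧ l = k) := by
    intro k ins
    cases ins <;> simp [notAcceptScheme, sat_not, sat_eq, val_cell, TermScheme.val_num,
      WExpr.eval, hV, hl]
  rw [sat_not, sat_conjInstr]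
  simp only [key, zero_add]
  constructor
  · intro h
    push Not at h
    obtain ⟨k, ins, h₁, rfl, rfl⟩ := h
    exact h₁
  · intro h h'
    exact h' _ _ h ⟨rfl, rfl⟩

theorem cellIndex_decode {M f t a : ℕ} (hf : f < 7) (ha : a < M) :
    cellIndex M f t a % 7 = f ∧ cellIndex M f t a / 7 / M = t ∧ cellIndex M f t a / 7 % M = a := by
  have h₁ : cellIndex M f t a / 7 = t * M + a := by unfold cellIndex; omega
  refine ⟨by unfold cellIndex; omega, ?_, ?_⟩
  · rw [h₁, Nat.mul_comm, Nat.mul_add_div (by omega), Nat.div_eq_of_lt ha, add_zero]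
  · rw [h₁, Nat.mul_comm, Nat.mul_add_mod, Nat.mod_eq_of_lt ha]

/-- The assignment that describes a sequence of configurations and of effects. -/
noncomputable def traceAssignment (M : ℕ) (s : ℕ → Config) (e : ℕ → Effect) (i : ℕ) : ℝ :=
  if i % 7 = 0 then (s (i / 7 / M)).W (i / 7 % M)
  else if i % 7 = 1 then (s (i / 7 / M)).R (i / 7 % M)
  else if i % 7 = 2 then (s (i / 7 / M)).pc
  else if i % 7 = 3 then (e (i / 7 / M)).aw
  else if i % 7 = 4 then (e (i / 7 / M)).vw
  else if i % 7 = 5 then (e (i / 7 / M)).ar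
  else (e (i / 7 / M)).vr

theorem describes_traceAssignment {M : ℕ} (hM : 0 < M) (s : ℕ → Config) (e : ℕ → Effect) (t : ℕ) :
    Describes M (traceAssignment M s e) t (s t) where
  W a ha := by
    obtain ⟨h₁, h₂, h₃⟩ := cellIndex_decode (f := 0) (t := t) (by norm_num) ha
    simp [traceAssignment, h₁, h₂, h₃]
  R a ha := by
    obtain ⟨h₁, h₂, h₃⟩ := cellIndex_decode (f := 1) (t := t) (by norm_num) ha
    simp [traceAssignment, h₁, h₂, h₃]
  pc := by
    obtain ⟨h₁, h₂, h₃⟩ := cellIndex_decode (f := 2) (t := t) (by norm_num) hM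
    simp [traceAssignment, h₁, h₂]

theorem described_traceAssignment {M : ℕ} (hM : 0 < M) (s : ℕ → Config) (e : ℕ → Effect) (t : ℕ)
    (h : (s (t + 1)).pc = (e t).pc) : (e t).Described M (traceAssignment M s e) t := by
  have key : ∀ f < 7, cellIndex M f t 0 % 7 = f ∧ cellIndex M f t 0 / 7 / M = t := fun f hf =>
    ⟨(cellIndex_decode hf hM).1, (cellIndex_decode hf hM).2.1⟩
  refine ⟨⟨?_, ?_⟩, ⟨?_, ?_⟩, ?_⟩
  · simp [traceAssignment, key 3 (by norm_num)]
  · simp [traceAssignment, key 4 (by norm_num)]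
  · simp [traceAssignment, key 5 (by norm_num)]
  · simp [traceAssignment, key 6 (by norm_num)]
  · rw [(describes_traceAssignment hM s e (t + 1)).pc, h]

end Tableau

section Verifier

variable {Q : DecisionProblem} {P : Program} {c : ℕ} (h : IsRealVerifier Q P c) (hc : 1 ≤ c)
include h hc

/-- The verification algorithm halts in time on all inputs that start with an instance. -/
theorem IsRealVerifier.exists_stopsAt (I : List ℤ) (x : List ℝ) (z : List ℕ)
    (hz : ∀ u ∈ z, u < 2 ^ wordSize c (x.length + (encode I ++ z).length)) :
    (∀ u ∈ encode I ++ z, u < 2 ^ wordSize c (x.length + (encode I ++ z).length)) ∧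
    ∃ t ≤ (x.length + (encode I ++ z).length) ^ c, ∃ s ins,
      StopsAt P (wordSize c (x.length + (encode I ++ z).length)) x (encode I ++ z) t s ins ∧
        ins.IsStop := by
  have hN : 2 ≤ x.length + (encode I ++ z).length := by
    have := two_le_length_encode I
    rw [List.length_append]; omega
  have hw := two_le_two_pow_wordSize hc hN
  have hb : ∀ u ∈ encode I ++ z, u < 2 ^ wordSize c (x.length + (encode I ++ z).length) := by
    intro u hu
    rcases List.mem_append.1 hu with hu | hu
    · rcases encode_bits u hu with rfl | rfl <;> omega
    · exact hz u hu
  exact ⟨hb, (h.halts x _ hN hb).exists_stopsAt⟩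

/-- The tableau can be satisfied iff there is an accepting computation with certificates of the
given lengths. -/
theorem exists_sat_tableauScheme {I : List ℤ} {V : ℕ → ℕ} (hn : V 0 = (encode I).length)
    (hV : V 3 + 1 = 2 ^ wordSize c (V 1 + (V 0 + V 2))) :
    (∃ v, (tableauScheme P c).Sat (fun j => (encode I).getD j 0) v 4 V) ↔
      ∃ (x : List ℝ) (z : List ℕ), x.length = V 1 ∧ z.length = V 2 ∧
        (∀ u ∈ z, u < 2 ^ wordSize c (x.length + (encode I ++ z).length)) ∧
        Accepts P (wordSize c (x.length + (encode I ++ z).length)) x (encode I ++ z) := by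
  have hinp := getD_bits (encode_bits (I := I))
  obtain ⟨N, hN⟩ : ∃ N, N = V 1 + (V 0 + V 2) := ⟨_, rfl⟩
  have hT : ∀ V' : ℕ → ℕ, V' 0 = V 0 → V' 1 = V 1 → V' 2 = V 2 →
      (powExpr totalExpr c).eval V' = N ^ c := by
    intro V' h₀ h₁ h₂
    simp [eval_powExpr, totalExpr, WExpr.eval, BinOp.eval, h₀, h₁, h₂, hN]
  have hlen : ∀ (x : List ℝ) (z : List ℕ), x.length = V 1 → z.length = V 2 →
      x.length + (encode I ++ z).length = N := by
    intro x z hx hz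
    rw [List.length_append, hx, hz, hN, hn]
  have hpos : 0 < 2 ^ wordSize c N := by positivity
  rw [← hN] at hV
  -- The scheme for one time step, read along the computation on given certificates.
  have hstep : ∀ (x : List ℝ) (z : List ℕ), x.length = V 1 → z.length = V 2 →
      (∀ u ∈ z, u < 2 ^ wordSize c N) → ∀ (v : ℕ → ℝ) (t : ℕ),
      Describes (2 ^ wordSize c N) v t
        (trace P (wordSize c N) (init x (encode I ++ z)) t) →
      ∃ ins, P[(trace P (wordSize c N) (init x (encode I ++ z)) t).pc]? = some ins ∧
      (ins.effect (wordSize c N) (trace P (wordSize c N) (init x (encode I ++ z)) t)).pc =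
        (trace P (wordSize c N) (init x (encode I ++ z)) (t + 1)).pc ∧
      ((stepScheme P).Sat (fun j => (encode I).getD j 0) v 5 (Function.update V 4 t) ↔
        (ins.effect (wordSize c N) (trace P (wordSize c N) (init x (encode I ++ z)) t)).Described
          (2 ^ wordSize c N) v t ∧
        Describes (2 ^ wordSize c N) v (t + 1)
          (trace P (wordSize c N) (init x (encode I ++ z)) (t + 1))) := by
    intro x z hx hz hzw v t hd
    have := h.exists_stopsAt hc I x z
    rw [hlen x z hx hz] at this
    obtain ⟨hb, t₀, -, s₀, ins₀, hs, hs'⟩ := this hzw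
    obtain ⟨ins, h₁, h₂, h₃, h₄⟩ := exists_instr_trace hs hs' t
    refine ⟨ins, h₁, h₄.pc.symm, ?_⟩
    have := sat_stepScheme (inp := fun j => (encode I).getD j 0) (V := Function.update V 4 t)
      (by simpa using hV) (by simpa using hd) (trace_words (init_words hb) t) h₁ h₂ h₃ h₄
    simpa using this
  constructor
  · rintro ⟨v, hi, ht, ha⟩
    replace hi := (sat_initScheme hinp hV).1 hi
    obtain ⟨hpc, hi⟩ := hi
    -- The certificates are read off from the initial registers.
    let x : List ℝ := (List.range (V 1)).map fun a => v (cellIndex (2 ^ wordSize c N) 1 0 a)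
    let z : List ℕ := (List.range (V 2)).map fun a =>
      if V 0 + a < 2 ^ wordSize c N then
        ⌊v (cellIndex (2 ^ wordSize c N) 0 0 (V 0 + a))⌋₊ else 0
    have hx : x.length = V 1 := by simp [x]
    have hz : z.length = V 2 := by simp [z]
    have hzw : ∀ u ∈ z, u < 2 ^ wordSize c N := by
      intro u hu
      simp only [z, List.mem_map, List.mem_range] at hu
      obtain ⟨a, ha, rfl⟩ := hu
      split
      · rename_i hlt
        have := (hi (V 0 + a) hlt).1
        rw [if_neg (by omega), if_pos (by omega)] at this
        obtain ⟨b, hb, hb'⟩ := this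
        rw [hb', Nat.floor_natCast]
        exact hb
      · exact hpos
    have hd₀ : Describes (2 ^ wordSize c N) v 0 (init x (encode I ++ z)) := by
      refine ⟨fun a ha => ?_, fun a ha => ?_, by simpa [init] using hpc⟩
      · have := (hi a ha).1
        simp only [init]
        split_ifs at this with h₁ h₂
        · rw [this, List.getD_append _ _ _ _ (by omega)]
        · obtain ⟨b, hb, hb'⟩ := this
          rw [List.getD_append_right _ _ _ _ (by omega), List.getD_eq_getElem _ _ (by omega)]
          simp only [z, List.getElem_map, List.getElem_range]
          have h₃ : V 0 + (a - (encode I).length) = a := by omega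
          rw [h₃, if_pos ha, hb', Nat.floor_natCast]
        · rw [this, List.getD_eq_default _ _ (by rw [List.length_append]; omega), Nat.cast_zero]
      · have := (hi a ha).2
        simp only [init]
        split_ifs at this with h₁
        · rw [List.getD_eq_getElem _ _ (by omega)]
          simp [x]
        · rw [this, List.getD_eq_default _ _ (by omega)]
    have hd : ∀ t ≤ N ^ c, Describes (2 ^ wordSize c N) v t
        (trace P (wordSize c N) (init x (encode I ++ z)) t) := by
      intro t
      induction t with
      | zero => intro _; exact hd₀
      | succ t ih =>
        intro hle
        obtain ⟨ins, -, -, h₂⟩ := hstep x z hx hz hzw v t (ih (by omega))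
        have h₃ := (FormulaScheme.sat_all _ _).1 ht t (by rw [hT V rfl rfl rfl]; omega)
        exact (h₂.1 h₃).2
    have := h.exists_stopsAt hc I x z
    rw [hlen x z hx hz] at this
    obtain ⟨-, t₀, ht₀, s₀, ins₀, hs, hs'⟩ := this hzw
    have hend := (hd _ le_rfl).pc
    rw [trace_of_le hs hs' ht₀] at hend
    replace ha := (sat_not_conj_notAccept hV (by rw [hT V rfl rfl rfl]; exact hend)).1 ha
    rw [hs.2] at ha
    obtain rfl := Option.some.inj ha
    refine ⟨x, z, hx, hz, ?_, ?_⟩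
    · rw [hlen x z hx hz]; exact hzw
    · rw [hlen x z hx hz]; exact ⟨t₀, s₀, hs⟩
  · rintro ⟨x, z, hx, hz, hzw, ha⟩
    have hend₀ := h.exists_stopsAt hc I x z
    rw [hlen x z hx hz] at hzw ha hend₀
    obtain ⟨hb, t₀, ht₀, s₀, ins₀, hs, hs'⟩ := hend₀ hzw
    obtain ⟨t₁, s₁, hs₁⟩ := ha
    obtain ⟨rfl, rfl⟩ := hs.unique hs' hs₁ (Or.inr (Or.inl rfl))
    obtain ⟨s, hs_def⟩ : ∃ s, s = trace P (wordSize c N) (init x (encode I ++ z)) := ⟨_, rfl⟩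
    -- Conversely, an accepting computation determines values for all variables.
    let e : ℕ → Effect := fun t => ((P[(s t).pc]?).getD .halt).effect (wordSize c N) (s t)
    let v := traceAssignment (2 ^ wordSize c N) s e
    have hd : ∀ t, Describes (2 ^ wordSize c N) v t (s t) := describes_traceAssignment hpos s e
    have hd₀ := hd 0
    rw [hs_def] at hd₀
    simp only [trace] at hd₀
    refine ⟨v, ?_, ?_, ?_⟩
    · change initScheme.Sat _ v 4 V
      rw [sat_initScheme hinp hV]
      refine ⟨by simpa [init] using hd₀.pc, fun a ha => ⟨?_, ?_⟩⟩
      · rw [hd₀.W a ha]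
        simp only [init]
        split_ifs with h₁ h₂
        · rw [List.getD_append _ _ _ _ (by omega)]
        · exact ⟨_, init_words (x := []) hb a, rfl⟩
        · rw [List.getD_eq_default _ _ (by rw [List.length_append]; omega), Nat.cast_zero]
      · split_ifs with h₁
        rw [hd₀.R a ha]
        simp only [init]
        rw [List.getD_eq_default _ _ (by omega)]
    · refine (FormulaScheme.sat_all _ _).2 fun t _ => ?_
      have hdt := hd t
      rw [hs_def] at hdt
      obtain ⟨ins, h₁, h₂, h₃⟩ := hstep x z hx hz hzw v t hdt
      refine h₃.2 ⟨?_, by rw [← hs_def]; exact hd (t + 1)⟩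
      rw [← hs_def] at h₁ h₂ ⊢
      have he : e t = ins.effect (wordSize c N) (s t) := by simp [e, h₁]
      rw [← he] at h₂ ⊢
      exact described_traceAssignment hpos s e t h₂.symm
    · change (FormulaScheme.not _).Sat _ v 4 V
      have hend := (hd (N ^ c)).pc
      rw [hs_def, trace_of_le hs hs' ht₀] at hend
      rw [sat_not_conj_notAccept hV (by rw [hT V rfl rfl rfl]; exact hend)]
      exact hs.2

/-- The formula of a verification algorithm is true iff the instance is a yes-instance. -/
theorem verifierScheme_etrTrue_iff (I : List ℤ) {V : ℕ → ℕ} (hn : V 0 = (encode I).length) :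
    ((verifierScheme P c).toFormula (fun j => (encode I).getD j 0) 1 V).ETRTrue ↔ Q I = true := by
  have hfalse : ∀ v d V', ¬ falseScheme.Sat (fun j => (encode I).getD j 0) v d V' := by
    intro v d V'
    simp [falseScheme, FormulaScheme.sat_lt]
  have h2 := two_le_length_encode I
  have e₁ : ((verifierScheme P c).toFormula (fun j => (encode I).getD j 0) 1 V).ETRTrue ↔
      ∃ v, (verifierScheme P c).Sat (fun j => (encode I).getD j 0) v 1 V := Iff.rfl
  rw [e₁]
  simp only [verifierScheme, FormulaScheme.sat_ex, FormulaScheme.sat_cond, eval_powExpr,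
    WExpr.eval, BinOp.eval, totalExpr, eval_numCells, ne_eq, Nat.reduceEqDiff, not_false_eq_true,
    Function.update_of_ne, Function.update_self, hn, OfNat.zero_ne_ofNat,
    zero_ne_one, OfNat.one_ne_ofNat, Nat.lt_one_iff, hfalse,
    if_false_right, if_false_left, Nat.reduceAdd]
  constructor
  · rintro ⟨v, lx, hlx, lz, hlz, m, hm, h₁, h₂, h₃, hsat⟩
    rw [show m = m + 1 - 1 from rfl, Nat.add_sub_cancel,
      show (m + 1 &&& m) = ((m + 1) &&& (m + 1 - 1)) from rfl,
      Nat.and_sub_one_eq_zero_iff_isPowerOfTwo (by omega)] at h₁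
    obtain ⟨k, hk⟩ := h₁
    have hk' : k = wordSize c (lx + ((encode I).length + lz)) :=
      eq_two_pow_wordSize (by omega) (by omega)
    have := (exists_sat_tableauScheme h hc (I := I)
      (V := Function.update (Function.update (Function.update V 1 lx) 2 lz) 3 m)
      (by simpa using hn) (by simp [hn, hk, ← hk'])).1 ⟨v, hsat⟩
    obtain ⟨x, z, -, -, hz, ha⟩ := this
    by_contra hQ
    exact not_accepts_and_rejects ha (h.sound I (by simpa using hQ) x z hz)
  · intro hQ
    obtain ⟨x, z, hx, hz, hzw, ha⟩ := h.complete I hQ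
    have hM : 0 < 2 ^ wordSize c (x.length + ((encode I).length + z.length)) := by positivity
    have hlow := le_two_pow_wordSize c (x.length + ((encode I).length + z.length))
    have hup := two_pow_wordSize_lt (c := c) (N := x.length + ((encode I).length + z.length))
      (by omega)
    obtain ⟨m, hm⟩ : ∃ m, m + 1 = 2 ^ wordSize c (x.length + ((encode I).length + z.length)) :=
      ⟨_, Nat.succ_pred_eq_of_pos hM⟩
    obtain ⟨v, hv⟩ := (exists_sat_tableauScheme h hc (I := I)
      (V := Function.update (Function.update (Function.update V 1 x.length) 2 z.length) 3 m)
      (by simpa using hn) (by simp [hn, hm])).2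
      ⟨x, z, by simp, by simp, hzw, ha⟩
    refine ⟨v, x.length, by omega, z.length, by omega, m, by omega, ?_, by omega, by omega, hv⟩
    rw [show (m + 1 &&& m) = ((m + 1) &&& (m + 1 - 1)) from rfl,
      Nat.and_sub_one_eq_zero_iff_isPowerOfTwo (by omega)]
    exact ⟨_, hm⟩

end Verifier

/-! ### Codes of instances as sequences of pairs -/

/-- A sequence of pairs, written as a sequence of words. -/
def unpair (l : List (ℕ × ℕ)) : List ℕ := l.flatMap fun p => [p.1, p.2]

/-- The pairs that represent an integer. -/
def intPairs (z : ℤ) : List (ℕ × ℕ) :=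
  (decide (z < 0) :: z.natAbs.bits).map (fun β => (1, β.toNat)) ++ [(0, 1)]

theorem encode_eq_unpair (I : List ℤ) :
    encode I = unpair (I.flatMap intPairs) ++ [0, 0] := by
  have : ∀ z, encodeInt z = unpair (intPairs z) := by
    intro z
    simp [encodeInt, intPairs, unpair, List.flatMap_map]
  rw [encode, show encodeInt = fun z => unpair (intPairs z) from funext this]
  simp only [unpair, List.flatMap_assoc]

theorem length_unpair (l : List (ℕ × ℕ)) : (unpair l).length = 2 * l.length := by
  simp [unpair, mul_comm]

theorem getD_unpair (l : List (ℕ × ℕ)) (r : List ℕ) {j : ℕ} (hj : j < l.length) :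
    (unpair l ++ r).getD (2 * j) 0 = l[j].1 ∧ (unpair l ++ r).getD (2 * j + 1) 0 = l[j].2 := by
  induction l generalizing j with
  | nil => simp at hj
  | cons p l ih =>
    have : unpair (p :: l) ++ r = p.1 :: p.2 :: (unpair l ++ r) := by simp [unpair]
    rw [this]
    cases j with
    | zero => simp
    | succ j =>
      have := ih (j := j) (by simpa using hj)
      simpa [Nat.mul_succ] using this

theorem intPairs_ne_zero {z : ℤ} {p : ℕ × ℕ} (hp : p ∈ intPairs z) : 0 < p.1 + p.2 := by
  simp only [intPairs, List.mem_append, List.mem_map, List.mem_singleton] at hp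
  rcases hp with ⟨β, -, rfl⟩ | rfl
  · simp
  · simp

/-- The end of the code of an instance is the first pair of zeros. -/
theorem encode_pairs (I : List ℤ) : ∃ k, (encode I).length = 2 * k + 2 ∧
    (∀ j < k, 0 < (encode I).getD (2 * j) 0 + (encode I).getD (2 * j + 1) 0) ∧
    ∀ i, 2 * k ≤ i → (encode I).getD i 0 = 0 := by
  refine ⟨(I.flatMap intPairs).length, ?_, fun j hj => ?_, fun i hi => ?_⟩
  · simp [encode_eq_unpair, length_unpair]
  · rw [encode_eq_unpair]
    obtain ⟨h₁, h₂⟩ := getD_unpair _ [0, 0] hj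
    rw [h₁, h₂]
    obtain ⟨z, -, hz⟩ := List.mem_flatMap.1 (List.getElem_mem hj)
    exact intPairs_ne_zero hz
  · rw [encode_eq_unpair, List.getD_append_right _ _ _ _ (by rw [length_unpair]; omega)]
    rcases h : i - (unpair (I.flatMap intPairs)).length with _ | _ | k <;> simp

/-! ### The reduction program -/

/-- Number with the binary digits `g 0, …, g (k - 1)`, most significant first. -/
def packed (g : ℕ → ℕ) : ℕ → ℕ
  | 0 => 0
  | k + 1 => 2 * packed g k + g k

theorem packed_lt {g : ℕ → ℕ} (hg : ∀ i, g i = 0 ∨ g i = 1) (k : ℕ) : packed g k < 2 ^ k := by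
  induction k with
  | zero => simp [packed]
  | succ k ih =>
    rw [packed, pow_succ]
    rcases hg k with h | h <;> omega

/-- Copy one pair of words, and read the next one. -/
def relocateBody : Cmd :=
  .seq (.store (.op .add (.var 31) (.var 2)) (.var 3))
  (.seq (.store (.op .add (.op .add (.var 31) (.var 2)) (.const 1)) (.var 4))
  (.seq (.assign 2 (.op .add (.var 2) (.const 2)))
  (.seq (.load 3 (.var 2)) (.load 4 (.op .add (.var 2) (.const 1))))))

/-- Copy the pairs of input words from address `64` on to the memory that starts at the address in
variable `31`, until the final pair. This frees the memory from address `64` on for the output. -/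
def relocate : Cmd :=
  .seq (.seq (.assign 2 (.const 64)) (.seq (.load 3 (.var 2))
    (.load 4 (.op .add (.var 2) (.const 1)))))
  (.loop (.lt (.const 0) (.op .add (.var 3) (.var 4))) relocateBody)

/-- Write the last bit of variable `0` to the memory, and remove it. -/
def unpackBody : Cmd :=
  .seq (.sub 2 (.var 2) (.const 1))
  (.seq (.store (.op .add (.var 31) (.var 2)) (.op .modS (.var 0) (.const 1)))
  (.assign 0 (.op .divS (.var 0) (.const 1))))

/-- Write the `64` bits of variable `0` to the memory from the address in variable `31` on. -/
def unpack : Cmd :=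
  .seq (.assign 2 (.const 64))
  (.loop (.lt (.const 0) (.var 2)) unpackBody)

/-- Load the pair number `V 2 / 2` of the relocated input. -/
def loadPair : Cmd :=
  .seq (.load 3 (.op .add (.var 31) (.var 2)))
    (.load 4 (.op .add (.op .add (.var 31) (.var 2)) (.const 1)))

/-- Compute the size of the relocated input, and initialize the output pointer. -/
def measure : Cmd :=
  .seq (.seq (.assign 2 (.const 0)) loadPair)
  (.seq (.loop (.lt (.const 0) (.op .add (.var 3) (.var 4)))
    (.seq (.assign 2 (.op .add (.var 2) (.const 2))) loadPair))
  (.seq (.assign 0 (.op .add (.var 2) (.const 2))) (.assign 30 (.const 64))))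

section Setup

variable {w n k B : ℕ} {g : ℕ → ℕ}
  (hB : n + 200 ≤ B) (hw : 2 * B ≤ 2 ^ w) (hB64 : 2 ^ 64 ≤ B)
  (hg : ∀ i, g i = 0 ∨ g i = 1) (hk : n = 2 * k + 2)
  (hpos : ∀ j < k, 0 < g (2 * j) + g (2 * j + 1)) (hzero : ∀ i, 2 * k ≤ i → g i = 0)

include hB hw hg hk hpos hzero in
theorem relocate_spec {σ : Store} (h31 : σ.V 31 = B) (hM : ∀ a, 64 ≤ a → σ.M a = g a) :
    Cmd.Ends w relocate (n * 50 + 50) (fun σ' => σ'.V 0 = σ.V 0 ∧ σ'.V 31 = B ∧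
      ∀ i, 64 ≤ i → σ'.M (B + i) = g i) σ := by
  have hg1 : ∀ i, g i ≤ 1 := fun i => by rcases hg i with h | h <;> omega
  let I : ℕ → Store → Prop := fun j τ => τ.V 0 = σ.V 0 ∧ τ.V 31 = B ∧ τ.V 2 = 64 + 2 * j ∧
    τ.V 3 = g (64 + 2 * j) ∧ τ.V 4 = g (64 + 2 * j + 1) ∧ (∀ a, 64 ≤ a → a < B → τ.M a = g a) ∧
    ∀ i, 64 ≤ i → τ.M (B + i) = if i < 64 + 2 * j then g i else 0
  have h₁ : Cmd.wp w (.seq (.assign 2 (.const 64)) (.seq (.load 3 (.var 2))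
      (.load 4 (.op .add (.var 2) (.const 1))))) (I 0) σ := by
    simp only [Cmd.wp, WExpr.Ok, WExpr.eval, BinOp.eval, I]
    refine ⟨by omega, ⟨by simp; omega, by simp, ⟨by simp; omega, by omega, by simp; omega⟩,
      by simp, ?_⟩⟩
    simp [hM, h31]
    refine ⟨fun a ha _ => hM a ha, fun i hi => ?_⟩
    rw [hM _ (by omega), hzero _ (by omega), if_neg (by omega)]
  refine Cmd.Ends.mono ((Cmd.Ends.of_wp h₁).seq' fun σ₁ hσ₁ =>
    -- Pairs with numbers below `32` have been packed; if there are no others, nothing is copied.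
    Cmd.Ends.loop (T := relocateBody.cost) (m := k - 32) I (fun j hj τ hτ => ?_)
      (fun τ hτ => ?_) hσ₁) ?_ ?_
  rotate_left 1
  · obtain ⟨-, -, -, e3, e4, -⟩ := hτ
    have := hzero (64 + 2 * (k - 32)) (by omega)
    have := hzero (64 + 2 * (k - 32) + 1) (by omega)
    simp only [Test.Ok, Test.Holds, WExpr.Ok, WExpr.eval, BinOp.eval, e3, e4]
    omega
  · have : (k - 32) ≤ n := by omega
    simp only [relocateBody, Cmd.cost, Cmd.size, Test.len, WExpr.len, BinOp.code, List.length_cons,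
      List.length_nil]
    omega
  · rintro τ ⟨e0, e31, -, -, -, -, e⟩
    refine ⟨e0, e31, fun i hi => ?_⟩
    rw [e i hi]
    split
    · rfl
    · rw [hzero i (by omega)]
  · obtain ⟨e0, e31, e2, e3, e4, eM, e⟩ := hτ
    have hp := hpos (32 + j) (by omega)
    rw [show 2 * (32 + j) = 64 + 2 * j by ring] at hp
    have g1 := hg1 (64 + 2 * j)
    have g2 := hg1 (64 + 2 * j + 1)
    refine ⟨?_, ?_, Cmd.Ends.of_wp ?_⟩
    · simp only [Test.Ok, WExpr.Ok, WExpr.eval, BinOp.eval, e3, e4]; omega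
    · simp only [Test.Holds, WExpr.eval, BinOp.eval, e3, e4]; omega
    · simp only [relocateBody, Cmd.wp, WExpr.Ok, WExpr.eval, BinOp.eval, ne_eq, Nat.reduceEqDiff,
        not_false_eq_true, Function.update_of_ne, Function.update_self, e31, e2, e3, e4,
        OfNat.zero_ne_ofNat, I, e0]
      and_intros
      any_goals first | exact True.intro | omega
      · rw [Function.update_of_ne (by omega), Function.update_of_ne (by omega),
          eM _ (by omega) (by omega)]
        congr 1
      · rw [Function.update_of_ne (by omega), Function.update_of_ne (by omega),
          eM _ (by omega) (by omega)]
        congr 1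
      · intro a ha ha'
        rw [Function.update_of_ne (by omega), Function.update_of_ne (by omega), eM a ha ha']
      · intro i hi
        simp only [Function.update_apply]
        by_cases c1 : i = 64 + 2 * j
        · subst c1; simp
        · by_cases c2 : i = 64 + 2 * j + 1
          · subst c2
            rw [if_pos (by omega), if_pos (by omega)]
          · rw [if_neg (by omega), if_neg (by omega), e i hi]
            by_cases c3 : i < 64 + 2 * j
            · rw [if_pos c3, if_pos (by omega)]
            · rw [if_neg c3, if_neg (by omega)]

include hw hg hB64 in
theorem unpack_spec {σ : Store} (h0 : σ.V 0 = packed g 64) (h31 : σ.V 31 = B)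
    (hM : ∀ i, 64 ≤ i → σ.M (B + i) = g i) :
    Cmd.Ends w unpack 2000 (fun σ' => σ'.V 31 = B ∧ ∀ i, σ'.M (B + i) = g i) σ := by
  let I : ℕ → Store → Prop := fun j τ => τ.V 0 = packed g (64 - j) ∧ τ.V 31 = B ∧
    τ.V 2 = 64 - j ∧ ∀ i, 64 - j ≤ i → τ.M (B + i) = g i
  have h₁ : Cmd.wp w (.assign 2 (.const 64)) (I 0) σ := by
    simp only [Cmd.wp, WExpr.Ok, WExpr.eval, I]
    exact ⟨by omega, by simpa using h0, by simpa using h31, by simp, by simpa using hM⟩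
  refine Cmd.Ends.mono ((Cmd.Ends.of_wp h₁).seq' fun σ₁ hσ₁ =>
    Cmd.Ends.loop (T := unpackBody.cost) (m := 64) I (fun j hj τ hτ => ?_)
      (fun τ hτ => ?_) hσ₁) ?_ ?_
  rotate_left 1
  · obtain ⟨-, -, e2, -⟩ := hτ
    simp only [Test.Ok, Test.Holds, WExpr.Ok, WExpr.eval, e2]
    omega
  · simp only [unpackBody, Cmd.cost, Cmd.size, Test.len, WExpr.len, BinOp.code, List.length_cons,
      List.length_nil]
    omega
  · rintro τ ⟨-, e31, -, e⟩
    exact ⟨e31, fun i => e i (by omega)⟩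
  · obtain ⟨e0, e31, e2, e⟩ := hτ
    obtain ⟨m, hm⟩ : ∃ m, 64 - j = m + 1 := ⟨63 - j, by omega⟩
    rw [hm] at e0 e2 e
    have hlt := packed_lt hg (m + 1)
    have hle : 2 ^ (m + 1) ≤ 2 ^ 64 := Nat.pow_le_pow_right (by norm_num) (by omega)
    have hgm := hg m
    have hp : packed g (m + 1) = 2 * packed g m + g m := rfl
    refine ⟨?_, ?_, Cmd.Ends.of_wp ?_⟩
    · simp only [Test.Ok, WExpr.Ok, e2]; omega
    · simp only [Test.Holds, WExpr.eval, e2]; omega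
    · simp only [unpackBody, Cmd.wp, WExpr.Ok, WExpr.eval, BinOp.eval, ne_eq, Nat.reduceEqDiff,
        not_false_eq_true, Function.update_of_ne, Function.update_self, e31, e2, e0,
        Nat.add_sub_cancel, OfNat.zero_ne_ofNat, OfNat.ofNat_ne_zero, I,
        show 64 - (j + 1) = m by omega]
      and_intros
      any_goals first | exact True.intro | omega
      · intro i hi
        simp only [Function.update_apply]
        by_cases c1 : i = m
        · subst c1
          rw [if_pos rfl]
          omega
        · rw [if_neg (by omega), e i (by omega)]

include hB hw hg hk hpos hzero in
theorem measure_spec {σ : Store} (h31 : σ.V 31 = B) (hM : ∀ i, σ.M (B + i) = g i) :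
    Cmd.Ends w measure (n * 50 + 50) (fun σ' => σ'.V 0 = n ∧ σ'.V 30 = 64 ∧ σ'.V 31 = B ∧
      ∀ i, σ'.M (B + i) = g i) σ := by
  have hg1 : ∀ i, g i ≤ 1 := fun i => by rcases hg i with h | h <;> omega
  let I : ℕ → Store → Prop := fun j τ => τ.V 31 = B ∧ τ.V 2 = 2 * j ∧
    τ.V 3 = g (2 * j) ∧ τ.V 4 = g (2 * j + 1) ∧ ∀ i, τ.M (B + i) = g i
  have h₁ : Cmd.wp w (.seq (.assign 2 (.const 0)) loadPair) (I 0) σ := by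
    simp only [loadPair, Cmd.wp, WExpr.Ok, WExpr.eval, BinOp.eval, I, ne_eq, Nat.reduceEqDiff,
      not_false_eq_true, Function.update_of_ne, Function.update_self, h31, add_assoc, hM]
    and_intros
    any_goals first | exact True.intro | omega
    · exact fun _ => True.intro
  refine Cmd.Ends.mono ((Cmd.Ends.of_wp h₁).seq' fun σ₁ hσ₁ =>
    (Cmd.Ends.loop (T := Cmd.cost (.seq (.assign 2 (.op .add (.var 2) (.const 2))) loadPair))
      (m := k) I (fun j hj τ hτ => ?_) (fun τ hτ => ?_) hσ₁).seq'
      fun σ₂ hσ₂ => Cmd.Ends.of_wp (Q := fun σ' => σ'.V 0 = n ∧ σ'.V 30 = 64 ∧ σ'.V 31 = B ∧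
      ∀ i, σ'.M (B + i) = g i) ?_) ?_ fun _ h => h
  rotate_left 1
  · obtain ⟨-, -, e3, e4, -⟩ := hτ
    have := hzero (2 * k) (by omega)
    have := hzero (2 * k + 1) (by omega)
    simp only [Test.Ok, Test.Holds, WExpr.Ok, WExpr.eval, BinOp.eval, e3, e4]
    omega
  · obtain ⟨e31, e2, e3, e4, e⟩ := hσ₂
    simp only [Cmd.wp, WExpr.Ok, WExpr.eval, BinOp.eval, e2]
    refine ⟨by omega, by omega, by simp [hk], by simp, by simpa using e31, by simpa using e⟩
  · simp only [loadPair, Cmd.cost, Cmd.size, Test.len, WExpr.len, BinOp.code, List.length_cons,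
      List.length_nil]
    omega
  · obtain ⟨e31, e2, e3, e4, e⟩ := hτ
    have hp := hpos j hj
    have g1 := hg1 (2 * j)
    have g2 := hg1 (2 * j + 1)
    refine ⟨?_, ?_, Cmd.Ends.of_wp ?_⟩
    · simp only [Test.Ok, WExpr.Ok, WExpr.eval, BinOp.eval, e3, e4]; omega
    · simp only [Test.Holds, WExpr.eval, BinOp.eval, e3, e4]; omega
    · simp only [loadPair, Cmd.wp, WExpr.Ok, WExpr.eval, BinOp.eval, ne_eq, Nat.reduceEqDiff,
        not_false_eq_true, Function.update_of_ne, Function.update_self, e31, e2, I, add_assoc, e,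
        Nat.mul_add]
      and_intros
      any_goals first | exact True.intro | omega
      · exact fun _ => True.intro

end Setup

/-! ### The formula scheme of a verification algorithm can be generated by a word RAM -/

theorem conjInstr_wf {f : ℕ → Instr → FormulaScheme} {P : Program} {d : ℕ}
    (h : ∀ l ins, (f l ins).WF d) (k : ℕ) : (conjInstr f k P).WF d := by
  induction P generalizing k with
  | nil => simp [conjInstr, FormulaScheme.WF, TermScheme.WF, WExpr.Fits, WExpr.Below, WExpr.WF]
  | cons ins P ih => exact ⟨h k ins, ih (k + 1)⟩

theorem effectScheme_wf (l : ℕ) (ins : Instr) : (effectScheme l ins).WF 5 := by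
  cases ins
  case wArith o i j k =>
    cases o <;> simp [effectScheme, writesR, noR, goesTo, now, later, cell, numCells, opEntry,
      FormulaScheme.WF, TermScheme.WF, WExpr.Fits, WExpr.Below, WExpr.WF]
  case rArith o i j k =>
    cases o <;> simp [effectScheme, writesW, noW, goesTo, now, later, cell, numCells, realOpScheme,
      FormulaScheme.WF, TermScheme.WF, WExpr.Fits, WExpr.Below, WExpr.WF]
  all_goals
    simp [effectScheme, writesW, writesR, noW, noR, goesTo, now, later, cell, numCells,
      branchScheme, FormulaScheme.WF, TermScheme.WF, WExpr.Fits, WExpr.Below, WExpr.WF]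

theorem powExpr_below {e : WExpr} {d : ℕ} (h : e.Below d) (c : ℕ) : (powExpr e c).Below d := by
  induction c with
  | zero => trivial
  | succ c ih => exact ⟨ih, h⟩

theorem powExpr_wf {e : WExpr} {d : ℕ} (h : e.WF (d + 1)) (hd : d + 2 < 64) (c : ℕ) :
    (powExpr e c).WF d := by
  induction c with
  | zero => simp only [powExpr, WExpr.WF]; omega
  | succ c ih => exact ⟨ih, h, hd⟩

theorem totalExpr_below {d : ℕ} (h : 3 ≤ d) : totalExpr.Below d := by
  simp only [totalExpr, WExpr.Below]; omega

theorem totalExpr_wf {d : ℕ} (h : d ≤ 40) : totalExpr.WF d := by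
  simp only [totalExpr, WExpr.WF]; omega

theorem tableauScheme_wf (P : Program) (c : ℕ) : (tableauScheme P c).WF 4 := by
  have hpow : (powExpr totalExpr c).Fits 4 :=
    ⟨powExpr_below (totalExpr_below (by norm_num)) c,
      powExpr_wf (totalExpr_wf (by norm_num)) (by norm_num) c⟩
  refine ⟨?_, ⟨by norm_num, hpow, ?_, conjInstr_wf (fun l ins => ?_) 0⟩,
    conjInstr_wf (fun l ins => ?_) 0⟩
  · simp [initScheme, cell, numCells, FormulaScheme.WF, TermScheme.WF, WExpr.Fits, WExpr.Below,
      WExpr.WF]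
  · simp [frameScheme, now, later, cell, numCells, FormulaScheme.WF, TermScheme.WF, WExpr.Fits,
      WExpr.Below, WExpr.WF]
  · refine ⟨?_, effectScheme_wf l ins⟩
    simp [now, cell, FormulaScheme.WF, TermScheme.WF, WExpr.Fits, WExpr.Below, WExpr.WF]
  · have hpow' : (powExpr totalExpr c).WF 34 := hpow.2
    have hpow'' : (powExpr totalExpr c).Below 4 := hpow.1
    cases ins <;> simp [notAcceptScheme, cell, FormulaScheme.WF, TermScheme.WF, WExpr.Fits,
      WExpr.Below, WExpr.WF, hpow', hpow'']

theorem verifierScheme_wf (P : Program) (c : ℕ) : (verifierScheme P c).WF 1 := by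
  have h₁ : ∀ d, (powExpr (.var 0) c).Below (d + 1) := fun d =>
    powExpr_below (by simp [WExpr.Below]) c
  have h₂ : (powExpr (.var 0) c).WF 34 := powExpr_wf (by simp [WExpr.WF]) (by norm_num) c
  have h₃ : ∀ d, (powExpr totalExpr c).Below (d + 3) := fun d =>
    powExpr_below (totalExpr_below (by omega)) c
  have h₄ : ∀ d ≤ 35, (powExpr totalExpr c).WF d := fun d hd =>
    powExpr_wf (totalExpr_wf (by omega)) (by omega) c
  simp [verifierScheme, falseScheme, numCells, FormulaScheme.WF, TermScheme.WF, WExpr.Fits,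
    WExpr.Below, WExpr.WF, h₁ 0, h₁ 1, h₂, h₃ 0, h₃ 1, h₄, tableauScheme_wf]

/-! ### Programs of the word RAM -/

theorem WExpr.isWord_code {e : WExpr} {d : ℕ} : ∀ ins ∈ e.code d, ins.IsWord := by
  induction e generalizing d with
  | const k => simp [code, Instr.IsWord]
  | var i => simp [code, Instr.IsWord]
  | op o e f he hf =>
    intro ins h
    simp only [code, List.mem_append] at h
    rcases h with h | h | h
    · exact he _ h
    · exact hf _ h
    · cases o <;> simp only [BinOp.code, List.mem_cons, List.not_mem_nil, or_false] at h <;>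
        rcases h with rfl | rfl | rfl <;> trivial

/-- The tests that do not involve real variables. -/
def Test.IsWord : Test → Prop
  | lt _ _ | eq _ _ => True
  | _ => False

/-- The programs that do not involve real variables. -/
def Cmd.IsWord : Cmd → Prop
  | skip | assign _ _ | load _ _ | store _ _ | sub _ _ _ => True
  | seq c₁ c₂ => c₁.IsWord ∧ c₂.IsWord
  | ite t c₁ c₂ => t.IsWord ∧ c₁.IsWord ∧ c₂.IsWord
  | loop t c => t.IsWord ∧ c.IsWord
  | _ => False

theorem Test.isWord_code {t : Test} (h : t.IsWord) {l : ℕ} : ∀ ins ∈ t.code l, ins.IsWord := by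
  intro ins h'
  cases t with
  | lt e f | eq e f =>
    simp only [code, List.mem_append, List.mem_singleton] at h'
    rcases h' with h' | h' | rfl
    · exact WExpr.isWord_code _ h'
    · exact WExpr.isWord_code _ h'
    · trivial
  | _ => exact h.elim

theorem Cmd.isWord_code {c : Cmd} (h : c.IsWord) {off : ℕ} : ∀ ins ∈ c.code off, ins.IsWord := by
  induction c generalizing off with
  | skip => simp [code]
  | assign v e | load v e =>
    intro ins h'
    simp only [code, List.mem_append, List.mem_singleton] at h'
    rcases h' with h' | rfl
    · exact WExpr.isWord_code _ h'
    · trivial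
  | store e f | sub v e f =>
    intro ins h'
    simp only [code, List.mem_append, List.mem_singleton] at h'
    rcases h' with h' | h' | rfl
    · exact WExpr.isWord_code _ h'
    · exact WExpr.isWord_code _ h'
    · trivial
  | seq c₁ c₂ h₁ h₂ =>
    intro ins h'
    simp only [code, List.mem_append] at h'
    rcases h' with h' | h'
    · exact h₁ h.1 _ h'
    · exact h₂ h.2 _ h'
  | ite t c₁ c₂ h₁ h₂ =>
    intro ins h'
    simp only [code, List.mem_append, List.mem_cons] at h'
    rcases h' with h' | h' | rfl | h'
    · exact Test.isWord_code h.1 _ h'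
    · exact h₂ h.2.2 _ h'
    · trivial
    · exact h₁ h.2.1 _ h'
  | loop t c hc =>
    intro ins h'
    simp only [code, List.mem_append, List.mem_cons, List.not_mem_nil, or_false] at h'
    rcases h' with h' | rfl | h' | rfl
    · exact Test.isWord_code h.1 _ h'
    · trivial
    · exact hc h.2 _ h'
    · trivial
  | _ => exact h.elim

theorem TermScheme.isWord_gen (T : TermScheme) (d : ℕ) : (T.gen d).IsWord := by
  induction T with
  | add s t hs ht => exact ⟨by simp [emit, Cmd.IsWord], hs, ht⟩
  | mul s t hs ht => exact ⟨by simp [emit, Cmd.IsWord], hs, ht⟩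
  | _ => simp [gen, emitLoop, emit, incr, Cmd.IsWord, Test.IsWord]

theorem FormulaScheme.isWord_gen (F : FormulaScheme) (d : ℕ) : (F.gen d).IsWord := by
  induction F generalizing d with
  | eq s t | lt s t =>
    exact ⟨by simp [emit, Cmd.IsWord], TermScheme.isWord_gen s d, TermScheme.isWord_gen t d⟩
  | and F G hF hG | or F G hF hG => exact ⟨by simp [emit, Cmd.IsWord], hF d, hG d⟩
  | not F hF => exact ⟨by simp [emit, Cmd.IsWord], hF d⟩
  | all e F hF | ex e F hF =>
    simp [gen, emitLoop, emit, incr, Cmd.IsWord, Test.IsWord, hF (d + 1)]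
  | cond e f F G hF hG => exact ⟨trivial, hF d, hG d⟩

theorem exists_goodWords (P : Program) : ∃ K, ∀ w, K < 2 ^ w → GoodWords P w := by
  refine ⟨(P.flatMap Instr.words).sum, fun w hw ins hi a ha => ?_⟩
  exact (List.le_sum_of_mem (List.mem_flatMap.2 ⟨ins, hi, ha⟩)).trans_lt hw

/-! ### Straight-line code before and after a structured program -/

/-- Set the registers with addresses below `m` to constants. -/
def constsCode (f : ℕ → ℕ) (m : ℕ) : List Instr := (List.range m).map fun i => .wConst i (f i)

/-- Pack the bits in the first `k + 1` registers into register `0`. The first `64` words of an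
instance are saved in this way before their registers are used as variables and scratch space. -/
def packCode (k : ℕ) : List Instr :=
  (List.range k).flatMap fun i => [.wArith .add 0 0 0, .wArith .add 0 0 (i + 1)]

/-- Set register `31` to half of the number of words. -/
def halfCode : List Instr :=
  [.wConst 31 0, .wArith .nand 31 31 31, .wConst 30 2, .wArith .div 31 31 30, .wConst 30 1,
    .wArith .add 31 31 30]

theorem length_packCode (k : ℕ) : (packCode k).length = 2 * k := by
  simp [packCode, mul_comm]

section Run

variable {P : Program} {w : ℕ} (hP : GoodWords P w)
include hP

theorem run_constsCode {f : ℕ → ℕ} {m off : ℕ} {s : Config} (hc : CodeAt P off (constsCode f m))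
    (hs : s.pc = off) :
    run P w m s = some { pc := off + m, W := fun i => if i < m then f i else s.W i, R := s.R } := by
  induction m with
  | zero => simp [run, ← hs]
  | succ m ih =>
    rw [constsCode, List.range_succ, List.map_append] at hc
    have c₁ := hc.right
    simp only [List.length_map, List.length_range, List.map_cons] at c₁
    refine run_trans (ih hc.left) (run_instr hP c₁ rfl ?_)
    simp only [Instr.exec, Config.setW, add_assoc]
    congr 2
    funext i
    rw [Function.update_apply]
    split_ifs <;> first | rfl | omega | (congr 1; omega)

theorem run_packCode {g : ℕ → ℕ} (hg : ∀ i, g i = 0 ∨ g i = 1) {k off : ℕ} (hk : k < w)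
    {s : Config} (hc : CodeAt P off (packCode k)) (hs : s.pc = off) (hW : ∀ i, s.W i = g i) :
    run P w (2 * k) s =
      some { pc := off + 2 * k, W := Function.update s.W 0 (packed g (k + 1)), R := s.R } := by
  induction k with
  | zero =>
    have : Function.update s.W 0 (packed g 1) = s.W := by
      rw [Function.update_eq_self_iff]
      simp [packed, hW]
    simp only [mul_zero, run, zero_add, this, add_zero, ← hs]
  | succ k ih =>
    rw [packCode, List.range_succ, List.flatMap_append] at hc
    have c₁ := hc.right
    replace c₁ : CodeAt P (off + (packCode k).length) _ := c₁
    rw [length_packCode] at c₁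
    have r₁ := ih (by omega) hc.left
    have hlt := packed_lt hg (k + 1)
    have hlt' := packed_lt hg (k + 2)
    have hle : 2 ^ (k + 2) ≤ 2 ^ w := Nat.pow_le_pow_right (by norm_num) (by omega)
    have hp : packed g (k + 2) = 2 * packed g (k + 1) + g (k + 1) := rfl
    refine run_trans r₁ (run_trans (run_instr hP c₁ rfl rfl) (run_instr hP c₁.tail rfl ?_))
    simp only [Instr.exec, WordOp.eval, Config.setW, Option.map_some, Function.update_self,
      Function.update_idem, ne_eq, Nat.add_eq_zero_iff, one_ne_zero, and_false, not_false_eq_true,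
      Function.update_of_ne, hW]
    rw [Nat.mod_eq_of_lt (a := packed g (k + 1) + packed g (k + 1)) (by omega),
      Nat.mod_eq_of_lt (by omega), hp, two_mul (packed g (k + 1))]
    rfl

theorem run_halfCode {off : ℕ} (hw : 2 ≤ w) {s : Config} (hc : CodeAt P off halfCode)
    (hs : s.pc = off) :
    ∃ W, run P w 6 s = some { pc := off + 6, W := W, R := s.R } ∧ W 31 = 2 ^ (w - 1) ∧
      ∀ i, i ≠ 30 → i ≠ 31 → W i = s.W i := by
  obtain ⟨k, rfl⟩ : ∃ k, w = k + 1 := ⟨w - 1, by omega⟩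
  have hk : 2 ≤ 2 ^ k := by
    calc 2 = 2 ^ 1 := rfl
      _ ≤ 2 ^ k := Nat.pow_le_pow_right (by norm_num) (by omega)
  have hk' : 2 ^ (k + 1) = 2 * 2 ^ k := by ring
  have e₁ : (2 ^ (k + 1) - 1) / 2 = 2 ^ k - 1 := by omega
  have e₂ : (2 ^ k - 1 + 1) % 2 ^ (k + 1) = 2 ^ k := by
    rw [Nat.mod_eq_of_lt (by omega)]; omega
  let s₁ := s.setW 31 0
  let s₂ := s₁.setW 31 (2 ^ (k + 1) - 1)
  let s₃ := s₂.setW 30 2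
  let s₄ := s₃.setW 31 (2 ^ k - 1)
  let s₅ := s₄.setW 30 1
  let s₆ := s₅.setW 31 (2 ^ k)
  have r₁ : run P (k + 1) 1 s = some s₁ := run_instr hP hc hs rfl
  have r₂ : run P (k + 1) 1 s₁ = some s₂ := run_instr hP hc.tail (by simp [s₁, Config.setW, hs])
    (by simp [s₁, s₂, Config.setW, Instr.exec, WordOp.eval])
  have r₃ : run P (k + 1) 1 s₂ = some s₃ := run_instr hP hc.tail.tail
    (by simp [s₁, s₂, Config.setW, hs]) rfl
  have r₄ : run P (k + 1) 1 s₃ = some s₄ := run_instr hP hc.tail.tail.tail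
    (by simp [s₁, s₂, s₃, Config.setW, hs])
    (by simp [s₁, s₂, s₃, s₄, Config.setW, Instr.exec, WordOp.eval, e₁])
  have r₅ : run P (k + 1) 1 s₄ = some s₅ := run_instr hP hc.tail.tail.tail.tail
    (by simp [s₁, s₂, s₃, s₄, Config.setW, hs]) rfl
  have r₆ : run P (k + 1) 1 s₅ = some s₆ := run_instr hP hc.tail.tail.tail.tail.tail
    (by simp [s₁, s₂, s₃, s₄, s₅, Config.setW, hs])
    (by simp [s₁, s₂, s₃, s₄, s₅, s₆, Config.setW, Instr.exec, WordOp.eval, e₂])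
  refine ⟨s₆.W, ?_, by simp [s₆, Config.setW], fun i h₁ h₂ => ?_⟩
  · rw [run_trans r₁ (run_trans r₂ (run_trans r₃ (run_trans r₄ (run_trans r₅ r₆))))]
    simp [s₁, s₂, s₃, s₄, s₅, s₆, Config.setW, hs]
  · simp [s₁, s₂, s₃, s₄, s₅, s₆, Config.setW, h₁, h₂]

end Run

/-! ### Problems with a real verification algorithm belong to `∃ℝ` -/

/-- A formula with the same meaning whose code starts with `4 * k` further symbols. With `k = 16`
the remaining symbols belong into the registers from `64` on, which are the memory of structured
programs, and the constant symbols before them can be written at the very end. -/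
def Formula.pad : ℕ → Formula → Formula
  | 0, φ => φ
  | k + 1, φ => .and (.eq .zero .zero) (pad k φ)

theorem Formula.etrTrue_pad (k : ℕ) (φ : Formula) : (pad k φ).ETRTrue ↔ φ.ETRTrue := by
  unfold ETRTrue
  refine exists_congr fun v => ?_
  induction k with
  | zero => rfl
  | succ k ih => simp [pad, Holds, ih]

/-- The symbols with which padding begins. -/
def padSymbol (i : ℕ) : ℕ := if i % 4 = 0 then 7 else if i % 4 = 1 then 4 else 0

theorem Formula.code_pad (k : ℕ) (φ : Formula) :
    (pad k φ).code = (List.range (4 * k)).map padSymbol ++ φ.code := by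
  induction k with
  | zero => rfl
  | succ k ih =>
    rw [pad, code, ih, show 4 * (k + 1) = 4 + 4 * k by ring, List.range_add]
    simp [code, Term.code, padSymbol, List.range_succ]

/-- The structured part of the reduction: move the instance to the upper half of the memory, compute
its size, and output the formula of the verification algorithm. -/
def reductionCmd (P : Program) (c : ℕ) : Cmd :=
  .seq relocate (.seq unpack (.seq measure ((verifierScheme P c).gen 1)))

/-- The program that transforms an instance into an ETR formula. -/
def reduction (P : Program) (c : ℕ) : Program :=
  packCode 63 ++ (halfCode ++ ((reductionCmd P c).code 132 ++ (constsCode padSymbol 64 ++ [.halt])))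

theorem reductionCmd_wf (P : Program) (c : ℕ) : (reductionCmd P c).WF := by
  refine ⟨?_, ?_, ?_, FormulaScheme.wf_gen (by norm_num) (verifierScheme_wf P c)⟩
  · simp [relocate, relocateBody, Cmd.WF, Test.WF, WExpr.WF]
  · simp [unpack, unpackBody, Cmd.WF, Test.WF, WExpr.WF]
  · simp [measure, loadPair, Cmd.WF, Test.WF, WExpr.WF]

theorem reduction_isWord (P : Program) (c : ℕ) : ∀ ins ∈ reduction P c, ins.IsWord := by
  intro ins h
  simp only [reduction, packCode, halfCode, constsCode, List.mem_append, List.mem_flatMap,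
    List.mem_map, List.mem_cons, List.not_mem_nil, or_false] at h
  rcases h with ⟨i, -, rfl | rfl⟩ | (rfl | rfl | rfl | rfl | rfl | rfl) | h | ⟨i, -, rfl⟩ | rfl
  case inr.inr.inl =>
    refine Cmd.isWord_code (c := reductionCmd P c)
      ⟨?_, ?_, ?_, FormulaScheme.isWord_gen _ 1⟩ _ h
    · simp [relocate, relocateBody, Cmd.IsWord, Test.IsWord]
    · simp [unpack, unpackBody, Cmd.IsWord, Test.IsWord]
    · simp [measure, loadPair, Cmd.IsWord, Test.IsWord]
  all_goals trivial

/-- The word size `⌈(d + K + 100) log₂ n⌉` is at least `64`, admits the constant `K`, and leaves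
space for `n ^ d` symbols of output in the lower half of the memory. -/
theorem reduction_size_bounds {n d K w : ℕ} (hn : 2 ≤ n) (h : n ^ (d + K + 100) ≤ 2 ^ w) :
    64 ≤ w ∧ K < 2 ^ w ∧ 2 ^ 64 ≤ 2 ^ (w - 1) ∧ 2 * 2 ^ (w - 1) = 2 ^ w ∧
      n ^ d + n + 2000 ≤ 2 ^ (w - 1) := by
  have h₁ : 2 ^ (d + K + 100) ≤ 2 ^ w := (Nat.pow_le_pow_left hn _).trans h
  have h₂ : d + K + 100 ≤ w := (Nat.pow_le_pow_iff_right (by norm_num)).1 h₁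
  have h₃ : K < 2 ^ w := by
    calc K < 2 ^ K := Nat.lt_two_pow_self
      _ ≤ 2 ^ w := Nat.pow_le_pow_right (by norm_num) (by omega)
  obtain ⟨k, rfl⟩ : ∃ k, w = k + 1 := ⟨w - 1, by omega⟩
  have h₄ : 2 ^ (k + 1) = 2 * 2 ^ k := by ring
  refine ⟨by omega, h₃, Nat.pow_le_pow_right (by norm_num) (by omega), by simpa using h₄.symm, ?_⟩
  have h₅ : 2 ^ 99 ≤ n ^ 99 := Nat.pow_le_pow_left hn _
  have h₆ : n ^ d * n * 2 ^ 99 ≤ n ^ (d + K + 100) := by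
    calc n ^ d * n * 2 ^ 99 ≤ n ^ d * n * n ^ 99 := Nat.mul_le_mul_left _ h₅
      _ = n ^ (d + 100) := by ring
      _ ≤ _ := Nat.pow_le_pow_right (by omega) (by omega)
  have h₇ : 1 ≤ n ^ d := Nat.one_le_pow _ _ (by omega)
  have h₈ : n ^ d ≤ n ^ d * n := Nat.le_mul_of_pos_right _ (by omega)
  have h₉ : n ≤ n ^ d * n := Nat.le_mul_of_pos_left _ (by omega)
  simp only [Nat.add_sub_cancel]
  omega

theorem IsRealVerifier.inExistsR {Q : DecisionProblem} {P : Program} {c : ℕ}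
    (h : IsRealVerifier Q P c) (hc : 1 ≤ c) : InExistsR Q := by
  obtain ⟨K, hK⟩ := exists_goodWords (reduction P c)
  obtain ⟨d, hd⟩ : ∃ d, d = (verifierScheme P c).deg := ⟨_, rfl⟩
  refine ⟨reduction P c, d + K + 100, by omega, reduction_isWord P c, fun I => ?_⟩
  obtain ⟨n, hn⟩ : ∃ n, n = (encode I).length := ⟨_, rfl⟩
  have hn2 : 2 ≤ n := hn ▸ two_le_length_encode I
  obtain ⟨g, hg⟩ : ∃ g : ℕ → ℕ, g = fun j => (encode I).getD j 0 := ⟨_, rfl⟩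
  have hbits : ∀ j, g j = 0 ∨ g j = 1 := fun j => by
    rw [hg]; exact getD_bits encode_bits j
  obtain ⟨k, hk, hpos, hzero⟩ := encode_pairs I
  rw [← hn] at hk ⊢
  obtain ⟨w, hw⟩ : ∃ w, w = wordSize (d + K + 100) n := ⟨_, rfl⟩
  rw [← hw]
  obtain ⟨hw64, hKw, hB64, hBw, hB⟩ := reduction_size_bounds (d := d) (K := K) hn2
    (hw ▸ le_two_pow_wordSize (d + K + 100) n)
  have hP := hK w hKw
  obtain ⟨B, hBdef⟩ : ∃ B, B = 2 ^ (w - 1) := ⟨_, rfl⟩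
  rw [← hBdef] at hB64 hBw hB
  have hcode : CodeAt (reduction P c) 0 (packCode 63 ++ (halfCode ++ ((reductionCmd P c).code 132 ++
    (constsCode padSymbol 64 ++ [.halt])))) := ⟨[], [], by simp [reduction], rfl⟩
  -- Straight-line prologue.
  have r₁ := run_packCode hP hbits (k := 63) (by omega) hcode.left (s := init [] (encode I)) rfl
    (fun i => by rw [hg]; rfl)
  have c₁ := hcode.right
  rw [length_packCode] at c₁
  obtain ⟨W, r₂, hW31, hW⟩ := run_halfCode hP (by omega) c₁.left
    (s := { pc := 0 + 2 * 63, W := Function.update (init [] (encode I)).W 0 (packed g (63 + 1)),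
            R := (init [] (encode I)).R }) rfl
  have c₂ := c₁.right
  -- The structured program.
  let σ : Store := ⟨W, W, (init [] (encode I)).R, (init [] (encode I)).R⟩
  have hV : ∀ i < 1, (fun _ => n) i ≤ n := fun i _ => le_rfl
  obtain ⟨φ, hφ⟩ : ∃ φ, φ = (verifierScheme P c).toFormula g 1 (fun _ => n) := ⟨_, rfl⟩
  have hlen : φ.code.length ≤ n ^ d := by
    rw [hφ, hd]
    exact FormulaScheme.length_le hn2 (verifierScheme_wf P c) hV
  have hE : Cmd.Ends w (reductionCmd P c) (n * 100 + 2100 + n ^ d)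
      (fun σ' => ∀ i, (hi : i < φ.code.length) → σ'.M (64 + i) = φ.code[i]) σ := by
    refine Cmd.Ends.mono
      ((relocate_spec (B := B) (g := g) (k := k) (by omega) (by omega) hbits hk
        (hg ▸ hpos) (hg ▸ hzero) (σ := σ) (by simpa [σ, hBdef] using hW31)
        (fun a ha => ?_)).seq' fun σ₁ h₁ =>
      (unpack_spec (B := B) (g := g) (by omega) hB64 hbits
        (h₁.1.trans ?_) h₁.2.1 h₁.2.2).seq' fun σ₂ h₂ =>
      (measure_spec (n := n) (B := B) (g := g) (k := k) (by omega) (by omega) hbits hk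
        (hg ▸ hpos) (hg ▸ hzero) h₂.1 h₂.2).seq' fun σ₃ h₃ =>
      (FormulaScheme.gen_spec (inp := g) (V := fun _ => n) hn2 (by norm_num) (verifierScheme_wf P c)
        hV hbits (fun i hi => ?_) ⟨?_, ?_, ?_⟩ ?_).mono (T' := n ^ d) (Q' := fun σ' =>
          ∀ i, (hi : i < φ.code.length) → σ'.M (64 + i) = φ.code[i]) ?_
          fun σ' he i hi => ?_) ?_ fun _ h => h
    · simp only [σ]
      rw [hW a (by omega) (by omega)]
      change Function.update (init [] (encode I)).W 0 _ a = g a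
      rw [Function.update_of_ne (by omega), hg]
      rfl
    · simp only [σ]
      rw [hW 0 (by norm_num) (by norm_num)]
      exact Function.update_self (f := (init [] (encode I)).W) 0 _
    · obtain rfl : i = 0 := by omega
      exact h₃.1
    · rw [h₃.2.1]
    · rw [h₃.2.1, h₃.2.2.1, ← hφ]; omega
    · rw [h₃.2.2.1]; exact h₃.2.2.2
    · rw [h₃.2.2.1, ← hd]; omega
    · rw [← hd]
    · subst hφ
      rw [he.mem, h₃.2.1, splice_get _ _ _ _ hi]
    · omega
  obtain ⟨σ', t, ht, hbig, hσ'⟩ := hE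
  obtain ⟨s', r₃, hpc, hrel⟩ := hbig.run_code hP (reductionCmd_wf P c) (off := 132) c₂.left
    (s := { pc := 0 + 2 * 63 + 6, W := W, R := (init [] (encode I)).R }) rfl
    ⟨fun _ _ => rfl, fun _ _ => rfl, fun _ _ => rfl, fun _ _ => rfl⟩
  have c₃ := c₂.right
  rw [Cmd.length_code] at c₃
  have r₄ := run_constsCode hP c₃.left hpc
  have c₄ := c₃.right
  -- The first `64` registers are overwritten by padding.
  refine ⟨φ.pad 16, ?_, _, ?_, _, ⟨run_trans r₁ (run_trans r₂ (run_trans r₃ r₄)), ?_⟩, ?_, ?_⟩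
  · rw [Formula.etrTrue_pad, hφ, hg]
    exact verifierScheme_etrTrue_iff h hc I hn
  · refine le_trans ?_ (Nat.pow_le_pow_right (by omega : 1 ≤ n)
      (show d + 100 ≤ d + K + 100 by omega))
    have h₁ : 2 ^ 99 ≤ n ^ 99 := Nat.pow_le_pow_left hn2 _
    have h₂ : n ^ (d + 100) = n ^ d * n * n ^ 99 := by ring
    have h₃ : n ^ d * n * 2 ^ 99 ≤ n ^ d * n * n ^ 99 := Nat.mul_le_mul_left _ h₁
    have h₄ : 1 ≤ n ^ d := Nat.one_le_pow _ _ (by omega)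
    have h₅ : n ^ d ≤ n ^ d * n := Nat.le_mul_of_pos_right _ (by omega)
    have h₆ : n ≤ n ^ d * n := Nat.le_mul_of_pos_left _ (by omega)
    omega
  · exact c₄.head
  · rw [Formula.code_pad]
    simp only [List.length_append, List.length_map, List.length_range]
    omega
  · intro i hi
    simp only [Formula.code_pad, List.length_append, List.length_map, List.length_range] at hi
    simp only [Formula.code_pad]
    by_cases hi' : i < 64
    · rw [List.getElem_append_left (by simpa using hi')]
      simp [hi']
    · rw [List.getElem_append_right (by simpa using hi'), if_neg hi', hrel.M i (by omega)]
      obtain ⟨j, rfl⟩ : ∃ j, i = 64 + j := ⟨i - 64, by omega⟩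
      rw [hσ' j (by omega)]
      simp

/-! ### Reading an instance -/

/-- The words `b` with all nonzero words replaced by `1`. A verification algorithm has to halt on
all inputs, also on those that do not start with the code of an instance. -/
def bitOf (b : ℕ → ℕ) (p : ℕ) : ℕ := if b p = 0 then 0 else 1

theorem bitOf_le (b : ℕ → ℕ) (p : ℕ) : bitOf b p ≤ 1 := by
  unfold bitOf; split <;> omega

/-- Read the input word number `e` as a bit. The words with numbers below `64` have been saved in
the real memory, since their registers are variables and scratch space. Arbitrary words, unlike
bits, cannot be packed into one register. -/
def readBit (v : ℕ) (e : WExpr) : Cmd :=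
  .seq (.ite (.lt e (.const 64)) (.rload 0 (.op .add (.const 4) e)) (.rword 0 e))
    (.ite (.rzero 0) (.assign v (.const 0)) (.assign v (.const 1)))

/-- The input `b` is in its place, and the part of the memory from address `B` on is free. -/
structure HasInput (b : ℕ → ℕ) (B : ℕ) (σ : Store) : Prop where
  low : ∀ p < 64, σ.S (4 + p) = b p
  high : ∀ p, 64 ≤ p → p < B → σ.M p = b p

theorem readBit_spec {w v B : ℕ} {b : ℕ → ℕ} {e : WExpr} {σ : Store} (h : HasInput b B σ)
    (he : e.Ok w σ.V) (hB : e.eval σ.V < B) (hw : e.eval σ.V + 100 < 2 ^ w) :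
    Cmd.Ends w (readBit v e) (3 * e.len + 20) (fun σ' => σ' = ⟨Function.update σ.V v
      (bitOf b (e.eval σ.V)), σ.M, Function.update σ.R 0 (b (e.eval σ.V) : ℝ), σ.S⟩) σ := by
  refine (Cmd.Ends.of_wp ?_).mono ?_ fun _ h => h
  · have key : (b (e.eval σ.V) = 0 → bitOf b (e.eval σ.V) = 0) ∧
        (¬ b (e.eval σ.V) = 0 → bitOf b (e.eval σ.V) = 1) := by
      unfold bitOf
      exact ⟨fun h => if_pos h, fun h => if_neg h⟩
    simp only [readBit, Cmd.wp, Test.Ok, Test.Holds, WExpr.Ok, WExpr.eval, BinOp.eval]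
    refine ⟨⟨he, by omega⟩, fun h' => ⟨⟨by omega, he, by omega⟩, by omega, trivial, ?_⟩,
      fun h' => ⟨he, by omega, trivial, ?_⟩⟩
    · rw [h.low _ h']
      simp only [Function.update_self, Nat.cast_eq_zero]
      exact ⟨fun h₀ => ⟨by omega, by rw [key.1 h₀]⟩, fun h₀ => ⟨by omega, by rw [key.2 h₀]⟩⟩
    · rw [h.high _ (by omega) hB]
      simp only [Function.update_self, Nat.cast_eq_zero]
      exact ⟨fun h₀ => ⟨by omega, by rw [key.1 h₀]⟩, fun h₀ => ⟨by omega, by rw [key.2 h₀]⟩⟩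
  · simp only [readBit, Cmd.cost, Cmd.size, Test.len, WExpr.len, BinOp.code, List.length_cons,
      List.length_nil]
    omega

/-- Read the pair of input words that starts at the position in variable `2`. -/
def readPair : Cmd := .seq (readBit 3 (.var 2)) (readBit 4 (.op .add (.var 2) (.const 1)))

theorem readPair_spec {w B p : ℕ} {b : ℕ → ℕ} {σ : Store} (h : HasInput b B σ)
    (hp : σ.V 2 = p) (hB : p + 1 < B) (hw : p + 200 < 2 ^ w) :
    Cmd.Ends w readPair 60 (fun σ' => σ'.V 31 = σ.V 31 ∧ σ'.V 2 = p ∧ σ'.V 3 = bitOf b p ∧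
      σ'.V 4 = bitOf b (p + 1) ∧ σ'.M = σ.M ∧ σ'.S = σ.S) σ := by
  subst hp
  refine ((readBit_spec h (by simp only [WExpr.Ok]; omega) (by simp only [WExpr.eval]; omega)
    (by simp only [WExpr.eval]; omega)).seq' fun σ₁ h₁ =>
    (readBit_spec (b := b) (B := B) ?_ ?_ ?_ ?_).mono le_rfl fun σ₂ h₂ => ?_).mono
      (T' := 60) ?_ fun _ h => h
  all_goals try subst h₁
  · exact ⟨h.low, h.high⟩
  · simp [WExpr.Ok, WExpr.eval, BinOp.eval]; omega
  · simp [WExpr.eval, BinOp.eval]; omega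
  · simp [WExpr.eval, BinOp.eval]; omega
  · subst h₂
    simp [WExpr.eval, BinOp.eval]
  · simp [WExpr.len, BinOp.code]

/-- Copy a pair to the free memory, and read the next one. -/
def parseBody : Cmd :=
  .seq (.seq (.store (.op .add (.var 31) (.var 2)) (.var 3))
    (.seq (.store (.op .add (.op .add (.var 31) (.var 2)) (.const 1)) (.var 4))
      (.assign 2 (.op .add (.var 2) (.const 2))))) readPair

/-- Copy the instance to the free memory, and compute its size. -/
def parse : Cmd :=
  .seq (.seq (.assign 2 (.const 0)) readPair)
  (.seq (.loop (.lt (.const 0) (.op .add (.var 3) (.var 4))) parseBody)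
  (.assign 0 (.op .add (.var 2) (.const 2))))

theorem parse_spec {w B k : ℕ} {b : ℕ → ℕ} {σ : Store} (h : HasInput b B σ)
    (h31 : σ.V 31 = B) (hfree : ∀ i, σ.M (B + i) = 0) (hB : 2 * k + 200 ≤ B) (hw : 2 * B ≤ 2 ^ w)
    (hpos : ∀ j < k, 0 < bitOf b (2 * j) + bitOf b (2 * j + 1))
    (hend : bitOf b (2 * k) + bitOf b (2 * k + 1) = 0) :
    Cmd.Ends w parse (k * 100 + 100) (fun σ' => σ'.V 0 = 2 * k + 2 ∧ σ'.V 31 = B ∧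
      (∀ i, σ'.M (B + i) = if i < 2 * k then bitOf b i else 0) ∧ σ'.S = σ.S) σ := by
  let I : ℕ → Store → Prop := fun j τ => τ.V 31 = B ∧ τ.V 2 = 2 * j ∧ τ.V 3 = bitOf b (2 * j) ∧
    τ.V 4 = bitOf b (2 * j + 1) ∧ (∀ a, 64 ≤ a → a < B → τ.M a = b a) ∧
    (∀ i, τ.M (B + i) = if i < 2 * j then bitOf b i else 0) ∧ τ.S = σ.S
  have h₁ : Cmd.Ends w (.seq (.assign 2 (.const 0)) readPair) 62 (I 0) σ := by
    refine ((Cmd.Ends.of_wp (Q := fun τ => τ = ⟨Function.update σ.V 2 0, σ.M, σ.R, σ.S⟩) ?_).seq'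
      fun σ₁ e₁ => (readPair_spec (p := 0) (b := b) (B := B) ?_ ?_ ?_ ?_).mono le_rfl
        fun σ₂ e₂ => ?_).mono (T' := 62) ?_ fun _ h => h
    all_goals try subst e₁
    · simp only [Cmd.wp, WExpr.Ok, WExpr.eval, and_true]; omega
    · exact ⟨h.low, h.high⟩
    · simp
    · omega
    · omega
    · obtain ⟨e31, e2, e3, e4, eM, eS⟩ := e₂
      refine ⟨by simpa [h31] using e31, e2, e3, e4, fun a ha ha' => ?_, fun i => ?_, eS⟩
      · rw [eM]; exact h.high a ha ha'
      · rw [eM, if_neg (by omega)]; exact hfree i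
    · simp [Cmd.cost, Cmd.size, WExpr.len]
  have h₂ : ∀ j < k, ∀ τ, I j τ → Cmd.Ends w parseBody 90 (I (j + 1)) τ := by
    rintro j hj τ ⟨e31, e2, e3, e4, eM, e, eS⟩
    have b₁ := bitOf_le b (2 * j)
    have b₂ := bitOf_le b (2 * j + 1)
    refine ((Cmd.Ends.of_wp (Q := fun τ' => τ' = ⟨Function.update τ.V 2 (2 * j + 2),
      Function.update (Function.update τ.M (B + 2 * j) (bitOf b (2 * j))) (B + 2 * j + 1)
        (bitOf b (2 * j + 1)), τ.R, τ.S⟩) ?_).seq'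
      fun σ₁ e₁ => (readPair_spec (p := 2 * j + 2) (b := b) (B := B) ?_ ?_ ?_ ?_).mono le_rfl
        fun σ₂ e₂ => ?_).mono (T' := 90) ?_ fun _ h => h
    all_goals try subst e₁
    · simp only [Cmd.wp, WExpr.Ok, WExpr.eval, BinOp.eval, e31, e2, e3, e4, and_true]
      and_intros
      all_goals omega
    · refine ⟨fun p hp => ?_, fun p hp hp' => ?_⟩
      · simp only [eS]; exact h.low p hp
      · simp only
        rw [Function.update_of_ne (by omega), Function.update_of_ne (by omega), eM p hp hp']
    · simp
    · omega
    · omega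
    · obtain ⟨f31, f2, f3, f4, fM, fS⟩ := e₂
      refine ⟨by simpa [e31] using f31, f2, f3, f4, fun a ha ha' => ?_, fun i => ?_, fS.trans eS⟩
      · rw [fM]
        simp only
        rw [Function.update_of_ne (by omega), Function.update_of_ne (by omega), eM a ha ha']
      · rw [fM]
        simp only [Function.update_apply]
        by_cases c1 : i = 2 * j + 1
        · subst c1
          rw [if_pos (by omega), if_pos (by omega)]
        · rw [if_neg (by omega)]
          by_cases c2 : i = 2 * j
          · subst c2
            rw [if_pos (by omega), if_pos (by omega)]
          · rw [if_neg (by omega), e i]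
            by_cases c3 : i < 2 * j
            · rw [if_pos c3, if_pos (by omega)]
            · rw [if_neg c3, if_neg (by omega)]
    · simp [Cmd.cost, Cmd.size, WExpr.len, BinOp.code]
  refine (h₁.seq' fun σ₁ hσ₁ => (Cmd.Ends.loop (m := k) (T := 90) I
    (fun j hj τ hτ => ⟨?_, ?_, h₂ j hj τ hτ⟩) (fun τ hτ => ?_) hσ₁).seq' fun σ₂ hσ₂ =>
    Cmd.Ends.of_wp (Q := fun σ' => σ'.V 0 = 2 * k + 2 ∧ σ'.V 31 = B ∧
      (∀ i, σ'.M (B + i) = if i < 2 * k then bitOf b i else 0) ∧ σ'.S = σ.S) ?_).mono ?_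
        fun _ h => h
  · obtain ⟨-, -, e3, e4, -⟩ := hτ
    have b₁ := bitOf_le b (2 * j)
    have b₂ := bitOf_le b (2 * j + 1)
    simp only [Test.Ok, WExpr.Ok, WExpr.eval, BinOp.eval, e3, e4]
    omega
  · obtain ⟨-, -, e3, e4, -⟩ := hτ
    simp only [Test.Holds, WExpr.eval, BinOp.eval, e3, e4]
    exact hpos j hj
  · obtain ⟨-, -, e3, e4, -⟩ := hτ
    simp only [Test.Ok, Test.Holds, WExpr.Ok, WExpr.eval, BinOp.eval, e3, e4]
    omega
  · obtain ⟨e31, e2, -, -, -, e, eS⟩ := hσ₂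
    simp only [Cmd.wp, WExpr.Ok, WExpr.eval, BinOp.eval, e2]
    refine ⟨by omega, by simp, by simpa using e31, by simpa using e, eS⟩
  · simp [Cmd.cost, Cmd.size, Test.len, WExpr.len, BinOp.code]
    omega

/-- Compute the number of memory words of the word RAM with size parameter `c` in variable `7`, and
its predecessor in variable `9`. Variable `6` is the time bound `n ^ c`. -/
def sizes (c : ℕ) : Cmd :=
  .seq (.seq (.assign 6 (powExpr (.var 0) c)) (.assign 7 (.const 1)))
  (.seq (.loop (.lt (.var 7) (.var 6)) (.assign 7 (.op .add (.var 7) (.var 7))))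
  (.sub 9 (.var 7) (.const 1)))

theorem powExpr_ok {w n c : ℕ} {V : ℕ → ℕ} (hn : V 0 = n) (hn1 : 1 ≤ n)
    (h : n ^ c + n + 2 < 2 ^ w) :
    (powExpr (.var 0) c).Ok w V := by
  induction c with
  | zero => simp only [powExpr, WExpr.Ok]; omega
  | succ c ih =>
    have : n ^ c ≤ n ^ (c + 1) := Nat.pow_le_pow_right hn1 (by omega)
    refine ⟨ih (by omega), ?_, ?_⟩
    · simp only [WExpr.Ok]; omega
    · simp only [eval_powExpr, BinOp.eval, WExpr.eval, hn, ← pow_succ]; omega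

theorem sizes_spec {w n c : ℕ} {σ : Store} (hn : σ.V 0 = n) (hn2 : 2 ≤ n)
    (h : 4 * n ^ c + n + 10 < 2 ^ w) :
    Cmd.Ends w (sizes c) (10 * n ^ c + (powExpr (.var 0) c).len + 20) (fun σ' =>
      σ'.V 6 = n ^ c ∧ σ'.V 7 = 2 ^ wordSize c n ∧ σ'.V 9 + 1 = 2 ^ wordSize c n ∧
      σ'.V 31 = σ.V 31 ∧ σ'.M = σ.M ∧ σ'.S = σ.S) σ := by
  have hlt := two_pow_wordSize_lt (c := c) hn2
  have hle : wordSize c n ≤ n ^ c := by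
    rcases Nat.eq_zero_or_pos (wordSize c n) with h0 | h0
    · omega
    have h1 : 2 ^ (wordSize c n - 1) < n ^ c :=
      Nat.pow_lt_of_lt_clog (by unfold wordSize at *; omega)
    have h2 : wordSize c n - 1 < 2 ^ (wordSize c n - 1) := Nat.lt_two_pow_self
    omega
  let I : ℕ → Store → Prop := fun j τ => τ.V 6 = n ^ c ∧ τ.V 7 = 2 ^ j ∧ τ.V 31 = σ.V 31 ∧
    τ.M = σ.M ∧ τ.S = σ.S
  have hmono : ∀ j ≤ wordSize c n, 2 ^ j ≤ 2 ^ wordSize c n := fun j hj =>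
    Nat.pow_le_pow_right (by norm_num) hj
  refine ((Cmd.Ends.of_wp (Q := I 0) ?_).seq' fun σ₁ hσ₁ => (Cmd.Ends.loop (m := wordSize c n)
    (T := Cmd.cost (.assign 7 (.op .add (.var 7) (.var 7)))) I
    (fun j hj τ hτ => ⟨?_, ?_, Cmd.Ends.of_wp ?_⟩) (fun τ hτ => ?_) hσ₁).seq' fun σ₂ hσ₂ =>
    Cmd.Ends.of_wp (Q := fun σ' =>
      σ'.V 6 = n ^ c ∧ σ'.V 7 = 2 ^ wordSize c n ∧ σ'.V 9 + 1 = 2 ^ wordSize c n ∧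
      σ'.V 31 = σ.V 31 ∧ σ'.M = σ.M ∧ σ'.S = σ.S) ?_).mono ?_ fun _ h => h
  · have := powExpr_ok (c := c) hn (by omega) (by omega : n ^ c + n + 2 < 2 ^ w)
    simp only [Cmd.wp, this, WExpr.Ok, eval_powExpr, WExpr.eval, I, hn]
    refine ⟨trivial, by omega, ?_⟩
    simp
  · obtain ⟨e6, e7, -⟩ := hτ
    have := hmono j hj.le
    simp only [Test.Ok, WExpr.Ok, e6, e7]
    omega
  · obtain ⟨e6, e7, -⟩ := hτ
    simp only [Test.Holds, WExpr.eval, e6, e7]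
    exact Nat.pow_lt_of_lt_clog hj
  · obtain ⟨e6, e7, e31, eM, eS⟩ := hτ
    have := hmono (j + 1) hj
    rw [pow_succ] at this
    simp only [Cmd.wp, WExpr.Ok, WExpr.eval, BinOp.eval, e7, I]
    refine ⟨by omega, ?_, ?_, ?_, eM, eS⟩
    · simpa using e6
    · simp; ring
    · simpa using e31
  · obtain ⟨e6, e7, -⟩ := hτ
    have := le_two_pow_wordSize c n
    simp only [Test.Ok, Test.Holds, WExpr.Ok, WExpr.eval, e6, e7]
    omega
  · obtain ⟨e6, e7, e31, eM, eS⟩ := hσ₂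
    have : 0 < 2 ^ wordSize c n := by positivity
    simp only [Cmd.wp, WExpr.Ok, WExpr.eval, e7]
    refine ⟨by omega, by omega, by omega, by simpa using e6, by simpa using e7, ?_,
      by simpa using e31, eM, eS⟩
    simp only [Function.update_self]
    omega
  · simp only [Cmd.cost, Cmd.size, Test.len, WExpr.len, BinOp.code, List.length_cons,
      List.length_nil]
    omega

/-! ### Simulation of the word RAM -/

/-- Address of a simulated register. -/
def simAddr (e : WExpr) : WExpr := .op .add (.var 31) e

/-- Replace variable `10` by the result of an operation on the variables `10` and `11`. Variable `7`
is the number of words of the simulated machine, and variable `9` is its predecessor. -/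
def simOp : WordOp → Cmd
  | .add => .assign 10 (.op .modS (.op .add (.var 10) (.var 11)) (.var 9))
  | .sub => .seq (.sub 10 (.op .add (.var 10) (.var 7)) (.var 11))
      (.assign 10 (.op .modS (.var 10) (.var 9)))
  | .mulLow => .assign 10 (.op .modS (.op .mul (.var 10) (.var 11)) (.var 9))
  | .mulHigh => .assign 10 (.op .divS (.op .mul (.var 10) (.var 11)) (.var 9))
  | .div => .seq (.sub 11 (.var 11) (.const 1)) (.assign 10 (.op .divS (.var 10) (.var 11)))
  | .mod => .seq (.sub 11 (.var 11) (.const 1)) (.assign 10 (.op .modS (.var 10) (.var 11)))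
  | .nand => .sub 10 (.var 7) (.op .add (.op .land (.var 10) (.var 11)) (.const 1))

/-- The operation is defined. -/
def simGuard : WordOp → Test
  | .div | .mod => .lt (.const 0) (.var 11)
  | _ => .lt (.const 0) (.const 1)

/-- Execute the instruction with index `l`. Stopping instructions and undefined operations change
nothing. Variable `8` is the simulated program counter. -/
def simInstr (l : ℕ) : Instr → Cmd
  | .wConst i j => .seq (.store (simAddr (.const i)) (.const j)) (.assign 8 (.const (l + 1)))
  | .wCopy i j => .seq (.load 10 (simAddr (.const j))) (.seq (.store (simAddr (.const i)) (.var 10))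
      (.assign 8 (.const (l + 1))))
  | .wStore i j => .seq (.load 11 (simAddr (.const i))) (.seq (.load 10 (simAddr (.const j)))
      (.seq (.store (simAddr (.var 11)) (.var 10)) (.assign 8 (.const (l + 1)))))
  | .wLoad i j => .seq (.load 11 (simAddr (.const j))) (.seq (.load 10 (simAddr (.var 11)))
      (.seq (.store (simAddr (.const i)) (.var 10)) (.assign 8 (.const (l + 1)))))
  | .wArith o i j k => .seq (.load 10 (simAddr (.const j))) (.seq (.load 11 (simAddr (.const k)))
      (.ite (simGuard o) (.seq (simOp o) (.seq (.store (simAddr (.const i)) (.var 10))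
        (.assign 8 (.const (l + 1))))) .skip))
  | .wIfEq i j l' => .seq (.load 10 (simAddr (.const i))) (.seq (.load 11 (simAddr (.const j)))
      (.ite (.eq (.var 10) (.var 11)) (.assign 8 (.const l')) (.assign 8 (.const (l + 1)))))
  | .wIfLt i j l' => .seq (.load 10 (simAddr (.const i))) (.seq (.load 11 (simAddr (.const j)))
      (.ite (.lt (.var 10) (.var 11)) (.assign 8 (.const l')) (.assign 8 (.const (l + 1)))))
  | .goto l' => .assign 8 (.const l')
  | _ => .skip

/-- The greatest constant word of an instruction. -/
def Instr.maxWord (ins : Instr) : ℕ := ins.words.foldr max 0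

/-- Execute the instruction with the index in variable `8`, if there is one. Instructions with
constants that are not words do nothing. -/
def dispatch : ℕ → Program → Cmd
  | _, [] => .skip
  | k, ins :: P => .ite (.eq (.var 8) (.const k))
      (.ite (.lt (.const ins.maxWord) (.var 7)) (simInstr k ins) .skip) (dispatch (k + 1) P)

/-- Simulate the number of steps in variable `6`. A configuration in which the simulated machine has
stopped or is stuck does not change any more. -/
def simulate (P : Program) : Cmd :=
  .seq (.assign 8 (.const 0)) (.loop (.lt (.const 0) (.var 6))
    (.seq (.sub 6 (.var 6) (.const 1)) (dispatch 0 P)))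

/-- The target of a jump instruction, and `0` for other instructions. -/
def Instr.target : Instr → ℕ
  | .wIfEq _ _ l | .wIfLt _ _ l | .rIfZero _ l | .rIfPos _ l | .goto l => l
  | _ => 0

theorem Instr.maxWord_lt_iff {ins : Instr} {m : ℕ} (hm : 0 < m) :
    ins.maxWord < m ↔ ∀ a ∈ ins.words, a < m := by
  unfold maxWord
  induction ins.words with
  | nil => simpa using hm
  | cons a L ih => simp [ih]

/-- All numbers that occur in the program are at most `K`. -/
structure Program.BoundedBy (P : Program) (K : ℕ) : Prop where
  length : P.length ≤ K
  target : ∀ ins ∈ P, ins.target ≤ K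
  words : ∀ ins ∈ P, ∀ a ∈ ins.words, a ≤ K

theorem Program.exists_boundedBy (P : Program) : ∃ K, BoundedBy P K := by
  refine ⟨P.length + (P.map Instr.target).sum + (P.flatMap Instr.words).sum, ⟨by omega, ?_, ?_⟩⟩
  · intro ins h
    have := List.le_sum_of_mem (List.mem_map_of_mem (f := Instr.target) h)
    omega
  · intro ins h a ha
    have := List.le_sum_of_mem (List.mem_flatMap.2 ⟨ins, h, ha⟩)
    omega

/-- The store `σ` represents the configuration `s` of a word RAM at word size `w`, with its memory
from address `B` on; `T` more steps have to be simulated. -/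
structure Sim (w B T : ℕ) (S : ℕ → ℝ) (s : Config) (σ : Store) : Prop where
  clock : σ.V 6 = T
  size : σ.V 7 = 2 ^ w
  pred : σ.V 9 + 1 = 2 ^ w
  pc : σ.V 8 = s.pc
  base : σ.V 31 = B
  mem : ∀ a < 2 ^ w, σ.M (B + a) = s.W a
  real : σ.S = S

section Sim

variable {w w' B T K : ℕ} {S : ℕ → ℝ} {s : Config} {σ : Store}

theorem Sim.setW (h : Sim w B T S s σ) {V : ℕ → ℕ} {M : ℕ → ℕ} {R : ℕ → ℝ} {i x : ℕ}
    (h6 : V 6 = σ.V 6) (h7 : V 7 = σ.V 7) (h9 : V 9 = σ.V 9) (h31 : V 31 = σ.V 31)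
    (h8 : V 8 = s.pc + 1) (hM : M = Function.update σ.M (B + i) x) :
    Sim w B T S (s.setW i x) ⟨V, M, R, σ.S⟩ where
  clock := h6.trans h.clock
  size := h7.trans h.size
  pred := by simp only [h9, h.pred]
  pc := h8
  base := h31.trans h.base
  mem a ha := by
    simp only [hM, Config.setW, Function.update_apply, Nat.add_left_cancel_iff, h.mem a ha]
  real := h.real

theorem Sim.jump (h : Sim w B T S s σ) {V : ℕ → ℕ} {R : ℕ → ℝ} {l : ℕ}
    (h6 : V 6 = σ.V 6) (h7 : V 7 = σ.V 7) (h9 : V 9 = σ.V 9) (h31 : V 31 = σ.V 31)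
    (h8 : V 8 = l) : Sim w B T S (s.jump l) ⟨V, σ.M, R, σ.S⟩ where
  clock := h6.trans h.clock
  size := h7.trans h.size
  pred := by simp only [h9, h.pred]
  pc := h8
  base := h31.trans h.base
  mem := h.mem
  real := h.real

theorem simOp_wp {o : WordOp} {y z x : ℕ} {Q : Store → Prop} (h7 : σ.V 7 = 2 ^ w)
    (h9 : σ.V 9 + 1 = 2 ^ w) (hy : σ.V 10 = y) (hz : σ.V 11 = z) (hy' : y < 2 ^ w) (hz' : z < 2 ^ w)
    (hw : 2 ^ w * 2 ^ w + 2 * 2 ^ w + 2 < 2 ^ w') (ho : o.eval w y z = some x)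
    (hQ : ∀ V, V 10 = x → (∀ i, i ≠ 10 → i ≠ 11 → V i = σ.V i) → Q ⟨V, σ.M, σ.R, σ.S⟩) :
    (simGuard o).Ok w' σ.V ∧ (simGuard o).Holds σ ∧ (simOp o).wp w' Q σ := by
  have hpos : 0 < 2 ^ w := by positivity
  have hyz : y * z ≤ 2 ^ w * 2 ^ w := Nat.mul_le_mul hy'.le hz'.le
  have hmod : ∀ a, a % 2 ^ w < 2 ^ w := fun a => Nat.mod_lt _ hpos
  cases o with
  | add =>
    obtain rfl := Option.some.inj ho
    have := hmod (y + z)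
    refine ⟨⟨?_, ?_⟩, ?_, ?_⟩
    · simp only [WExpr.Ok]; omega
    · simp only [WExpr.Ok]; omega
    · simp [simGuard, Test.Holds, WExpr.eval]
    · simp only [simOp, Cmd.wp, WExpr.Ok, WExpr.eval, BinOp.eval, hy, hz, h9]
      refine ⟨⟨⟨by omega, by omega, by omega⟩, by omega, by omega⟩, hQ _ (by simp) fun i h₁ _ => ?_⟩
      simp [h₁]
  | sub =>
    obtain rfl := Option.some.inj ho
    have := hmod (y + 2 ^ w - z)
    refine ⟨⟨?_, ?_⟩, ?_, ?_⟩
    · simp only [WExpr.Ok]; omega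
    · simp only [WExpr.Ok]; omega
    · simp [simGuard, Test.Holds, WExpr.eval]
    · simp only [simOp, Cmd.wp, WExpr.Ok, WExpr.eval, BinOp.eval, hy, hz, h7, h9,
        Function.update_self, ne_eq, Nat.reduceEqDiff, not_false_eq_true, Function.update_of_ne]
      refine ⟨⟨by omega, by omega, by omega⟩, by omega, by omega, ⟨by omega, by omega, by omega⟩,
        hQ _ (by simp) fun i h₁ _ => ?_⟩
      simp [h₁]
  | mulLow =>
    obtain rfl := Option.some.inj ho
    have := hmod (y * z)
    refine ⟨⟨?_, ?_⟩, ?_, ?_⟩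
    · simp only [WExpr.Ok]; omega
    · simp only [WExpr.Ok]; omega
    · simp [simGuard, Test.Holds, WExpr.eval]
    · simp only [simOp, Cmd.wp, WExpr.Ok, WExpr.eval, BinOp.eval, hy, hz, h9]
      refine ⟨⟨⟨by omega, by omega, by omega⟩, by omega, by omega⟩, hQ _ (by simp) fun i h₁ _ => ?_⟩
      simp [h₁]
  | mulHigh =>
    obtain rfl := Option.some.inj ho
    have := Nat.div_le_self (y * z) (2 ^ w)
    refine ⟨⟨?_, ?_⟩, ?_, ?_⟩
    · simp only [WExpr.Ok]; omega
    · simp only [WExpr.Ok]; omega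
    · simp [simGuard, Test.Holds, WExpr.eval]
    · simp only [simOp, Cmd.wp, WExpr.Ok, WExpr.eval, BinOp.eval, hy, hz, h9]
      refine ⟨⟨⟨by omega, by omega, by omega⟩, by omega, by omega⟩, hQ _ (by simp) fun i h₁ _ => ?_⟩
      simp [h₁]
  | div =>
    simp only [WordOp.eval] at ho
    split at ho
    · cases ho
    obtain rfl := Option.some.inj ho
    have := Nat.div_le_self y z
    refine ⟨⟨?_, ?_⟩, ?_, ?_⟩
    · simp only [WExpr.Ok]; omega
    · simp only [WExpr.Ok]; omega
    · simp only [simGuard, Test.Holds, WExpr.eval]; omega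
    · simp only [simOp, Cmd.wp, WExpr.Ok, WExpr.eval, BinOp.eval, hy, hz,
        Function.update_self, ne_eq, Nat.reduceEqDiff, not_false_eq_true, Function.update_of_ne]
      rw [show z - 1 + 1 = z by omega]
      refine ⟨by omega, by omega, by omega, ⟨by omega, by omega, by omega⟩,
        hQ _ (by simp) fun i h₁ h₂ => ?_⟩
      simp [h₁, h₂]
  | mod =>
    simp only [WordOp.eval] at ho
    split at ho
    · cases ho
    obtain rfl := Option.some.inj ho
    have := Nat.mod_le y z
    refine ⟨⟨?_, ?_⟩, ?_, ?_⟩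
    · simp only [WExpr.Ok]; omega
    · simp only [WExpr.Ok]; omega
    · simp only [simGuard, Test.Holds, WExpr.eval]; omega
    · simp only [simOp, Cmd.wp, WExpr.Ok, WExpr.eval, BinOp.eval, hy, hz,
        Function.update_self, ne_eq, Nat.reduceEqDiff, not_false_eq_true, Function.update_of_ne]
      rw [show z - 1 + 1 = z by omega]
      refine ⟨by omega, by omega, by omega, ⟨by omega, by omega, by omega⟩,
        hQ _ (by simp) fun i h₁ h₂ => ?_⟩
      simp [h₁, h₂]
  | nand =>
    obtain rfl := Option.some.inj ho
    have : y &&& z ≤ y := Nat.and_le_left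
    refine ⟨⟨?_, ?_⟩, ?_, ?_⟩
    · simp only [WExpr.Ok]; omega
    · simp only [WExpr.Ok]; omega
    · simp [simGuard, Test.Holds, WExpr.eval]
    · simp only [simOp, Cmd.wp, WExpr.Ok, WExpr.eval, BinOp.eval, hy, hz, h7]
      refine ⟨by omega, ⟨⟨by omega, by omega, by omega⟩, by omega, by omega⟩, by omega,
        hQ _ (by simp) fun i h₁ _ => ?_⟩
      simp [h₁]

theorem simGuard_of_none {o : WordOp} {y z : ℕ} (hz : σ.V 11 = z) (ho : o.eval w y z = none)
    (hw : z + 2 < 2 ^ w') : (simGuard o).Ok w' σ.V ∧ ¬ (simGuard o).Holds σ := by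
  cases o with
  | div | mod =>
    simp only [WordOp.eval] at ho
    split at ho
    · subst hz
      simp only [simGuard, Test.Ok, Test.Holds, WExpr.Ok, WExpr.eval]; omega
    · cases ho
  | _ => cases ho

/-- One instruction is simulated correctly. -/
theorem simInstr_wp {P : Program} {ins : Instr} (h : Sim w B T S s σ) (hs : ∀ a, s.W a < 2 ^ w)
    (hP : P[s.pc]? = some ins) (hword : ins.IsWord) (hins : ∀ a ∈ ins.words, a < 2 ^ w)
    (hB : 64 ≤ B) (hw : 2 ^ w * 2 ^ w + 2 * 2 ^ w + B + 2 < 2 ^ w') (hpc : s.pc + 2 < 2 ^ w')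
    (ht : ins.target + 1 < 2 ^ w') :
    (simInstr s.pc ins).wp w' (Sim w B T S ((ins.exec w s).getD s)) σ := by
  have e31 := h.base
  have hmem := h.mem
  cases ins with
  | wConst i j =>
    have hi := hins i (by simp [Instr.words])
    have hj := hins j (by simp [Instr.words])
    simp only [simInstr, simAddr, Cmd.wp, WExpr.Ok, WExpr.eval, BinOp.eval, e31]
    refine ⟨by omega, by omega, by omega, by omega, h.setW ?_ ?_ ?_ ?_ ?_ rfl⟩ <;> simp
  | wCopy i j =>
    have hi := hins i (by simp [Instr.words])
    have hj := hins j (by simp [Instr.words])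
    have := hs j
    simp only [simInstr, simAddr, Cmd.wp, WExpr.Ok, WExpr.eval, BinOp.eval, e31, ne_eq,
      Nat.reduceEqDiff, not_false_eq_true, Function.update_of_ne, Function.update_self,
      hmem j hj]
    refine ⟨by omega, by omega, by omega, by omega, by omega, by omega,
      h.setW ?_ ?_ ?_ ?_ ?_ rfl⟩ <;> simp
  | wStore i j =>
    have hi := hins i (by simp [Instr.words])
    have hj := hins j (by simp [Instr.words])
    have h₁ := hs j
    have h₂ := hs i
    simp only [simInstr, simAddr, Cmd.wp, WExpr.Ok, WExpr.eval, BinOp.eval, e31, ne_eq,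
      Nat.reduceEqDiff, not_false_eq_true, Function.update_of_ne, Function.update_self,
      hmem j hj, hmem i hi]
    refine ⟨by omega, by omega, by omega, by omega, by omega, by omega, by omega, by omega,
      h.setW ?_ ?_ ?_ ?_ ?_ rfl⟩ <;> simp
  | wLoad i j =>
    have hi := hins i (by simp [Instr.words])
    have hj := hins j (by simp [Instr.words])
    have h₁ := hs j
    have h₂ := hs (s.W j)
    simp only [simInstr, simAddr, Cmd.wp, WExpr.Ok, WExpr.eval, BinOp.eval, e31, ne_eq,
      Nat.reduceEqDiff, not_false_eq_true, Function.update_of_ne, Function.update_self,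
      hmem j hj, hmem _ h₁]
    refine ⟨by omega, by omega, by omega, by omega, by omega, by omega, by omega, by omega,
      h.setW ?_ ?_ ?_ ?_ ?_ rfl⟩ <;> simp
  | wArith o i j k =>
    have hi := hins i (by simp [Instr.words])
    have hj := hins j (by simp [Instr.words])
    have hk := hins k (by simp [Instr.words])
    have h₁ := hs j
    have h₂ := hs k
    simp only [simInstr, simAddr, Cmd.wp, WExpr.Ok, WExpr.eval, BinOp.eval, e31, ne_eq,
      Nat.reduceEqDiff, not_false_eq_true, Function.update_of_ne,
      hmem j hj, hmem k hk]
    refine ⟨by omega, by omega, by omega, by omega, ?_⟩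
    cases ho : o.eval w (s.W j) (s.W k) with
    | none =>
      obtain ⟨g₁, g₂⟩ := simGuard_of_none (w := w) (w' := w')
        (σ := ⟨Function.update (Function.update σ.V 10 (s.W j)) 11 (s.W k), σ.M, σ.R, σ.S⟩)
        (z := s.W k) (by simp) ho (by omega)
      refine ⟨g₁, fun g => absurd g g₂, fun _ => ?_⟩
      simp only [Instr.exec, ho, Option.map_none, Option.getD_none]
      exact ⟨by simpa using h.clock, by simpa using h.size, by simpa using h.pred,
        by simpa using h.pc, by simpa using h.base, h.mem, h.real⟩
    | some x =>
      have hx := WordOp.eval_lt h₁ h₂ ho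
      obtain ⟨g₁, g₂, g₃⟩ := simOp_wp (w := w) (w' := w')
        (σ := ⟨Function.update (Function.update σ.V 10 (s.W j)) 11 (s.W k), σ.M, σ.R, σ.S⟩)
        (y := s.W j) (z := s.W k) (x := x) (o := o)
        (Q := Cmd.wp w' (.seq (.store (simAddr (.const i)) (.var 10)) (.assign 8
          (.const (s.pc + 1)))) (Sim w B T S ((Instr.exec w s (.wArith o i j k)).getD s)))
        (by simpa using h.size) (by simpa using h.pred) (by simp) (by simp) h₁ h₂ (by omega) ho
        (fun V hV hV' => by
          have e31' : V 31 = B := (hV' 31 (by norm_num) (by norm_num)).trans (by simpa using h.base)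
          simp only [Cmd.wp, simAddr, WExpr.Ok, WExpr.eval, BinOp.eval, hV, e31', Instr.exec, ho,
            Option.map_some, Option.getD_some]
          refine ⟨by omega, by omega, by omega, by omega, h.setW ?_ ?_ ?_ ?_ ?_ rfl⟩
          · simp [hV' 6]
          · simp [hV' 7]
          · simp [hV' 9]
          · simp [hV' 31]
          · simp)
      exact ⟨g₁, fun _ => g₃, fun g => absurd g₂ g⟩
  | wIfEq i j l' =>
    have hi := hins i (by simp [Instr.words])
    have hj := hins j (by simp [Instr.words])
    have h₁ := hs j
    have h₂ := hs i
    have ht' : l' + 1 < 2 ^ w' := ht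
    simp only [simInstr, simAddr, Cmd.wp, Test.Ok, Test.Holds, WExpr.Ok, WExpr.eval, BinOp.eval,
      e31, ne_eq, Nat.reduceEqDiff, not_false_eq_true, Function.update_of_ne,
      Function.update_self, hmem j hj, hmem i hi, Instr.exec, Option.getD_some, Config.jumpIf]
    refine ⟨by omega, by omega, by omega, by omega, by omega, fun hh => ⟨by omega, ?_⟩,
      fun hh => ⟨by omega, ?_⟩⟩
    · rw [if_pos hh]
      apply h.jump <;> simp
    · rw [if_neg hh]
      apply h.jump <;> simp
  | wIfLt i j l' =>
    have hi := hins i (by simp [Instr.words])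
    have hj := hins j (by simp [Instr.words])
    have h₁ := hs j
    have h₂ := hs i
    have ht' : l' + 1 < 2 ^ w' := ht
    simp only [simInstr, simAddr, Cmd.wp, Test.Ok, Test.Holds, WExpr.Ok, WExpr.eval, BinOp.eval,
      e31, ne_eq, Nat.reduceEqDiff, not_false_eq_true, Function.update_of_ne,
      Function.update_self, hmem j hj, hmem i hi, Instr.exec, Option.getD_some, Config.jumpIf]
    refine ⟨by omega, by omega, by omega, by omega, by omega, fun hh => ⟨by omega, ?_⟩,
      fun hh => ⟨by omega, ?_⟩⟩
    · rw [if_pos hh]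
      apply h.jump <;> simp
    · rw [if_neg hh]
      apply h.jump <;> simp
  | goto l' =>
    have ht' : l' + 1 < 2 ^ w' := ht
    exact ⟨ht', h.jump (by simp) (by simp) (by simp) (by simp) (by simp [WExpr.eval])⟩
  | halt => exact h
  | accept => exact h
  | reject => exact h
  | _ => exact hword.elim

theorem dispatch_wp {P : Program} {k : ℕ} {Q : Store → Prop} (h8 : σ.V 8 + 1 < 2 ^ w')
    (h7 : σ.V 7 + 1 < 2 ^ w') (hk : k + P.length + 1 < 2 ^ w')
    (hwords : ∀ ins ∈ P, ins.maxWord + 1 < 2 ^ w')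
    (h : ∀ j ins, P[j]? = some ins → σ.V 8 = k + j →
      (ins.maxWord < σ.V 7 → (simInstr (k + j) ins).wp w' Q σ) ∧ (¬ ins.maxWord < σ.V 7 → Q σ))
    (h' : (∀ j, σ.V 8 = k + j → P[j]? = none) → Q σ) : (dispatch k P).wp w' Q σ := by
  induction P generalizing k with
  | nil => exact h' fun j _ => rfl
  | cons ins P ih =>
    simp only [List.length_cons] at hk
    simp only [dispatch, Cmd.wp, Test.Ok, Test.Holds, WExpr.Ok, WExpr.eval]
    refine ⟨by omega, fun hk' => ⟨⟨hwords ins (by simp), h7⟩, ?_⟩, fun hk' => ?_⟩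
    · exact h 0 ins rfl hk'
    · refine ih (by omega) (fun i hi => hwords i (by simp [hi])) (fun j i hj hj' => ?_) fun hn => ?_
      · have := h (j + 1) i (by simpa using hj) (by omega)
        rwa [← add_assoc, add_right_comm] at this
      · refine h' fun j hj => ?_
        cases j with
        | zero => exact absurd hj hk'
        | succ j => simpa using hn j (by omega)

theorem exec_pc_le {P : Program} {ins : Instr} {s' : Config} (hP : P.BoundedBy K)
    (h : P[s.pc]? = some ins) (hs : ins.exec w s = some s') : s'.pc ≤ K := by
  have h₁ : s.pc < P.length := (List.getElem?_eq_some_iff.1 h).1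
  have h₂ := hP.length
  have h₃ := hP.target ins (List.mem_of_getElem? h)
  have h₄ := (Instr.leads_effect hs).pc
  rw [h₄]
  cases ins <;> simp only [Instr.effect, Instr.target] at * <;> first | omega | (split <;> omega)

/-- One step is simulated correctly. -/
theorem dispatch_step {P : Program} (hP : P.BoundedBy K) (hword : ∀ ins ∈ P, ins.IsWord)
    (h : Sim w B T S s σ) (hs : ∀ a, s.W a < 2 ^ w) (hpc : s.pc ≤ K) (hB : 64 ≤ B)
    (hw : 2 ^ w * 2 ^ w + 2 * 2 ^ w + B + K + 2 < 2 ^ w') :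
    (dispatch 0 P).wp w' (fun σ' => Sim w B T S ((step P w s).getD s) σ') σ := by
  have hlen := hP.length
  have hpos : 0 < 2 ^ w := by positivity
  refine dispatch_wp (by rw [h.pc]; omega) (by rw [h.size]; omega) (by omega)
    (fun ins hi => ?_) (fun j ins hj hj' => ?_) fun hn => ?_
  · have : ins.maxWord < K + 1 := (Instr.maxWord_lt_iff (by omega)).2 fun a ha =>
      Nat.lt_succ_of_le (hP.words ins hi a ha)
    omega
  · rw [h.pc, zero_add] at hj'
    rw [zero_add, ← hj', h.size, Instr.maxWord_lt_iff hpos]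
    rw [← hj'] at hj
    have hmem := List.mem_of_getElem? hj
    refine ⟨fun hins => ?_, fun hins => ?_⟩
    · have : step P w s = ins.exec w s := by
        rw [step, hj]
        exact if_pos hins
      rw [this]
      exact simInstr_wp h hs hj (hword _ hmem) hins hB (by omega) (by omega)
        (by have := hP.target _ hmem; omega)
    · have : step P w s = none := by
        rw [step, hj]
        exact if_neg hins
      rw [this]
      exact h
  · have : step P w s = none := by
      rw [step, hn s.pc (by rw [h.pc, zero_add])]
    rw [this]
    exact h

theorem trace_pc_le {P : Program} (hP : P.BoundedBy K) (hs : s.pc = 0) (t : ℕ) :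
    (trace P w s t).pc ≤ K := by
  induction t with
  | zero => rw [trace, hs]; omega
  | succ t ih =>
    rw [trace]
    cases hstep : step P w (trace P w s t) with
    | none => exact ih
    | some s' =>
      obtain ⟨ins, h₁, -, h₂⟩ := step_eq_some hstep
      exact exec_pc_le hP h₁ h₂

theorem simulate_spec {P : Program} (hP : P.BoundedBy K) (hword : ∀ ins ∈ P, ins.IsWord)
    (hs : ∀ a, s.W a < 2 ^ w) (hpc : s.pc = 0) (hB : 64 ≤ B)
    (hw : 2 ^ w * 2 ^ w + 2 * 2 ^ w + B + K + T + 2 < 2 ^ w')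
    (h : Sim w B T S s { σ with V := Function.update σ.V 8 0 }) :
    Cmd.Ends w' (simulate P) (T * ((dispatch 0 P).cost + 10) + 10)
      (Sim w B 0 S (trace P w s T)) σ := by
  let I : ℕ → Store → Prop := fun j => Sim w B (T - j) S (trace P w s j)
  refine ((Cmd.Ends.of_wp (Q := I 0) ?_).seq' fun σ₁ hσ₁ => Cmd.Ends.loop
    (T := Cmd.cost (.seq (.sub 6 (.var 6) (.const 1)) (dispatch 0 P))) (m := T) I
    (fun j hj τ hτ => ?_) (fun τ hτ => ?_) hσ₁).mono ?_ fun σ' hσ' => ?_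
  · simp only [Cmd.wp, WExpr.Ok]
    exact ⟨by omega, h⟩
  · have e6 := hτ.clock
    refine ⟨?_, ?_, Cmd.Ends.of_wp ?_⟩
    · simp only [Test.Ok, WExpr.Ok, e6]; omega
    · simp only [Test.Holds, WExpr.eval, e6]; omega
    · simp only [Cmd.wp, WExpr.Ok, WExpr.eval, e6]
      refine ⟨by omega, by omega, by omega, ?_⟩
      refine dispatch_step hP hword ⟨?_, ?_, ?_, ?_, ?_, hτ.mem, hτ.real⟩ (trace_words hs j)
        (trace_pc_le hP hpc j) hB (by omega)
      · simp; omega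
      · simpa using hτ.size
      · simpa using hτ.pred
      · simpa using hτ.pc
      · simpa using hτ.base
  · have e6 := hτ.clock
    simp only [Test.Ok, Test.Holds, WExpr.Ok, WExpr.eval, e6]; omega
  · simp only [Cmd.cost, Cmd.size, Test.len, WExpr.len]
    have : T * (1 + 1 + 1 + (1 + 1 + 1 + (dispatch 0 P).cost) + 1) ≤
      T * ((dispatch 0 P).cost + 10) := Nat.mul_le_mul_left _ (by omega)
    omega
  · simpa only [I, Nat.sub_self] using hσ'

end Sim

/-! ### Evaluation of formulas in prefix notation -/

/-- Push a number onto a stack. Stacks are infinite sequences, with the top at index `0`. -/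
def push (x : ℝ) (st : ℕ → ℝ) : ℕ → ℝ
  | 0 => x
  | i + 1 => st i

open Classical in
/-- Value of a binary symbol; `1` and `0` are the truth values. -/
noncomputable def symbolValue (k : ℕ) (a b : ℝ) : ℝ :=
  if k = 2 then a + b else if k = 4 then (if a = b then 1 else 0)
  else if k = 5 then (if a ≤ b then 1 else 0) else if k = 6 then (if a < b then 1 else 0)
  else if k = 8 then a + b - a * b else a * b

/-- Effect of a symbol on the stack, if the string is read from right to left. The variables have
the values `X`. -/
noncomputable def evalSymbol (X : ℕ → ℝ) (k : ℕ) (st : ℕ → ℝ) : ℕ → ℝ :=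
  if 9 < k then push (X (k - 10)) st
  else if k < 2 then push k st
  else if k = 9 then push (1 - st 0) fun i => st (i + 1)
  else push (symbolValue k (st 0) (st 1)) fun i => st (i + 2)

theorem foldr_evalSymbol_term (X : ℕ → ℝ) (t : Term) (L : List ℕ) (st : ℕ → ℝ) :
    (t.code ++ L).foldr (evalSymbol X) st = push (t.eval X) (L.foldr (evalSymbol X) st) := by
  induction t generalizing L with
  | zero => simp [Term.code, Term.eval, evalSymbol]
  | one => simp [Term.code, Term.eval, evalSymbol]
  | var i => simp [Term.code, Term.eval, evalSymbol, show 9 < 10 + i by omega]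
  | add s t hs ht =>
    simp only [Term.code, Term.eval, List.cons_append, List.append_assoc, List.foldr_cons, hs, ht]
    simp [evalSymbol, symbolValue, push]
  | mul s t hs ht =>
    simp only [Term.code, Term.eval, List.cons_append, List.append_assoc, List.foldr_cons, hs, ht]
    simp [evalSymbol, symbolValue, push]

open Classical in
/-- Right-to-left evaluation of a formula pushes its truth value. -/
theorem foldr_evalSymbol_formula (X : ℕ → ℝ) (φ : Formula) (L : List ℕ) (st : ℕ → ℝ) :
    (φ.code ++ L).foldr (evalSymbol X) st =
      push (if φ.Holds X then 1 else 0) (L.foldr (evalSymbol X) st) := by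
  induction φ generalizing L with
  | eq s t | le s t | lt s t =>
    simp only [Formula.code, Formula.Holds, List.cons_append, List.append_assoc, List.foldr_cons,
      foldr_evalSymbol_term]
    simp [evalSymbol, symbolValue, push]
    rfl
  | and φ ψ hφ hψ =>
    simp only [Formula.code, Formula.Holds, List.cons_append, List.append_assoc, List.foldr_cons,
      hφ, hψ]
    by_cases h₁ : φ.Holds X <;> by_cases h₂ : ψ.Holds X <;>
      simp [evalSymbol, symbolValue, push, h₁, h₂]
  | or φ ψ hφ hψ =>
    simp only [Formula.code, Formula.Holds, List.cons_append, List.append_assoc, List.foldr_cons,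
      hφ, hψ]
    by_cases h₁ : φ.Holds X <;> by_cases h₂ : ψ.Holds X <;>
      simp [evalSymbol, symbolValue, push, h₁, h₂]
  | not φ hφ =>
    simp only [Formula.code, Formula.Holds, List.cons_append, List.foldr_cons, hφ]
    by_cases h₁ : φ.Holds X <;> simp [evalSymbol, push, h₁]

/-- The stack that ends below address `p` of the real memory. -/
def stackView (S : ℕ → ℝ) (p : ℕ) (i : ℕ) : ℝ := S (p - 1 - i)

theorem stackView_update (S : ℕ → ℝ) {q : ℕ} (hq : 1 ≤ q) (x : ℝ) :
    stackView (Function.update S q x) (q + 1) = push x (stackView S q) := by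
  funext i
  cases i with
  | zero => simp [stackView, push]
  | succ i =>
    simp only [stackView, push]
    rw [Function.update_of_ne (by omega)]
    congr 1
    omega

theorem stackView_sub (S : ℕ → ℝ) (p j : ℕ) :
    stackView S (p - j) = fun i => stackView S p (i + j) := by
  funext i
  simp only [stackView]
  congr 1
  omega

/-- Apply the binary symbol in variable `10` to the real variables `0` and `1`. -/
def evalBinary : Cmd :=
  .ite (.eq (.var 10) (.const 2)) (.rarith .add 0 0 1)
  (.ite (.eq (.var 10) (.const 4))
    (.seq (.rarith .sub 0 0 1) (.ite (.rzero 0) (.rconst 0 1) (.rconst 0 0)))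
  (.ite (.eq (.var 10) (.const 5))
    (.seq (.rarith .sub 0 0 1) (.ite (.rpos 0) (.rconst 0 0) (.rconst 0 1)))
  (.ite (.eq (.var 10) (.const 6))
    (.seq (.rarith .sub 0 1 0) (.ite (.rpos 0) (.rconst 0 1) (.rconst 0 0)))
  (.ite (.eq (.var 10) (.const 8))
    (.seq (.rarith .mul 2 0 1) (.seq (.rarith .add 0 0 1) (.rarith .sub 0 0 2)))
    (.rarith .mul 0 0 1)))))

/-- Pop the operands of the symbol in variable `10` and compute its value in the real variable `0`.
Variable `12` is the stack pointer. The value of variable number `i` of the formula, which is symbol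
`10 + i`, is the real register `68 + i`. -/
def evalTop : Cmd :=
  .ite (.lt (.const 9) (.var 10)) (.rload 0 (.op .add (.const 58) (.var 10)))
  (.ite (.lt (.var 10) (.const 2)) (.ite (.eq (.var 10) (.const 0)) (.rconst 0 0) (.rconst 0 1))
  (.seq (.sub 12 (.var 12) (.const 1)) (.seq (.rload 0 (.var 12))
  (.ite (.eq (.var 10) (.const 9)) (.seq (.rconst 1 1) (.rarith .sub 0 1 0))
    (.seq (.sub 12 (.var 12) (.const 1)) (.seq (.rload 1 (.var 12)) evalBinary))))))

/-- Process the symbol before the position in variable `13`. -/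
def evalBody : Cmd :=
  .seq (.seq (.sub 13 (.var 13) (.const 1)) (.load 10 (.op .add (.var 31) (.var 13))))
  (.seq evalTop (.seq (.rstore (.var 12) 0) (.assign 12 (.op .add (.var 12) (.const 1)))))

/-- Evaluate the formula at the beginning of the simulated memory. The whole memory is processed
from right to left as if it were a string of symbols, since the length of the formula is not known.
What is pushed for the words after the formula remains below its value on the stack. -/
def evaluate : Cmd :=
  .seq (.seq (.assign 13 (.var 7))
    (.assign 12 (.op .add (.const 60) (.op .add (.var 7) (.var 7)))))
  (.seq (.loop (.lt (.const 0) (.var 13)) evalBody)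
  (.seq (.sub 12 (.var 12) (.const 1)) (.rload 0 (.var 12))))

section Eval

variable {w : ℕ} {σ : Store} {Q : Store → Prop}

theorem evalBinary_wp {k : ℕ} (hk : σ.V 10 = k) (hk' : k < 10) (hw : 20 < 2 ^ w)
    (hQ : ∀ R, R 0 = symbolValue k (σ.R 0) (σ.R 1) → Q ⟨σ.V, σ.M, R, σ.S⟩) :
    evalBinary.wp w Q σ := by
  simp only [evalBinary, Cmd.wp, Test.Ok, Test.Holds, WExpr.Ok, WExpr.eval, RealOp.eval, hk]
  refine ⟨by omega, fun h => ⟨_, rfl, hQ _ ?_⟩, fun h₂ => ⟨by omega, fun h => ⟨_, rfl, trivial,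
    fun h' => hQ _ ?_, fun h' => hQ _ ?_⟩, fun h₄ => ⟨by omega, fun h => ⟨_, rfl, trivial,
    fun h' => hQ _ ?_, fun h' => hQ _ ?_⟩, fun h₅ => ⟨by omega, fun h => ⟨_, rfl, trivial,
    fun h' => hQ _ ?_, fun h' => hQ _ ?_⟩, fun h₆ => ⟨by omega, fun h => ⟨_, rfl, _, rfl, _, rfl,
    hQ _ ?_⟩, fun h₈ => ⟨_, rfl, hQ _ ?_⟩⟩⟩⟩⟩⟩
  · simp [symbolValue, h]
  · simp only [Function.update_self] at h'
    simp [symbolValue, h, sub_eq_zero.1 h']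
  · simp only [Function.update_self, sub_eq_zero] at h'
    simp [symbolValue, h, h']
  · simp only [Function.update_self, sub_pos] at h'
    simp [symbolValue, h, h']
  · simp only [Function.update_self, sub_pos, not_lt] at h'
    simp [symbolValue, h, h']
  · simp only [Function.update_self, sub_pos] at h'
    simp [symbolValue, h, h']
  · simp only [Function.update_self, sub_pos] at h'
    simp [symbolValue, h, h']
  · simp [symbolValue, h]
  · simp [symbolValue, h₂, h₄, h₅, h₆, h₈]

theorem evalTop_wp {k p : ℕ} {X : ℕ → ℝ} (hk : σ.V 10 = k) (hp : σ.V 12 = p) (hp' : 6 ≤ p)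
    (hX : 9 < k → σ.S (58 + k) = X (k - 10)) (hw : p + k + 100 < 2 ^ w)
    (hQ : ∀ V R q, (∀ i, i ≠ 12 → V i = σ.V i) → V 12 = q → q ≤ p → p ≤ q + 2 →
      push (R 0) (stackView σ.S q) = evalSymbol X k (stackView σ.S p) → Q ⟨V, σ.M, R, σ.S⟩) :
    evalTop.wp w Q σ := by
  simp only [evalTop, Cmd.wp, Test.Ok, Test.Holds, WExpr.Ok, WExpr.eval, BinOp.eval, RealOp.eval,
    hk, hp, ne_eq, Nat.reduceEqDiff, not_false_eq_true, Function.update_of_ne,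
    Function.update_self]
  refine ⟨by omega, fun h => ⟨by omega, by omega, hQ _ _ p (fun _ _ => rfl) hp le_rfl (by omega) ?_⟩,
    fun h₉ => ⟨by omega, fun h => ⟨by omega, fun h₀ => hQ _ _ p (fun _ _ => rfl) hp le_rfl
      (by omega) ?_, fun h₀ => hQ _ _ p (fun _ _ => rfl) hp le_rfl (by omega) ?_⟩,
    fun h₂ => ⟨by omega, by omega, by omega, by omega, by omega, by omega,
    fun h => ⟨_, rfl, hQ _ _ (p - 1) (fun i hi => by simp [hi]) (by simp) (by omega) (by omega) ?_⟩,
    fun h => ⟨by omega, by omega, by omega, by omega, by omega, ?_⟩⟩⟩⟩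
  · simp [evalSymbol, h, hX h]
  · simp [evalSymbol, h₀]
  · obtain rfl : k = 1 := by omega
    simp [evalSymbol]
  · rw [stackView_sub]
    simp [evalSymbol, h, stackView]
  · refine evalBinary_wp (k := k) (by simpa using hk) (by omega) (by omega) fun R hR =>
      hQ _ _ (p - 2) (fun i hi => by simp [hi]) (by simp; omega) (by omega) (by omega) ?_
    have e₁ : p - 1 - 1 = p - 2 := by omega
    simp only [Function.update_self, ne_eq, zero_ne_one, not_false_eq_true, Function.update_of_ne,
      e₁] at hR
    rw [stackView_sub, hR]
    simp [evalSymbol, h₉, h₂, h, stackView, e₁]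

/-- The symbols with the greatest `d` indices below `m`. -/
def lastSymbols (g : ℕ → ℕ) (m d : ℕ) : List ℕ := (List.range d).map fun i => g (m - d + i)

theorem lastSymbols_succ (g : ℕ → ℕ) {m d : ℕ} (h : d < m) :
    lastSymbols g m (d + 1) = g (m - d - 1) :: lastSymbols g m d := by
  simp only [lastSymbols, List.range_succ_eq_map, List.map_cons, List.map_map, List.cons.injEq]
  refine ⟨by congr 1, List.map_congr_left fun i _ => ?_⟩
  simp only [Function.comp]
  congr 1
  omega

theorem evaluate_spec {m B : ℕ} {g : ℕ → ℕ} {X : ℕ → ℝ} (h7 : σ.V 7 = m) (h31 : σ.V 31 = B)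
    (hB : 64 ≤ B) (hw : 4 * m + B + 300 < 2 ^ w) (hM : ∀ a < m, σ.M (B + a) = g a)
    (hg : ∀ a, g a < m) (hX : ∀ i, i + 10 < m → σ.S (68 + i) = X i) :
    Cmd.Ends w evaluate (m * 100 + 100) (fun σ' => ∃ st,
      σ'.R 0 = ((List.range m).map g).foldr (evalSymbol X) st 0) σ := by
  obtain ⟨st, hst⟩ : ∃ st, st = stackView σ.S (60 + 2 * m) := ⟨_, rfl⟩
  let I : ℕ → Store → Prop := fun d τ => τ.V 31 = B ∧ τ.V 13 = m - d ∧
    (60 + 2 * m ≤ τ.V 12 + d ∧ τ.V 12 ≤ 60 + 2 * m + d) ∧ τ.M = σ.M ∧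
    (∀ a < 58 + m, τ.S a = σ.S a) ∧
    stackView τ.S (τ.V 12) = (lastSymbols g m d).foldr (evalSymbol X) st
  refine ((Cmd.Ends.of_wp (Q := I 0) ?_).seq' fun σ₁ hσ₁ => (Cmd.Ends.loop (T := evalBody.cost)
    (m := m) I (fun d hd τ hτ => ⟨?_, ?_, Cmd.Ends.of_wp ?_⟩) (fun τ hτ => ?_) hσ₁).seq'
    fun σ₂ hσ₂ => Cmd.Ends.of_wp (Q := fun σ' => ∃ st,
      σ'.R 0 = ((List.range m).map g).foldr (evalSymbol X) st 0) ?_).mono ?_ fun _ h => h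
  · simp only [Cmd.wp, WExpr.Ok, WExpr.eval, BinOp.eval, h7, ne_eq, Nat.reduceEqDiff,
      not_false_eq_true, Function.update_of_ne, Function.update_self, I]
    refine ⟨by omega, ⟨by omega, ⟨by omega, by omega, by omega⟩, by omega⟩, h31, by omega,
      ⟨by omega, by omega⟩, trivial, fun _ _ => trivial, ?_⟩
    rw [hst, ← two_mul]
    rfl
  · obtain ⟨-, e13, -⟩ := hτ
    simp only [Test.Ok, WExpr.Ok, e13]; omega
  · obtain ⟨-, e13, -⟩ := hτ
    simp only [Test.Holds, WExpr.eval, e13]; omega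
  · obtain ⟨e31, e13, ⟨e12, e12'⟩, eM, eS, e⟩ := hτ
    have hgd := hg (m - d - 1)
    have hget : σ.M (B + (m - d - 1)) = g (m - d - 1) := hM _ (by omega)
    simp only [evalBody, Cmd.wp, WExpr.Ok, WExpr.eval, BinOp.eval, e13, e31, eM, hget, ne_eq,
      Nat.reduceEqDiff, not_false_eq_true, Function.update_of_ne, Function.update_self]
    refine ⟨by omega, by omega, by omega, ⟨by omega, by omega, by omega⟩, by omega, ?_⟩
    refine evalTop_wp (k := g (m - d - 1)) (p := τ.V 12) (X := X) (by simp) (by simp) (by omega)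
      (fun h => ?_) (by omega) fun V R q hV hq hqp hpq hR => ?_
    · rw [eS _ (by omega), ← hX _ (by omega)]
      congr 1
      omega
    · have e31' : V 31 = B := (hV 31 (by norm_num)).trans (by simpa using e31)
      have e13' : V 13 = m - d - 1 := (hV 13 (by norm_num)).trans (by simp)
      simp only [hq, I, ne_eq, Nat.reduceEqDiff, not_false_eq_true, Function.update_of_ne,
        Function.update_self, e31', e13']
      refine ⟨by omega, by omega, ⟨by omega, by omega, by omega⟩, trivial, by omega,
        ⟨by omega, by omega⟩, trivial, fun a ha => ?_, ?_⟩
      · rw [Function.update_of_ne (by omega), eS a ha]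
      · rw [stackView_update _ (by omega), hR, lastSymbols_succ g hd, List.foldr_cons, e]
  · obtain ⟨-, e13, -⟩ := hτ
    simp only [Test.Ok, Test.Holds, WExpr.Ok, WExpr.eval, e13]; omega
  · obtain ⟨e31, e13, ⟨e12, e12'⟩, eM, eS, e⟩ := hσ₂
    simp only [Cmd.wp, WExpr.Ok, WExpr.eval, Function.update_self]
    refine ⟨by omega, by omega, by omega, by omega, by omega, st, ?_⟩
    have : lastSymbols g m m = (List.range m).map g := by simp [lastSymbols]
    rw [← this, ← e]
    simp [stackView]
  · have : evalBody.cost ≤ 70 := by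
      simp [evalBody, evalTop, evalBinary, Cmd.cost, Cmd.size, Test.len, WExpr.len, BinOp.code]
    have h' : m * (evalBody.cost + 10) ≤ m * 80 := Nat.mul_le_mul_left _ (by omega)
    have h'' : m * (evalBody.cost + 10) = m * evalBody.cost + m * 10 := by ring
    simp only [Cmd.cost, Cmd.size, Test.len, WExpr.len, BinOp.code, List.length_cons,
      List.length_nil]
    have h3 : m * (1 + 1 + 1 + evalBody.cost + 1) = m * evalBody.cost + m * 4 := by ring
    omega

end Eval

/-! ### Problems in `∃ℝ` have a real verification algorithm -/

theorem WExpr.not_isSqrt_code {e : WExpr} {d : ℕ} : ∀ ins ∈ e.code d, ¬ ins.IsSqrt := by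
  intro ins h h'
  cases ins <;> first | exact h' | exact WExpr.isWord_code _ h

theorem Test.not_isSqrt_code {t : Test} {l : ℕ} : ∀ ins ∈ t.code l, ¬ ins.IsSqrt := by
  intro ins h h'
  cases t with
  | lt e f | eq e f =>
    simp only [code, List.mem_append, List.mem_singleton] at h
    rcases h with h | h | rfl
    · exact WExpr.not_isSqrt_code _ h h'
    · exact WExpr.not_isSqrt_code _ h h'
    · exact h'
  | rzero i | rpos i =>
    simp only [code, List.mem_singleton] at h
    subst h
    exact h'

theorem Cmd.not_isSqrt_code {c : Cmd} {off : ℕ} : ∀ ins ∈ c.code off, ¬ ins.IsSqrt := by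
  intro ins h h'
  induction c generalizing off with
  | skip => simp [code] at h
  | seq c₁ c₂ h₁ h₂ =>
    simp only [code, List.mem_append] at h
    rcases h with h | h
    · exact h₁ h
    · exact h₂ h
  | ite t c₁ c₂ h₁ h₂ =>
    simp only [code, List.mem_append, List.mem_cons] at h
    rcases h with h | h | rfl | h
    · exact Test.not_isSqrt_code _ h h'
    · exact h₂ h
    · exact h'
    · exact h₁ h
  | loop t c hc =>
    simp only [code, List.mem_append, List.mem_cons, List.not_mem_nil, or_false] at h
    rcases h with h | rfl | h | rfl
    · exact Test.not_isSqrt_code _ h h'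
    · exact h'
    · exact hc h
    · exact h'
  | rconst | rarith =>
    simp only [code, List.mem_singleton] at h
    subst h
    exact h'
  | assign | load | rload | rstore =>
    simp only [code, List.mem_append, List.mem_singleton] at h
    rcases h with h | rfl
    · exact WExpr.not_isSqrt_code _ h h'
    · exact h'
  | rword | store | sub =>
    simp only [code, List.mem_append, List.mem_cons, List.not_mem_nil, or_false] at h
    rcases h with h | h | h
    all_goals first
      | exact WExpr.not_isSqrt_code _ h h'
      | (subst h; exact h')

/-- Copy the first `m` word registers to the real registers from address `4` on. -/
def saveCode (m : ℕ) : List Instr := (List.range m).map fun i => .rCastWord (4 + i) i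

theorem run_saveCode {P : Program} {w : ℕ} (hP : GoodWords P w) {m off : ℕ} {s : Config}
    (hc : CodeAt P off (saveCode m)) (hs : s.pc = off) :
    run P w m s = some ⟨off + m, s.W,
      fun i => if 4 ≤ i ∧ i < 4 + m then (s.W (i - 4) : ℝ) else s.R i⟩ := by
  induction m with
  | zero =>
    have : (fun i => if 4 ≤ i ∧ i < 4 + 0 then (s.W (i - 4) : ℝ) else s.R i) = s.R := by
      funext i
      rw [if_neg (by omega)]
    simp only [run, this, ← hs, add_zero]
  | succ m ih =>
    rw [saveCode, List.range_succ, List.map_append] at hc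
    have c₁ := hc.right
    simp only [List.length_map, List.length_range, List.map_cons] at c₁
    refine run_trans (ih hc.left) (run_instr hP c₁ rfl ?_)
    simp only [Instr.exec, Config.setR, add_assoc]
    congr 2
    funext i
    rw [Function.update_apply]
    by_cases h : i = 4 + m
    · rw [if_pos h, if_pos (by omega)]
      congr 2
      omega
    · rw [if_neg h]
      by_cases h' : 4 ≤ i ∧ i < 4 + m
      · rw [if_pos h', if_pos (by omega)]
      · rw [if_neg h', if_neg (by omega)]

/-- The structured part of the verification algorithm for a reduction `P`: simulate the reduction,
and evaluate the resulting formula at the point given by the certificate. -/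
def verifierCmd (P : Program) (c : ℕ) : Cmd :=
  .seq parse (.seq (sizes c) (.seq (simulate P) evaluate))

/-- The verification algorithm for a reduction `P`. -/
def verifier (P : Program) (c : ℕ) : Program :=
  saveCode 64 ++ (halfCode ++ ((verifierCmd P c).code 70 ++
    [.rIfZero 0 (70 + (verifierCmd P c).size + 2), .accept, .reject]))

theorem simInstr_wf (l : ℕ) (ins : Instr) : (simInstr l ins).WF := by
  cases ins
  case wArith o i j k =>
    cases o <;> simp [simInstr, simAddr, simGuard, simOp, Cmd.WF, Test.WF, WExpr.WF]
  all_goals simp [simInstr, simAddr, Cmd.WF, Test.WF, WExpr.WF]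

theorem dispatch_wf (k : ℕ) (P : Program) : (dispatch k P).WF := by
  induction P generalizing k with
  | nil => trivial
  | cons ins P ih => simp [dispatch, Cmd.WF, Test.WF, WExpr.WF, ih, simInstr_wf]

theorem verifierCmd_wf (P : Program) (c : ℕ) : (verifierCmd P c).WF := by
  have h : (powExpr (.var 0) c).WF 32 := powExpr_wf (by simp [WExpr.WF]) (by norm_num) c
  refine ⟨?_, ?_, ?_, ?_⟩
  · simp [parse, parseBody, readPair, readBit, Cmd.WF, Test.WF, WExpr.WF]
  · simp [sizes, Cmd.WF, Test.WF, WExpr.WF, h]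
  · simp [simulate, Cmd.WF, Test.WF, WExpr.WF, dispatch_wf]
  · simp [evaluate, evalBody, evalTop, evalBinary, Cmd.WF, Test.WF, WExpr.WF]

theorem verifier_not_isSqrt (P : Program) (c : ℕ) : ∀ ins ∈ verifier P c, ¬ ins.IsSqrt := by
  intro ins h
  simp only [verifier, saveCode, halfCode, List.mem_append, List.mem_map, List.mem_cons,
    List.not_mem_nil, or_false] at h
  rcases h with ⟨i, -, rfl⟩ | (rfl | rfl | rfl | rfl | rfl | rfl) | h | rfl | rfl | rfl
  case inr.inr.inl => exact Cmd.not_isSqrt_code _ h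
  all_goals exact id

/-- A quantity that dominates all resources of the verification algorithm. -/
theorem verifier_size_bounds {N : ℕ} (hN : 2 ≤ N) (c C : ℕ) :
    ∃ Z, 1 ≤ Z ∧ N ≤ Z ∧ N ^ (3 * c) * N ^ (3 * c) ≤ Z ∧ N ^ (3 * c) * (C + 1) ≤ Z ∧
      4096 * Z ≤ N ^ (6 * c + C + 13) := by
  have hy : 1 ≤ N ^ (3 * c) := Nat.one_le_pow _ _ (by omega)
  refine ⟨N ^ (3 * c) * N ^ (3 * c) * (N * (C + 1)), ?_, ?_, ?_, ?_, ?_⟩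
  · exact Nat.mul_pos (Nat.mul_pos hy hy) (by positivity)
  · calc N ≤ N * (C + 1) := Nat.le_mul_of_pos_right _ (by omega)
      _ ≤ _ := Nat.le_mul_of_pos_left _ (Nat.mul_pos hy hy)
  · exact Nat.le_mul_of_pos_right _ (by positivity)
  · exact Nat.mul_le_mul (Nat.le_mul_of_pos_left _ hy) (Nat.le_mul_of_pos_left _ (by omega))
  · have h₁ : 2 ^ 12 ≤ N ^ 12 := Nat.pow_le_pow_left hN _
    have h₂ : C + 1 ≤ N ^ C := by
      calc C + 1 ≤ 2 ^ C := Nat.lt_two_pow_self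
        _ ≤ N ^ C := Nat.pow_le_pow_left hN _
    calc 4096 * (N ^ (3 * c) * N ^ (3 * c) * (N * (C + 1)))
        ≤ N ^ 12 * (N ^ (3 * c) * N ^ (3 * c) * (N * N ^ C)) :=
          Nat.mul_le_mul (by simpa using h₁)
            (Nat.mul_le_mul_left _ (Nat.mul_le_mul_left _ h₂))
      _ = N ^ (6 * c + C + 13) := by ring

open Classical in
/-- The behaviour of the verification algorithm: on every input it simulates the reduction on the
longest part of the input that can be the code of an instance, for a limited number of steps,
evaluates the output as a formula, and accepts if the result is not zero. -/
theorem verifier_stopsAt {P : Program} (hword : ∀ ins ∈ P, ins.IsWord) {c : ℕ} (hc : 1 ≤ c) :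
    ∃ C, ∀ (x : List ℝ) (b : List ℕ), 2 ≤ x.length + b.length →
      ∀ k, (∀ j < k, 0 < bitOf (b.getD · 0) (2 * j) + bitOf (b.getD · 0) (2 * j + 1)) →
      bitOf (b.getD · 0) (2 * k) + bitOf (b.getD · 0) (2 * k + 1) = 0 →
      ∃ t ≤ (x.length + b.length) ^ (6 * c + C + 13), ∃ s st,
        StopsAt (verifier P c) (wordSize (6 * c + C + 13) (x.length + b.length)) x b t s
          (if ((List.range (2 ^ wordSize c (2 * k + 2))).map (trace P (wordSize c (2 * k + 2))
            ⟨0, fun a => if a < 2 * k then bitOf (b.getD · 0) a else 0, fun _ => 0⟩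
            ((2 * k + 2) ^ c)).W).foldr (evalSymbol fun i => x.getD (68 + i) 0) st 0 = 0
          then .reject else .accept) := by
  obtain ⟨K, hK⟩ := P.exists_boundedBy
  obtain ⟨K', hK'⟩ := exists_goodWords (verifier P c)
  refine ⟨K + K' + (powExpr (.var 0) c).len + (dispatch 0 P).cost, fun x b hN k hpos hend => ?_⟩
  obtain ⟨C, hC⟩ : ∃ C, C = K + K' + (powExpr (.var 0) c).len + (dispatch 0 P).cost := ⟨_, rfl⟩
  rw [← hC]
  obtain ⟨N, hNdef⟩ : ∃ N, N = x.length + b.length := ⟨_, rfl⟩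
  rw [← hNdef] at hN ⊢
  obtain ⟨w', hw'⟩ : ∃ w', w' = wordSize (6 * c + C + 13) N := ⟨_, rfl⟩
  rw [← hw']
  obtain ⟨Z, hZ1, hZN, hZy, hZC, hZ⟩ := verifier_size_bounds hN c C
  have hlow := le_two_pow_wordSize (6 * c + C + 13) N
  rw [← hw'] at hlow
  obtain ⟨y, hy⟩ : ∃ y, y = N ^ (3 * c) := ⟨_, rfl⟩
  rw [← hy] at hZy hZC
  -- Zeros follow the input, so the part parsed as an instance is hardly longer than the input.
  have hk : 2 * k ≤ b.length + 1 := by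
    by_contra hcon
    have := hpos (k - 1) (by omega)
    have h₁ : b.getD (2 * (k - 1)) 0 = 0 := List.getD_eq_default _ _ (by omega)
    have h₂ : b.getD (2 * (k - 1) + 1) 0 = 0 := List.getD_eq_default _ _ (by omega)
    have h₃ : bitOf (b.getD · 0) (2 * (k - 1)) = 0 := if_pos h₁
    have h₄ : bitOf (b.getD · 0) (2 * (k - 1) + 1) = 0 := if_pos h₂
    omega
  obtain ⟨n, hn⟩ : ∃ n, n = 2 * k + 2 := ⟨_, rfl⟩
  rw [← hn]
  have hny : n ^ c ≤ y := by
    have : n ≤ N ^ 3 := by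
      have h₁ : 2 * 2 * N ≤ N * N * N := Nat.mul_le_mul_right _ (Nat.mul_le_mul hN hN)
      have h₂ : N ^ 3 = N * N * N := by ring
      omega
    rw [hy, pow_mul]
    exact Nat.pow_le_pow_left this c
  obtain ⟨w, hw⟩ : ∃ w, w = wordSize c n := ⟨_, rfl⟩
  rw [← hw]
  have hup := two_pow_wordSize_lt (c := c) (N := n) (by omega)
  rw [← hw] at hup
  have h2w := two_le_two_pow_wordSize (N := n) hc (by omega)
  rw [← hw] at h2w
  have hww : 2 ^ w * 2 ^ w ≤ 4 * Z := by
    calc 2 ^ w * 2 ^ w ≤ (2 * y) * (2 * y) := Nat.mul_le_mul (by omega) (by omega)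
      _ = 4 * (y * y) := by ring
      _ ≤ 4 * Z := by omega
  have hyC : y * C + y ≤ Z := by rw [← Nat.mul_succ]; exact hZC
  have hyD : n ^ c * ((dispatch 0 P).cost + 10) ≤ Z + 10 * y := by
    calc n ^ c * ((dispatch 0 P).cost + 10) ≤ y * (C + 10) :=
          Nat.mul_le_mul hny (by omega)
      _ ≤ Z + 10 * y := by rw [Nat.mul_add]; omega
  have hCy : C ≤ y * C := Nat.le_mul_of_pos_left _ (hy ▸ Nat.one_le_pow _ _ (by omega))
  have hw2 : 12 ≤ w' := by
    by_contra hcon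
    have : 2 ^ w' ≤ 2 ^ 11 := Nat.pow_le_pow_right (by norm_num) (by omega)
    omega
  obtain ⟨B, hB⟩ : ∃ B, B = 2 ^ (w' - 1) := ⟨_, rfl⟩
  have hBw : 2 * B = 2 ^ w' := by
    rw [hB, ← pow_succ']
    congr 1
    omega
  -- The reduction is simulated in the upper half of the memory, which the input does not reach.
  have hP := hK' w' (by omega)
  have hcode : CodeAt (verifier P c) 0 (saveCode 64 ++ (halfCode ++ ((verifierCmd P c).code 70 ++
    [.rIfZero 0 (70 + (verifierCmd P c).size + 2), .accept, .reject]))) :=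
    ⟨[], [], by simp [verifier], rfl⟩
  have r₁ := run_saveCode hP hcode.left (s := init x b) rfl
  have c₁ := hcode.right
  rw [show (saveCode 64).length = 64 by simp [saveCode]] at c₁
  obtain ⟨W, r₂, hW31, hW⟩ := run_halfCode hP (by omega) c₁.left (s := ⟨0 + 64,
    (init x b).W, fun i => if 4 ≤ i ∧ i < 4 + 64 then ((init x b).W (i - 4) : ℝ)
      else (init x b).R i⟩) rfl
  have c₂ := c₁.right
  obtain ⟨R, hR⟩ : ∃ R : ℕ → ℝ, R = fun i => if 4 ≤ i ∧ i < 4 + 64 then ((init x b).W (i - 4) : ℝ)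
      else (init x b).R i := ⟨_, rfl⟩
  rw [← hR] at r₁ r₂
  have hin : HasInput (b.getD · 0) B ⟨W, W, R, R⟩ := by
    refine ⟨fun p hp => ?_, fun p hp _ => hW p (by omega) (by omega)⟩
    simp only [hR]
    rw [if_pos (by omega), Nat.add_sub_cancel_left]
    rfl
  have hfree : ∀ i, W (B + i) = 0 := by
    intro i
    rw [hW _ (by omega) (by omega)]
    exact List.getD_eq_default _ _ (by omega)
  obtain ⟨s₀, hs₀⟩ : ∃ s₀ : Config, s₀ = ⟨0, fun a => if a < 2 * k then bitOf (b.getD · 0) a else 0,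
    fun _ => 0⟩ := ⟨_, rfl⟩
  rw [← hs₀]
  have hs₀w : ∀ a, s₀.W a < 2 ^ w := by
    intro a
    have := bitOf_le (b.getD · 0) a
    rw [hs₀]
    simp only
    split <;> omega
  have hE : Cmd.Ends w' (verifierCmd P c)
      ((k * 100 + 100) + ((10 * n ^ c + (powExpr (.var 0) c).len + 20) +
        ((n ^ c * ((dispatch 0 P).cost + 10) + 10) + (2 ^ w * 100 + 100))))
      (fun σ' => ∃ st, σ'.R 0 = ((List.range (2 ^ w)).map (trace P w s₀ (n ^ c)).W).foldr
        (evalSymbol fun i => x.getD (68 + i) 0) st 0) ⟨W, W, R, R⟩ := by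
    refine (parse_spec (k := k) hin (hW31.trans hB.symm) hfree (by omega) (by omega) hpos
      hend).seq' fun σ₁ h₁ => (sizes_spec (n := n) (c := c) (h₁.1.trans hn.symm) (by omega)
        (by omega)).seq' fun σ₂ h₂ => (simulate_spec (w := w) (B := B) (T := n ^ c) (S := R)
        (s := s₀) hK hword hs₀w (by rw [hs₀]) (by omega) (by omega) ?_).seq' fun σ₃ h₃ =>
        evaluate_spec h₃.size h₃.base (by omega) (by omega) h₃.mem (trace_words hs₀w _)
          fun i hi => ?_
    · obtain ⟨e6, e7, e9, e31, eM, eS⟩ := h₂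
      rw [← hw] at e7 e9
      refine ⟨by simpa using e6, by simpa using e7, by simpa using e9, by simp [hs₀],
        by simpa [h₁.2.1] using e31, fun a ha => ?_, eS.trans h₁.2.2.2⟩
      simp only [eM, h₁.2.2.1, hs₀]
    · rw [h₃.real, hR]
      simp only
      rw [if_neg (by omega)]
      rfl
  obtain ⟨σ', t, ht, hbig, st, hσ'⟩ := hE
  obtain ⟨s', r₃, hpc, hrel⟩ := hbig.run_code hP (verifierCmd_wf P c) (off := 70) c₂.left
    (s := { pc := 0 + 64 + 6, W := W, R := R }) rfl
    ⟨fun _ _ => rfl, fun _ _ => rfl, fun _ _ => rfl, fun _ _ => rfl⟩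
  have c₃ := c₂.right
  rw [Cmd.length_code] at c₃
  have r₄ := run_instr (s := s') hP c₃ hpc rfl
  refine ⟨64 + (6 + (t + 1)), by omega, _, st,
    run_trans r₁ (run_trans r₂ (run_trans r₃ r₄)), ?_⟩
  rw [← hσ', ← hrel.R 0 (by norm_num)]
  unfold Config.jumpIf
  by_cases h0 : s'.R 0 = 0
  · rw [if_pos h0, if_pos h0]
    exact c₃.tail.tail.head
  · rw [if_neg h0, if_neg h0]
    simp only [Config.jump, hpc]
    exact c₃.tail.head

/-- Registers after the input are zero, so that the search for the end of the instance terminates on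
all inputs. -/
theorem exists_first_zero_pair (b : List ℕ) :
    ∃ k, (∀ j < k, 0 < bitOf (b.getD · 0) (2 * j) + bitOf (b.getD · 0) (2 * j + 1)) ∧
      bitOf (b.getD · 0) (2 * k) + bitOf (b.getD · 0) (2 * k + 1) = 0 := by
  have h : ∃ k, bitOf (b.getD · 0) (2 * k) + bitOf (b.getD · 0) (2 * k + 1) = 0 := by
    refine ⟨b.length, ?_⟩
    have h₁ : b.getD (2 * b.length) 0 = 0 := List.getD_eq_default _ _ (by omega)
    have h₂ : b.getD (2 * b.length + 1) 0 = 0 := List.getD_eq_default _ _ (by omega)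
    simp only [bitOf]
    rw [if_pos h₁, if_pos h₂]
  classical
  exact ⟨Nat.find h, fun j hj => Nat.pos_of_ne_zero (Nat.find_min h hj), Nat.find_spec h⟩

open Classical in
/-- The behaviour of the verification algorithm on an instance: it accepts iff the formula holds at
the point given by the certificate. -/
theorem verifier_stopsAt_encode {P : Program} {c C : ℕ} {I : List ℤ} {φ : Formula} {t₀ : ℕ}
    {s₀ : Config} (ht₀ : t₀ ≤ (encode I).length ^ c)
    (hend₀ : StopsAt P (wordSize c (encode I).length) [] (encode I) t₀ s₀ .halt)
    (hout : s₀.Outputs (wordSize c (encode I).length) φ.code)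
    (hC : ∀ (x : List ℝ) (b : List ℕ), 2 ≤ x.length + b.length →
      ∀ k, (∀ j < k, 0 < bitOf (b.getD · 0) (2 * j) + bitOf (b.getD · 0) (2 * j + 1)) →
      bitOf (b.getD · 0) (2 * k) + bitOf (b.getD · 0) (2 * k + 1) = 0 →
      ∃ t ≤ (x.length + b.length) ^ (6 * c + C + 13), ∃ s st,
        StopsAt (verifier P c) (wordSize (6 * c + C + 13) (x.length + b.length)) x b t s
          (if ((List.range (2 ^ wordSize c (2 * k + 2))).map (trace P (wordSize c (2 * k + 2))
            ⟨0, fun a => if a < 2 * k then bitOf (b.getD · 0) a else 0, fun _ => 0⟩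
            ((2 * k + 2) ^ c)).W).foldr (evalSymbol fun i => x.getD (68 + i) 0) st 0 = 0
          then .reject else .accept)) (x : List ℝ) (z : List ℕ) :
    ∃ t s, StopsAt (verifier P c) (wordSize (6 * c + C + 13) (x.length + (encode I ++ z).length)) x
      (encode I ++ z) t s
      (if φ.Holds (fun i => x.getD (68 + i) 0) then .accept else .reject) := by
  obtain ⟨k, hk, hpos, hzero⟩ := encode_pairs I
  have hbit : ∀ a, a < (encode I).length →
      bitOf ((encode I ++ z).getD · 0) a = (encode I).getD a 0 := by
    intro a ha
    have h₁ : (encode I ++ z).getD a 0 = (encode I).getD a 0 := List.getD_append _ _ _ _ ha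
    simp only [bitOf, h₁]
    rcases getD_bits (encode_bits (I := I)) a with h | h <;> simp only [h] <;> rfl
  obtain ⟨t, -, s, st, hs⟩ := hC x (encode I ++ z) (by rw [List.length_append]; omega) k
    (fun j hj => by
      rw [hbit _ (by omega), hbit _ (by omega)]; exact hpos j hj)
    (by rw [hbit _ (by omega), hbit _ (by omega), hzero _ le_rfl, hzero _ (by omega)])
  have hinit : (⟨0, fun a => if a < 2 * k then bitOf ((encode I ++ z).getD · 0) a else 0,
      fun _ => 0⟩ : Config) = init [] (encode I) := by
    unfold init
    congr 1
    funext a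
    split
    · exact hbit a (by omega)
    · exact (hzero a (by omega)).symm
  rw [hinit, ← hk, trace_of_le hend₀ (Or.inl rfl) ht₀] at hs
  obtain ⟨L, hL⟩ : ∃ L, (List.range (2 ^ wordSize c (encode I).length)).map s₀.W = φ.code ++ L := by
    obtain ⟨hlen, hget⟩ := hout
    refine ⟨((List.range (2 ^ wordSize c (encode I).length)).map s₀.W).drop φ.code.length, ?_⟩
    conv_lhs => rw [← List.take_append_drop φ.code.length ((List.range _).map s₀.W)]
    congr 1
    refine List.ext_getElem (by simpa using hlen) fun i h₁ h₂ => ?_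
    simp [hget i h₂]
  rw [hL, foldr_evalSymbol_formula] at hs
  refine ⟨t, s, ?_⟩
  convert hs using 1
  simp [push]

theorem InExistsR.hasRealVerifier {Q : DecisionProblem} (h : InExistsR Q) (allowSqrt : Bool) :
    HasRealVerifier allowSqrt Q := by
  classical
  obtain ⟨P, c, hc, hword, hI⟩ := h
  obtain ⟨C, hC⟩ := verifier_stopsAt hword hc
  refine ⟨verifier P c, 6 * c + C + 13, by omega, fun _ => verifier_not_isSqrt P c, ⟨?_, ?_, ?_⟩⟩
  · intro x b hN _
    obtain ⟨k, hpos, hend⟩ := exists_first_zero_pair b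
    obtain ⟨t, ht, s, st, hs⟩ := hC x b hN k hpos hend
    refine ⟨t, ht, s, ?_⟩
    split at hs
    · exact Or.inr (Or.inr hs)
    · exact Or.inr (Or.inl hs)
  · intro I hQ
    obtain ⟨φ, hφ, t₀, ht₀, s₀, hend₀, hout⟩ := hI I
    obtain ⟨v, hv⟩ := hφ.2 hQ
    have hn := two_le_length_encode I
    obtain ⟨n, hndef⟩ : ∃ n, n = (encode I).length := ⟨_, rfl⟩
    -- Only variables that fit into the memory of the word RAM can occur in the formula.
    let x : List ℝ := (List.range (68 + 2 ^ wordSize c n)).map fun a => v (a - 68)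
    have hxv : φ.Holds (fun i => x.getD (68 + i) 0) := by
      have hcode : ∀ a ∈ φ.code, a < 2 ^ wordSize c n := by
        intro a ha
        obtain ⟨i, hi, rfl⟩ := List.getElem_of_mem ha
        rw [← hout.2 i hi, hndef]
        have := trace_words (P := P) (w := wordSize c (encode I).length)
          (s := init [] (encode I)) (init_words fun u hu => ?_) t₀ i
        · rwa [trace_of_run hend₀.1] at this
        · have := two_le_two_pow_wordSize (N := (encode I).length) hc hn
          rcases encode_bits u hu with h | h <;> omega
      have key : φ.code.foldr (evalSymbol fun i => x.getD (68 + i) 0) (fun _ => 0) =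
          φ.code.foldr (evalSymbol v) (fun _ => 0) := by
        refine List.foldr_ext _ _ _ fun a ha st => ?_
        unfold evalSymbol
        by_cases h9 : 9 < a
        · rw [if_pos h9, if_pos h9]
          have := hcode a ha
          have hx : x.getD (68 + (a - 10)) 0 = v (a - 10) := by
            rw [List.getD_eq_getElem _ _ (by simp [x]; omega)]
            simp [x]
          exact congrArg (push · st) hx
        · rw [if_neg h9, if_neg h9]
      have h₁ := foldr_evalSymbol_formula (fun i => x.getD (68 + i) 0) φ [] (fun _ => 0)
      have h₂ := foldr_evalSymbol_formula v φ [] (fun _ => 0)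
      rw [List.append_nil] at h₁ h₂
      rw [h₁, h₂] at key
      have := congrFun key 0
      simp only [push, if_pos hv] at this
      by_contra hcon
      rw [if_neg hcon] at this
      exact zero_ne_one this
    refine ⟨x, [], ?_, by simp, by simp, ?_⟩
    · have h₁ := two_pow_wordSize_lt (c := c) hn
      have h₂ : 2 ^ 7 ≤ n ^ 7 := Nat.pow_le_pow_left (hndef ▸ hn) _
      have h₃ : 1 ≤ n ^ c := Nat.one_le_pow _ _ (by omega)
      rw [← hndef] at h₁ ⊢
      calc x.length = 68 + 2 ^ wordSize c n := by simp [x]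
        _ ≤ n ^ c * 2 ^ 7 := by omega
        _ ≤ n ^ c * n ^ 7 := Nat.mul_le_mul_left _ h₂
        _ = n ^ (c + 7) := (pow_add _ _ _).symm
        _ ≤ n ^ (6 * c + C + 13) := Nat.pow_le_pow_right (by omega) (by omega)
    · obtain ⟨t, s, hs⟩ := verifier_stopsAt_encode ht₀ hend₀ hout hC x []
      rw [if_pos hxv] at hs
      exact ⟨t, s, hs⟩
  · intro I hQ x z _
    obtain ⟨φ, hφ, t₀, ht₀, s₀, hend₀, hout⟩ := hI I
    obtain ⟨t, s, hs⟩ := verifier_stopsAt_encode ht₀ hend₀ hout hC x z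
    -- A certificate that is accepted would be a solution of the formula.
    rw [if_neg] at hs
    · exact ⟨t, s, hs⟩
    · intro hcon
      have := hφ.1 ⟨_, hcon⟩
      rw [hQ] at this
      cases this

end RealRAM

theorem mainTheorem1 (Q : RealRAM.DecisionProblem) (allowSqrt : Bool) :
    RealRAM.HasRealVerifier allowSqrt Q ↔ RealRAM.InExistsR Q :=
  ⟨fun ⟨_, _, hc, _, h⟩ => h.inExistsR hc, fun h => h.hasRealVerifier allowSqrt⟩
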